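/- Let $\Sigma=(\Sigma_0,\Sigma_1)$ be a signature: a set $\Sigma_0$ of generating objects and a set $\Sigma_1$ of operations $d\colon \mathrm{ar}(d)\to\mathrm{coar}(d)$, where $\mathrm{ar}(d),\mathrm{coar}(d)\in\Sigma_0^\star$ are words. **Syntax.** Let $\Sigma+\mathsf{scFrob}$ be $\Sigma$ together with, for each $x\in\Sigma_0$, four new operations $\delta_x\colon x\to xx$, $\epsilon_x\colon x\to\varepsilon$, $\mu_x\colon xx\to x$, $\eta_x\colon\varepsilon\to x$ ($\varepsilon$ is the empty word). Terms over a signature are generated from its operations, the identities $\mathrm{id}_x\colon x\to x$, the symmetries $\sigma_{x,y}\colon xy\to yx$ ($x,y\in\Sigma_0$) and the empty diagram $\varepsilon\to\varepsilon$, under sequential composition $c\,;d$ and parallel composition $c\otimes d$. Let $\mathbf{F}=\mathsf{FreeSMC}(\Sigma+\mathsf{scFrob})$ be the strict symmetric monoidal category whose objects are the words in $\Sigma_0^\star$, with concatenation as tensor product, and whose morphisms $v\to w$ are the terms of type $v\to w$ over $\Sigma+\mathsf{scFrob}$ modulo the smallest congruence containing the laws of strict symmetric monoidal categories and, for each $x$,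 the axioms of special commutative Frobenius structures: $(\delta_x,\epsilon_x)$ is a cocommutative comonoid (coassociative, left and right counital), $(\mu_x,\eta_x)$ is a commutative monoid (associative, left and right unital), $(\delta_x\otimes \mathrm{id}_x);(\mathrm{id}_x\otimes\mu_x)=\mu_x;\delta_x=(\mathrm{id}_x\otimes\delta_x);(\mu_x\otimes \mathrm{id}_x)$, and $\delta_x;\mu_x=\mathrm{id}_x$. **Open hypergraphs.** A $\Sigma$-labelled hypergraph consists of finite sets of nodes and of hyperedges, a label in $\Sigma_0$ for each node and a label in $\Sigma_1$ for each hyperedge, and for each hyperedge labelled $d$ a list of source nodes and a list of target nodes whose words of labels are $\mathrm{ar}(d)$ and $\mathrm{coar}(d)$. A homomorphism is a pair of maps, on nodes and on hyperedges, preserving labels, sources and targets. The discrete hypergraph on a word $w$ has one node for each position of $w$, labelled by the letter there, and no hyperedges. An open hypergraph $v\to w$ is a cospan of hypergraph homomorphisms $v\xrightarrow{p}G\xleftarrow{q}w$ whose feet are the discrete hypergraphs on $v$ and $w$. Let $\mathsf{Hyp}_\Sigma$ be the strict symmetric monoidal category whose objects are the words in $\Sigma_0^\star$ and whose morphisms $v\to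 w$ are the isomorphism classes of open hypergraphs $v\to w$ (isomorphisms of carriers commuting with $p$ and $q$), with composition by pushout over the common foot, tensor product by concatenation of words and disjoint union of carriers, and the evident identities and symmetries on discrete hypergraphs. **Interpretation.** Define $[\![t]\!]\colon v\to w$ in $\mathsf{Hyp}_\Sigma$ for every term $t\colon v\to w$ over $\Sigma+\mathsf{scFrob}$ by induction. An operation $d\in\Sigma_1$ goes to the hypergraph with a single hyperedge labelled $d$ and $|\mathrm{ar}(d)|+|\mathrm{coar}(d)|$ distinct nodes, namely its sources, which form the left interface in order, and its targets, which form the right interface in order. Each of $\delta_x,\epsilon_x,\mu_x,\eta_x$ goes to the discrete hypergraph with one node labelled $x$, to which all positions of both interfaces are sent. Identities, symmetries, the empty diagram and the two compositions go to those of $\mathsf{Hyp}_\Sigma$. **Theorem.** The interpretation $[\![-]\!]$ induces an isomorphism of strict symmetric monoidal categories $\mathsf{FreeSMC}(\Sigma+\mathsf{scFrob})\cong\mathsf{Hyp}_\Sigma$. That is, there are mutually inverse strict symmetric monoidal functors $F\colon\mathbf{F}\to\mathsf{Hyp}_\Sigma$ and $G\colon\mathsf{Hyp}_\Sigma\to\mathbf{F}$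 such that $F$ is the identity on objects and sends the class of each term $t$ to $[\![t]\!]$. In particular, string diagrams over $\Sigma+\mathsf{scFrob}$ modulo the axioms of special commutative Frobenius structures are in one-to-one correspondence with $\Sigma$-labelled open hypergraphs up to isomorphism. -/

import Mathlib

open CategoryTheory

universe u v

namespace StringDiag

/-! ### Strict symmetric monoidal categories and strict symmetric monoidal functors -/

/-- A strict symmetric monoidal category. Morphisms whose source and target agree only up to the
(propositional) equality of objects are compared by heterogeneous equality or `eqToHom`. -/
class StrictSMC (C : Type u) extends Category.{v} C where
  tensorObj : C → C → C
  unit : C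
  tensorHom {X₁ Y₁ X₂ Y₂ : C} (f : X₁ ⟶ Y₁) (g : X₂ ⟶ Y₂) : tensorObj X₁ X₂ ⟶ tensorObj Y₁ Y₂
  symm (X Y : C) : tensorObj X Y ⟶ tensorObj Y X
  tensorObj_assoc (X Y Z : C) : tensorObj (tensorObj X Y) Z = tensorObj X (tensorObj Y Z)
  unit_tensorObj (X : C) : tensorObj unit X = X
  tensorObj_unit (X : C) : tensorObj X unit = X
  tensorHom_id (X Y : C) : tensorHom (𝟙 X) (𝟙 Y) = 𝟙 (tensorObj X Y)
  tensorHom_comp {X₁ Y₁ Z₁ X₂ Y₂ Z₂ : C} (c₁ : X₁ ⟶ Y₁) (d₁ : Y₁ ⟶ Z₁) (c₂ : X₂ ⟶ Y₂)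
    (d₂ : Y₂ ⟶ Z₂) : tensorHom c₁ c₂ ≫ tensorHom d₁ d₂ = tensorHom (c₁ ≫ d₁) (c₂ ≫ d₂)
  tensorHom_assoc {X₁ Y₁ X₂ Y₂ X₃ Y₃ : C} (c₁ : X₁ ⟶ Y₁) (c₂ : X₂ ⟶ Y₂) (c₃ : X₃ ⟶ Y₃) :
    HEq (tensorHom (tensorHom c₁ c₂) c₃) (tensorHom c₁ (tensorHom c₂ c₃))
  unit_tensorHom {X Y : C} (c : X ⟶ Y) : HEq (tensorHom (𝟙 unit) c) c
  tensorHom_unit {X Y : C} (c : X ⟶ Y) : HEq (tensorHom c (𝟙 unit)) c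
  symm_natural (X : C) {Y Z : C} (c : Y ⟶ Z) :
    tensorHom (𝟙 X) c ≫ symm X Z = symm X Y ≫ tensorHom c (𝟙 X)
  symm_symm (X Y : C) : symm X Y ≫ symm Y X = 𝟙 (tensorObj X Y)
  symm_tensor (X Y Z : C) :
    HEq (symm X (tensorObj Y Z))
      (tensorHom (symm X Y) (𝟙 Z) ≫ eqToHom (tensorObj_assoc Y X Z) ≫
        tensorHom (𝟙 Y) (symm X Z))

/-- A functor between strict symmetric monoidal categories is a strict symmetric monoidal functor
if it preserves the tensor product, the unit and the symmetries on the nose. -/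
structure IsStrictSymmetricMonoidal {C : Type*} [StrictSMC C] {D : Type*} [StrictSMC D]
    (F : C ⥤ D) : Prop where
  obj_tensor (X Y : C) :
    F.obj (StrictSMC.tensorObj X Y) = StrictSMC.tensorObj (F.obj X) (F.obj Y)
  obj_unit : F.obj StrictSMC.unit = StrictSMC.unit
  map_tensor {X₁ Y₁ X₂ Y₂ : C} (f : X₁ ⟶ Y₁) (g : X₂ ⟶ Y₂) :
    HEq (F.map (StrictSMC.tensorHom f g)) (StrictSMC.tensorHom (F.map f) (F.map g))
  map_symm (X Y : C) :
    HEq (F.map (StrictSMC.symm X Y)) (StrictSMC.symm (F.obj X) (F.obj Y))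

/-! ### Signatures, terms and string diagrams -/

set_option linter.checkUnivs false in
/-- A signature: generating objects, and operations whose arity and coarity are words of
generating objects. -/
structure Signature where
  Obj : Type u
  Op : Type v
  arity : Op → List Obj
  coarity : Op → List Obj

/-- Terms over a signature, of type `v ⟶ w` for words `v`, `w` of generating objects. -/
inductive Term (S : Signature.{u, v}) : List S.Obj → List S.Obj → Type (max u v)
  | op (d : S.Op) : Term S (S.arity d) (S.coarity d)
  | idn (x : S.Obj) : Term S [x] [x]
  | swap (x y : S.Obj) : Term S [x, y] [y, x]
  | null : Term S [] []
  | seq {u v w : List S.Obj} (c : Term S u v) (d : Term S v w) : Term S u w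
  | par {v₁ w₁ v₂ w₂ : List S.Obj} (c : Term S v₁ w₁) (d : Term S v₂ w₂) :
      Term S (v₁ ++ v₂) (w₁ ++ w₂)

namespace Term

variable {S : Signature.{u, v}}

/-- Transport of a term along equalities of words. -/
def cast {v v' w w' : List S.Obj} (hv : v = v') (hw : w = w') (t : Term S v w) : Term S v' w' :=
  hv ▸ hw ▸ t

/-- The identity on a word. -/
def idWord : (w : List S.Obj) → Term S w w
  | [] => null
  | x :: w => par (idn x) (idWord w)

/-- The symmetry exchanging one wire with a word. -/
def swapWire (x : S.Obj) : (w : List S.Obj) → Term S (x :: w) (w ++ [x])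
  | [] => idn x
  | y :: w => seq (par (swap x y) (idWord w)) (par (idn y) (swapWire x w) :)

/-- The symmetry exchanging two words. -/
def swapWord : (v w : List S.Obj) → Term S (v ++ w) (w ++ v)
  | [], w => cast rfl (List.append_nil w).symm (idWord w)
  | x :: v, w => seq (par (idn x) (swapWord v w) :)
      (cast rfl (List.append_assoc w [x] v) (par (v₁ := x :: w) (swapWire x w) (idWord v)))

end Term

/-- An equational theory over a signature, given by pairs of terms (representing string diagrams)
with the same arity and the same coarity. -/
abbrev Theory (S : Signature.{u, v}) : Type (max u v) :=
  ∀ v w : List S.Obj, Term S v w → Term S v w → Prop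

/-- The smallest congruence on terms that contains the laws of symmetric monoidal categories and
the axioms of the theory `E`. -/
inductive TermRel {S : Signature.{u, v}} (E : Theory S) :
    ∀ {v w : List S.Obj}, Term S v w → Term S v w → Prop
  | ax {v w : List S.Obj} {s t : Term S v w} (h : E v w s t) : TermRel E s t
  | refl {v w : List S.Obj} (t : Term S v w) : TermRel E t t
  | symm {v w : List S.Obj} {s t : Term S v w} (h : TermRel E s t) : TermRel E t s
  | trans {v w : List S.Obj} {r s t : Term S v w} (h : TermRel E r s) (h' : TermRel E s t) :
      TermRel E r t
  | seq_congr {u v w : List S.Obj} {c c' : Term S u v} {d d' : Term S v w}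
      (h : TermRel E c c') (h' : TermRel E d d') : TermRel E (c.seq d) (c'.seq d')
  | par_congr {v₁ w₁ v₂ w₂ : List S.Obj} {c c' : Term S v₁ w₁} {d d' : Term S v₂ w₂}
      (h : TermRel E c c') (h' : TermRel E d d') : TermRel E (c.par d) (c'.par d')
  | seq_assoc {u v w z : List S.Obj} (a : Term S u v) (b : Term S v w) (c : Term S w z) :
      TermRel E ((a.seq b).seq c) (a.seq (b.seq c))
  | id_seq {v w : List S.Obj} (c : Term S v w) : TermRel E ((Term.idWord v).seq c) c
  | seq_id {v w : List S.Obj} (c : Term S v w) : TermRel E (c.seq (Term.idWord w)) c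
  | interchange {u₁ v₁ w₁ u₂ v₂ w₂ : List S.Obj} (c₁ : Term S u₁ v₁) (d₁ : Term S v₁ w₁)
      (c₂ : Term S u₂ v₂) (d₂ : Term S v₂ w₂) :
      TermRel E ((c₁.par c₂).seq (d₁.par d₂)) ((c₁.seq d₁).par (c₂.seq d₂))
  | par_assoc {v₁ w₁ v₂ w₂ v₃ w₃ : List S.Obj} (c₁ : Term S v₁ w₁) (c₂ : Term S v₂ w₂)
      (c₃ : Term S v₃ w₃) :
      TermRel E (((c₁.par c₂).par c₃).cast (List.append_assoc v₁ v₂ v₃)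
        (List.append_assoc w₁ w₂ w₃)) (c₁.par (c₂.par c₃))
  | null_par {v w : List S.Obj} (c : Term S v w) : TermRel E (Term.null.par c) c
  | par_null {v w : List S.Obj} (c : Term S v w) :
      TermRel E ((c.par Term.null).cast (List.append_nil v) (List.append_nil w)) c
  | swap_natural (u : List S.Obj) {v w : List S.Obj} (c : Term S v w) :
      TermRel E (((Term.idWord u).par c).seq (Term.swapWord u w))
        ((Term.swapWord u v).seq (c.par (Term.idWord u)))
  | swap_swap (v w : List S.Obj) :
      TermRel E ((Term.swapWord v w).seq (Term.swapWord w v)) (Term.idWord (v ++ w))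

/-- Terms modulo the laws of symmetric monoidal categories and the axioms of `E`. -/
def termSetoid {S : Signature.{u, v}} (E : Theory S) (v w : List S.Obj) :
    Setoid (Term S v w) where
  r := TermRel E
  iseqv := ⟨TermRel.refl, TermRel.symm, TermRel.trans⟩

/-- String diagrams of type `v ⟶ w` over a signature, modulo the theory `E`. -/
def Diagram {S : Signature.{u, v}} (E : Theory S) (v w : List S.Obj) : Type (max u v) :=
  Quotient (termSetoid E v w)

namespace Diagram

variable {S : Signature.{u, v}} {E : Theory S}

/-- The string diagram represented by a term. -/
def mk (E : Theory S) {v w : List S.Obj} (t : Term S v w) : Diagram E v w :=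
  Quotient.mk (termSetoid E v w) t

/-- Sequential composition of string diagrams. -/
def seq {u v w : List S.Obj} (c : Diagram E u v) (d : Diagram E v w) : Diagram E u w :=
  Quotient.map₂ Term.seq (fun _ _ h _ _ h' => TermRel.seq_congr h h') c d

/-- Parallel composition of string diagrams. -/
def par {v₁ w₁ v₂ w₂ : List S.Obj} (c : Diagram E v₁ w₁) (d : Diagram E v₂ w₂) :
    Diagram E (v₁ ++ v₂) (w₁ ++ w₂) :=
  Quotient.map₂ Term.par (fun _ _ h _ _ h' => TermRel.par_congr h h') c d

theorem mk_cast_heq {v v' w w' : List S.Obj} (hv : v = v') (hw : w = w') (t : Term S v w) :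
    HEq (mk E (t.cast hv hw)) (mk E t) := by
  subst hv hw
  rfl

theorem par_heq {u u' v v' w w' z z' : List S.Obj} (hu : u = u') (hv : v = v') (hw : w = w')
    (hz : z = z') {c : Diagram E u v} {c' : Diagram E u' v'} {d : Diagram E w z}
    {d' : Diagram E w' z'} (hc : HEq c c') (hd : HEq d d') : HEq (c.par d) (c'.par d') := by
  subst hu hv hw hz hc hd
  rfl

theorem seq_assoc {u v w z : List S.Obj} (a : Diagram E u v) (b : Diagram E v w)
    (c : Diagram E w z) : (a.seq b).seq c = a.seq (b.seq c) := by
  induction a using Quotient.inductionOn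
  induction b using Quotient.inductionOn
  induction c using Quotient.inductionOn
  exact Quotient.sound (TermRel.seq_assoc _ _ _)

theorem id_seq {v w : List S.Obj} (c : Diagram E v w) :
    (mk E (Term.idWord v)).seq c = c := by
  induction c using Quotient.inductionOn
  exact Quotient.sound (TermRel.id_seq _)

theorem seq_id {v w : List S.Obj} (c : Diagram E v w) :
    c.seq (mk E (Term.idWord w)) = c := by
  induction c using Quotient.inductionOn
  exact Quotient.sound (TermRel.seq_id _)

theorem interchange {u₁ v₁ w₁ u₂ v₂ w₂ : List S.Obj} (c₁ : Diagram E u₁ v₁)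
    (d₁ : Diagram E v₁ w₁) (c₂ : Diagram E u₂ v₂) (d₂ : Diagram E v₂ w₂) :
    (c₁.par c₂).seq (d₁.par d₂) = (c₁.seq d₁).par (c₂.seq d₂) := by
  induction c₁ using Quotient.inductionOn
  induction c₂ using Quotient.inductionOn
  induction d₁ using Quotient.inductionOn
  induction d₂ using Quotient.inductionOn
  exact Quotient.sound (TermRel.interchange _ _ _ _)

theorem par_assoc {v₁ w₁ v₂ w₂ v₃ w₃ : List S.Obj} (c₁ : Diagram E v₁ w₁)
    (c₂ : Diagram E v₂ w₂) (c₃ : Diagram E v₃ w₃) :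
    HEq ((c₁.par c₂).par c₃) (c₁.par (c₂.par c₃)) := by
  induction c₁ using Quotient.inductionOn with | _ c₁ => ?_
  induction c₂ using Quotient.inductionOn with | _ c₂ => ?_
  induction c₃ using Quotient.inductionOn with | _ c₃ => ?_
  exact (mk_cast_heq (List.append_assoc v₁ v₂ v₃) (List.append_assoc w₁ w₂ w₃) _).symm.trans
    (heq_of_eq (Quotient.sound (TermRel.par_assoc c₁ c₂ c₃)))

theorem null_par {v w : List S.Obj} (c : Diagram E v w) : (mk E Term.null).par c = c := by
  induction c using Quotient.inductionOn
  exact Quotient.sound (TermRel.null_par _)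

theorem par_null {v w : List S.Obj} (c : Diagram E v w) : HEq (c.par (mk E Term.null)) c := by
  induction c using Quotient.inductionOn with | _ c => ?_
  exact (mk_cast_heq (List.append_nil v) (List.append_nil w) _).symm.trans
    (heq_of_eq (Quotient.sound (TermRel.par_null c)))

theorem par_id (v w : List S.Obj) :
    (mk E (Term.idWord v)).par (mk E (Term.idWord w)) = mk E (Term.idWord (v ++ w)) := by
  induction v with
  | nil => exact null_par _
  | cons x v ih =>
    have h : (mk E (Term.idWord (x :: v))).par (mk E (Term.idWord w)) =
        (mk E (Term.idn x)).par ((mk E (Term.idWord v)).par (mk E (Term.idWord w))) :=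
      eq_of_heq (par_assoc (mk E (Term.idn x)) (mk E (Term.idWord v)) (mk E (Term.idWord w)))
    rw [h, ih]
    rfl

theorem idn_seq {x : S.Obj} {w : List S.Obj} (c : Diagram E [x] w) :
    (mk E (Term.idn x)).seq c = c := by
  have h : mk E (Term.idn x) = mk E (Term.idWord [x]) :=
    (eq_of_heq (par_null (mk E (Term.idn x)))).symm
  rw [h, id_seq]

/-- Sequential composition of diagrams whose middle words are only propositionally equal. -/
def seqE {u v v' w : List S.Obj} (c : Diagram E u v) (h : v = v') (d : Diagram E v' w) :
    Diagram E u w :=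
  c.seq (h ▸ d)

theorem seqE_rfl {u v w : List S.Obj} (c : Diagram E u v) (h : v = v) (d : Diagram E v w) :
    c.seqE h d = c.seq d := rfl

theorem seqE_heq {u₁ v₁ v₁' w₁ u₂ v₂ v₂' w₂ : List S.Obj} (hu : u₁ = u₂) (hv : v₁ = v₂)
    (hv' : v₁' = v₂') (hw : w₁ = w₂) {c₁ : Diagram E u₁ v₁} {h₁ : v₁ = v₁'}
    {d₁ : Diagram E v₁' w₁} {c₂ : Diagram E u₂ v₂} {h₂ : v₂ = v₂'} {d₂ : Diagram E v₂' w₂}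
    (hc : HEq c₁ c₂) (hd : HEq d₁ d₂) : HEq (c₁.seqE h₁ d₁) (c₂.seqE h₂ d₂) := by
  subst hu hv hv' hw hc hd
  rfl

theorem seqE_assoc {a b b' c c' d : List S.Obj} (f : Diagram E a b) (h : b = b')
    (g : Diagram E b' c) (h' : c = c') (k : Diagram E c' d) :
    (f.seqE h g).seqE h' k = f.seqE h (g.seqE h' k) := by
  subst h h'
  exact seq_assoc _ _ _

theorem seqE_four {a b b' c c' d d' e : List S.Obj} (f : Diagram E a b) (h : b = b')
    (g : Diagram E b' c) (h' : c = c') (k : Diagram E c' d) (h'' : d = d') (l : Diagram E d' e) :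
    (f.seqE h g).seqE h' (k.seqE h'' l) = f.seqE h ((g.seqE h' k).seqE h'' l) := by
  subst h h' h''
  simp only [seqE_rfl, seq_assoc]

theorem par_seqE {u₁ v₁ v₁' w₁ u₂ v₂ v₂' w₂ : List S.Obj} (c₁ : Diagram E u₁ v₁)
    (h₁ : v₁ = v₁') (d₁ : Diagram E v₁' w₁) (c₂ : Diagram E u₂ v₂) (h₂ : v₂ = v₂')
    (d₂ : Diagram E v₂' w₂) (h : v₁ ++ v₂ = v₁' ++ v₂') :
    (c₁.seqE h₁ d₁).par (c₂.seqE h₂ d₂) = (c₁.par c₂).seqE h (d₁.par d₂) := by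
  subst h₁ h₂
  exact (interchange _ _ _ _).symm

/-- The interchange of a wire with a concatenation of two words. -/
theorem swapWire_append (x : S.Obj) (v w : List S.Obj) :
    HEq (mk E (Term.swapWire x (v ++ w)))
      (((mk E (Term.swapWire x v)).par (mk E (Term.idWord w))).seqE (List.append_assoc v [x] w)
        ((mk E (Term.idWord v)).par (mk E (Term.swapWire x w)))) := by
  induction v with
  | nil =>
    have h : ((mk E (Term.swapWire x [])).par (mk E (Term.idWord w))).seqE
        (List.append_assoc [] [x] w) ((mk E (Term.idWord [])).par (mk E (Term.swapWire x w))) =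
        (mk E (Term.idWord (x :: w))).seq ((mk E Term.null).par (mk E (Term.swapWire x w))) := rfl
    rw [h, null_par, id_seq]
    rfl
  | cons y v ih =>
    have hA : mk E (Term.swapWire x (y :: (v ++ w))) =
        ((mk E (Term.swap x y)).par (mk E (Term.idWord (v ++ w)))).seqE (by rfl)
          ((mk E (Term.idn y)).par (mk E (Term.swapWire x (v ++ w)))) := rfl
    have hB : mk E (Term.swapWire x (y :: v)) =
        ((mk E (Term.swap x y)).par (mk E (Term.idWord v))).seqE (by rfl)
          ((mk E (Term.idn y)).par (mk E (Term.swapWire x v))) := rfl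
    have hy : (mk E (Term.idn y)).seqE rfl (mk E (Term.idn y)) = mk E (Term.idn y) := idn_seq _
    have hw : (mk E (Term.idWord w)).seqE rfl (mk E (Term.idWord w)) = mk E (Term.idWord w) :=
      id_seq _
    have h₁ : HEq (mk E (Term.idn y) |>.par (mk E (Term.swapWire x (v ++ w))))
        (((mk E (Term.idn y)).par ((mk E (Term.swapWire x v)).par (mk E (Term.idWord w)))).seqE
          (by simp)
          ((mk E (Term.idn y)).par ((mk E (Term.idWord v)).par (mk E (Term.swapWire x w))))) := by
      rw [← par_seqE _ rfl _ _ (List.append_assoc v [x] w) _, hy]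
      exact par_heq rfl rfl rfl (by simp) HEq.rfl ih
    have h₂ : HEq ((mk E (Term.swap x y)).par (mk E (Term.idWord (v ++ w))))
        (((mk E (Term.swap x y)).par (mk E (Term.idWord v))).par (mk E (Term.idWord w))) := by
      rw [← par_id]
      exact (par_assoc _ _ _).symm
    have h₃ : HEq ((mk E (Term.idn y)).par ((mk E (Term.swapWire x v)).par (mk E (Term.idWord w))))
      (((mk E (Term.idn y)).par (mk E (Term.swapWire x v))).par (mk E (Term.idWord w))) :=
      (par_assoc _ _ _).symm
    have h₄ : HEq ((mk E (Term.idn y)).par ((mk E (Term.idWord v)).par (mk E (Term.swapWire x w))))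
      ((mk E (Term.idWord (y :: v))).par (mk E (Term.swapWire x w))) :=
      (par_assoc (mk E (Term.idn y)) (mk E (Term.idWord v)) _).symm
    refine (heq_of_eq hA).trans ?_
    refine (seqE_heq (u₂ := (([x] ++ [y]) ++ v) ++ w) (v₂ := (([y] ++ [x]) ++ v) ++ w)
      (v₂' := [y] ++ (([x] ++ v) ++ w)) (w₂ := [y] ++ (v ++ (w ++ [x])))
      rfl rfl rfl (by simp) h₂ h₁ (h₂ := rfl)).trans ?_
    rw [← seqE_assoc]
    refine seqE_heq rfl (by simp) (by simp) rfl ?_ h₄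
    rw [hB]
    conv_rhs => rw [← hw]
    rw [par_seqE _ _ _ _ _ _ (by rfl)]
    exact seqE_heq rfl rfl rfl (by simp) HEq.rfl h₃

theorem swapWord_cons (x : S.Obj) (v w : List S.Obj) :
    HEq (mk E (Term.swapWord (x :: v) w))
      (((mk E (Term.idn x)).par (mk E (Term.swapWord v w))).seqE (by rfl)
        ((mk E (Term.swapWire x w)).par (mk E (Term.idWord v)))) := by
  have h : mk E (Term.swapWord (x :: v) w) =
      ((mk E (Term.idn x)).par (mk E (Term.swapWord v w))).seqE (by rfl)
        (mk E (Term.cast rfl (List.append_assoc w [x] v)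
          (Term.par (v₁ := x :: w) (Term.swapWire x w) (Term.idWord v)))) := rfl
  exact (heq_of_eq h).trans (seqE_heq rfl rfl rfl (List.append_assoc w [x] v).symm HEq.rfl
    (mk_cast_heq rfl (List.append_assoc w [x] v) _))

theorem swap_step {x u v w : List S.Obj} (P : Diagram E (u ++ v) (v ++ u))
    (Q : Diagram E (u ++ w) (w ++ u)) (s : Diagram E (x ++ v) (v ++ x))
    (t : Diagram E (x ++ w) (w ++ x)) :
    HEq (((mk E (Term.idWord x)).par ((P.par (mk E (Term.idWord w))).seqE
          (List.append_assoc v u w) ((mk E (Term.idWord v)).par Q))).seqE (by simp)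
        (((s.par (mk E (Term.idWord w))).seqE (List.append_assoc v x w)
          ((mk E (Term.idWord v)).par t)).par (mk E (Term.idWord u))))
      (((((mk E (Term.idWord x)).par P).seqE (List.append_assoc x v u).symm
          (s.par (mk E (Term.idWord u)))).par (mk E (Term.idWord w))).seqE (by simp)
        ((mk E (Term.idWord v)).par (((mk E (Term.idWord x)).par Q).seqE
          (List.append_assoc x w u).symm (t.par (mk E (Term.idWord u)))))) := by
  have hi (z : List S.Obj) : (mk E (Term.idWord z)).seqE rfl (mk E (Term.idWord z)) =
    mk E (Term.idWord z) := id_seq _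
  have e₁ : (mk E (Term.idWord x)).par ((P.par (mk E (Term.idWord w))).seqE
          (List.append_assoc v u w) ((mk E (Term.idWord v)).par Q)) =
      ((mk E (Term.idWord x)).par (P.par (mk E (Term.idWord w)))).seqE (by simp)
        ((mk E (Term.idWord x)).par ((mk E (Term.idWord v)).par Q)) := by
    conv_lhs => rw [← hi x]
    exact par_seqE _ _ _ _ _ _ _
  have e₂ : ((s.par (mk E (Term.idWord w))).seqE (List.append_assoc v x w)
          ((mk E (Term.idWord v)).par t)).par (mk E (Term.idWord u)) =
      ((s.par (mk E (Term.idWord w))).par (mk E (Term.idWord u))).seqE (by simp)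
        (((mk E (Term.idWord v)).par t).par (mk E (Term.idWord u))) := by
    conv_lhs => rw [← hi u]
    exact par_seqE _ _ _ _ _ _ _
  have e₃ : (((mk E (Term.idWord x)).par P).seqE (List.append_assoc x v u).symm
          (s.par (mk E (Term.idWord u)))).par (mk E (Term.idWord w)) =
      (((mk E (Term.idWord x)).par P).par (mk E (Term.idWord w))).seqE (by simp)
        ((s.par (mk E (Term.idWord u))).par (mk E (Term.idWord w))) := by
    conv_lhs => rw [← hi w]
    exact par_seqE _ _ _ _ _ _ _
  have e₄ : (mk E (Term.idWord v)).par (((mk E (Term.idWord x)).par Q).seqE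
          (List.append_assoc x w u).symm (t.par (mk E (Term.idWord u)))) =
      ((mk E (Term.idWord v)).par ((mk E (Term.idWord x)).par Q)).seqE (by simp)
        ((mk E (Term.idWord v)).par (t.par (mk E (Term.idWord u)))) := by
    conv_lhs => rw [← hi v]
    exact par_seqE _ _ _ _ _ _ _
  have m₁ : HEq (((mk E (Term.idWord x)).par ((mk E (Term.idWord v)).par Q)).seqE
      (by simp) ((s.par (mk E (Term.idWord w))).par (mk E (Term.idWord u)))) (s.par Q) := by
    have k₁ : ((mk E (Term.idWord (x ++ v))).par Q).seqE rfl
        (s.par (mk E (Term.idWord (w ++ u)))) = s.par Q := by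
      rw [← par_seqE _ rfl _ _ rfl, seqE_rfl, seqE_rfl, id_seq, seq_id]
    refine HEq.trans ?_ (heq_of_eq k₁)
    refine seqE_heq (by simp) (by simp) (by simp) (by simp) ?_ ?_
    · rw [← par_id]
      exact (par_assoc _ _ _).symm
    · rw [← par_id]
      exact par_assoc _ _ _
  have m₂ : HEq (((s.par (mk E (Term.idWord u))).par (mk E (Term.idWord w))).seqE (by simp)
      ((mk E (Term.idWord v)).par ((mk E (Term.idWord x)).par Q))) (s.par Q) := by
    have k₂ : (s.par (mk E (Term.idWord (u ++ w)))).seqE rfl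
        ((mk E (Term.idWord (v ++ x))).par Q) = s.par Q := by
      rw [← par_seqE _ rfl _ _ rfl, seqE_rfl, seqE_rfl, id_seq, seq_id]
    refine HEq.trans ?_ (heq_of_eq k₂)
    refine seqE_heq (by simp) (by simp) (by simp) (by simp) ?_ ?_
    · rw [← par_id]
      exact par_assoc _ _ _
    · rw [← par_id]
      exact (par_assoc _ _ _).symm
  rw [e₁, e₂, e₃, e₄, seqE_four, seqE_four]
  exact seqE_heq (by simp) (by simp) (by simp) (by simp) (par_assoc _ _ _).symm
    (seqE_heq (by simp) (by simp) (by simp) (by simp) (m₁.trans m₂.symm) (par_assoc _ _ _))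

/-- The interchange of a word with a concatenation of two words. -/
theorem swapWord_append (u v w : List S.Obj) :
    HEq (mk E (Term.swapWord u (v ++ w)))
      (((mk E (Term.swapWord u v)).par (mk E (Term.idWord w))).seqE (List.append_assoc v u w)
        ((mk E (Term.idWord v)).par (mk E (Term.swapWord u w)))) := by
  induction u with
  | nil =>
    have h (z : List S.Obj) : HEq (mk E (Term.swapWord [] z)) (mk E (Term.idWord z)) :=
      mk_cast_heq rfl (List.append_nil z).symm _
    refine (h _).trans ?_
    have h₁ : mk E (Term.idWord (v ++ w)) = ((mk E (Term.idWord v)).par (mk E (Term.idWord w))).seqE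
        rfl ((mk E (Term.idWord v)).par (mk E (Term.idWord w))) := by
      rw [par_id, seqE_rfl, id_seq]
    rw [h₁]
    exact seqE_heq (by simp) (by simp) (by simp) (by simp)
      (par_heq rfl (by simp) rfl rfl (h v).symm HEq.rfl)
      (par_heq rfl rfl rfl (by simp) HEq.rfl (h w).symm)
  | cons x u ih =>
    have hx : mk E (Term.idn x) = mk E (Term.idWord [x]) :=
      (eq_of_heq (par_null (mk E (Term.idn x)))).symm
    refine (swapWord_cons x u (v ++ w)).trans ?_
    rw [hx]
    have h₁ := swap_step (mk E (Term.swapWord u v)) (mk E (Term.swapWord u w))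
      (mk E (Term.swapWire x v) : Diagram E ([x] ++ v) _)
      (mk E (Term.swapWire x w) : Diagram E ([x] ++ w) _)
    refine HEq.trans ?_ (h₁.trans ?_)
    · exact seqE_heq (by simp) (by simp) (by simp) (by simp)
        (par_heq rfl rfl (by simp) (by simp) HEq.rfl ih)
        (par_heq (by simp) (by simp) rfl rfl (swapWire_append x v w) HEq.rfl)
    · rw [← hx]
      exact seqE_heq (by simp) (by simp) (by simp) (by simp)
        (par_heq (by simp) (by simp) rfl rfl (swapWord_cons x u v).symm HEq.rfl)
        (par_heq rfl rfl (by simp) (by simp) HEq.rfl (swapWord_cons x u w).symm)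

end Diagram

/-- The free symmetric monoidal category on a signature and an equational theory: objects are words
of generating objects, morphisms are string diagrams modulo the theory. -/
structure FreeSMC {S : Signature.{u, v}} (E : Theory S) where
  word : List S.Obj

instance {S : Signature.{u, v}} (E : Theory S) : Category (FreeSMC E) where
  Hom X Y := Diagram E X.word Y.word
  id X := Diagram.mk E (Term.idWord X.word)
  comp f g := Diagram.seq f g
  id_comp := Diagram.id_seq
  comp_id := Diagram.seq_id
  assoc := Diagram.seq_assoc

theorem FreeSMC.comp_eqToHom_comp {S : Signature.{u, v}} {E : Theory S} {X Y Y' Z : FreeSMC E}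
    (f : X ⟶ Y) (h : Y = Y') (g : Y' ⟶ Z) :
    f ≫ eqToHom h ≫ g = Diagram.seqE f (congrArg FreeSMC.word h) g := by
  subst h
  rw [eqToHom_refl, Category.id_comp]
  rfl

instance {S : Signature.{u, v}} (E : Theory S) : StrictSMC (FreeSMC E) where
  tensorObj X Y := ⟨X.word ++ Y.word⟩
  unit := ⟨[]⟩
  tensorHom f g := Diagram.par f g
  symm X Y := Diagram.mk E (Term.swapWord X.word Y.word)
  tensorObj_assoc X Y Z := congrArg FreeSMC.mk (List.append_assoc _ _ _)
  unit_tensorObj _ := rfl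
  tensorObj_unit X := congrArg FreeSMC.mk (List.append_nil _)
  tensorHom_id X Y := Diagram.par_id _ _
  tensorHom_comp _ _ _ _ := Diagram.interchange _ _ _ _
  tensorHom_assoc _ _ _ := Diagram.par_assoc _ _ _
  unit_tensorHom _ := heq_of_eq (Diagram.null_par _)
  tensorHom_unit _ := Diagram.par_null _
  symm_natural X _ _ c := by
    induction c using Quotient.inductionOn
    exact Quotient.sound (TermRel.swap_natural X.word _)
  symm_symm X Y := Quotient.sound (TermRel.swap_swap X.word Y.word)
  symm_tensor X Y Z := by
    rw [FreeSMC.comp_eqToHom_comp]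
    exact Diagram.swapWord_append _ _ _

/-! ### Special commutative Frobenius structures -/

/-- The generators of a special commutative Frobenius structure, one for each generating object. -/
inductive FrobOp (A : Type u) : Type u
  | comult (x : A)
  | counit (x : A)
  | mult (x : A)
  | unit (x : A)

/-- The arity of a Frobenius generator. -/
def FrobOp.arity {A : Type u} : FrobOp A → List A
  | comult x => [x]
  | counit x => [x]
  | mult x => [x, x]
  | unit _ => []

/-- The coarity of a Frobenius generator. -/
def FrobOp.coarity {A : Type u} : FrobOp A → List A
  | comult x => [x, x]
  | counit _ => []
  | mult x => [x]
  | unit x => [x]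

/-- The signature `S + scFrob`: the disjoint union of the operations of `S` with the Frobenius
generators on all the generating objects of `S`. -/
@[reducible]
def Signature.addFrob (S : Signature.{u, v}) : Signature.{u, max u v} where
  Obj := S.Obj
  Op := S.Op ⊕ FrobOp S.Obj
  arity := Sum.elim S.arity FrobOp.arity
  coarity := Sum.elim S.coarity FrobOp.coarity

namespace Term

variable {S : Signature.{u, v}}

/-- Comultiplication. -/
def comult (x : S.Obj) : Term S.addFrob [x] [x, x] := op (S := S.addFrob) (.inr (.comult x))

/-- Counit. -/
def counit (x : S.Obj) : Term S.addFrob [x] [] := op (S := S.addFrob) (.inr (.counit x))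

/-- Multiplication. -/
def mult (x : S.Obj) : Term S.addFrob [x, x] [x] := op (S := S.addFrob) (.inr (.mult x))

/-- Unit. -/
def unit (x : S.Obj) : Term S.addFrob [] [x] := op (S := S.addFrob) (.inr (.unit x))

end Term

open Term in
/-- The equational theory of special commutative Frobenius structures, for the Frobenius generators
on each of the generating objects. -/
inductive scFrob (S : Signature.{u, v}) : Theory S.addFrob
  | coassoc (x : S.Obj) : scFrob S [x] [x, x, x]
      (seq (comult x) (par (comult x) (idn (S := S.addFrob) x) :)) (seq (comult x) (par (idn (S := S.addFrob) x) (comult x) :))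
  | counit_left (x : S.Obj) : scFrob S [x] [x]
      (seq (comult x) (par (counit x) (idn (S := S.addFrob) x) :)) (idn (S := S.addFrob) x)
  | counit_right (x : S.Obj) : scFrob S [x] [x]
      (seq (comult x) (par (idn (S := S.addFrob) x) (counit x) :)) (idn (S := S.addFrob) x)
  | cocomm (x : S.Obj) : scFrob S [x] [x, x] (seq (comult x) (swap (S := S.addFrob) x x)) (comult x)
  | assoc (x : S.Obj) : scFrob S [x, x, x] [x]
      (seq (par (mult x) (idn (S := S.addFrob) x) :) (mult x)) (seq (par (idn (S := S.addFrob) x) (mult x) :) (mult x))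
  | unit_left (x : S.Obj) : scFrob S [x] [x]
      (seq (par (unit x) (idn (S := S.addFrob) x) :) (mult x)) (idn (S := S.addFrob) x)
  | unit_right (x : S.Obj) : scFrob S [x] [x]
      (seq (par (idn (S := S.addFrob) x) (unit x) :) (mult x)) (idn (S := S.addFrob) x)
  | comm (x : S.Obj) : scFrob S [x, x] [x] (seq (swap (S := S.addFrob) x x) (mult x)) (mult x)
  | frobenius_left (x : S.Obj) : scFrob S [x, x] [x, x]
      (seq (par (comult x) (idn (S := S.addFrob) x) :) (par (idn (S := S.addFrob) x) (mult x) :)) (seq (mult x) (comult x))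
  | frobenius_right (x : S.Obj) : scFrob S [x, x] [x, x]
      (seq (mult x) (comult x)) (seq (par (idn (S := S.addFrob) x) (comult x) :) (par (mult x) (idn (S := S.addFrob) x) :))
  | special (x : S.Obj) : scFrob S [x] [x] (seq (comult x) (mult x)) (idn (S := S.addFrob) x)

/-! ### Hypergraphs and open hypergraphs -/

/-- A finite `S`-labelled hypergraph: nodes are labelled with generating objects, hyperedges with
operations. A hyperedge has a list of sources and a list of targets, whose labels are the arity
and the coarity of its operation. -/
structure Hypergraph (S : Signature.{u, v}) where
  Node : Type
  Edge : Type
  finite_node : Finite Node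
  finite_edge : Finite Edge
  nodeLabel : Node → S.Obj
  edgeLabel : Edge → S.Op
  source : Edge → List Node
  target : Edge → List Node
  map_source (e : Edge) : (source e).map nodeLabel = S.arity (edgeLabel e)
  map_target (e : Edge) : (target e).map nodeLabel = S.coarity (edgeLabel e)

/-- Homomorphisms of labelled hypergraphs. -/
structure Hypergraph.Hom {S : Signature.{u, v}} (G H : Hypergraph S) where
  node : G.Node → H.Node
  edge : G.Edge → H.Edge
  nodeLabel (n : G.Node) : H.nodeLabel (node n) = G.nodeLabel n
  edgeLabel (e : G.Edge) : H.edgeLabel (edge e) = G.edgeLabel e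
  source (e : G.Edge) : H.source (edge e) = (G.source e).map node
  target (e : G.Edge) : H.target (edge e) = (G.target e).map node

/-- The discrete hypergraph on a word: one node for each position, and no hyperedges. -/
@[reducible]
def Hypergraph.discrete {S : Signature.{u, v}} (w : List S.Obj) : Hypergraph S where
  Node := Fin w.length
  Edge := Empty
  finite_node := inferInstance
  finite_edge := inferInstance
  nodeLabel := w.get
  edgeLabel := Empty.elim
  source := Empty.elim
  target := Empty.elim
  map_source e := e.elim
  map_target e := e.elim

/-- A homomorphism out of a discrete hypergraph is a label-preserving map on nodes. -/
@[reducible]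
def Hypergraph.ofDiscrete {S : Signature.{u, v}} {w : List S.Obj} {G : Hypergraph S}
    (f : Fin w.length → G.Node) (hf : ∀ i, G.nodeLabel (f i) = w.get i) : (discrete w).Hom G where
  node := f
  edge := Empty.elim
  nodeLabel := hf
  edgeLabel e := e.elim
  source e := e.elim
  target e := e.elim

/-- An open hypergraph of type `v ⟶ w`: a cospan of hypergraphs whose feet are the discrete
hypergraphs on `v` and `w`. -/
structure OpenHypergraph (S : Signature.{u, v}) (v w : List S.Obj) where
  carrier : Hypergraph S
  left : (Hypergraph.discrete v).Hom carrier
  right : (Hypergraph.discrete w).Hom carrier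

namespace OpenHypergraph

variable {S : Signature.{u, v}}

/-- Two open hypergraphs are isomorphic if there is an isomorphism of their carriers that commutes
with the two interfaces. -/
def IsIso {v w : List S.Obj} (G H : OpenHypergraph S v w) : Prop :=
  ∃ f : G.carrier.Hom H.carrier, Function.Bijective f.node ∧ Function.Bijective f.edge ∧
    (∀ i, f.node (G.left.node i) = H.left.node i) ∧
    (∀ i, f.node (G.right.node i) = H.right.node i)

theorem isIso_of_equiv {v w : List S.Obj} {G H : OpenHypergraph S v w}
    (n : G.carrier.Node ≃ H.carrier.Node) (e : G.carrier.Edge ≃ H.carrier.Edge)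
    (hn : ∀ a, H.carrier.nodeLabel (n a) = G.carrier.nodeLabel a)
    (he : ∀ a, H.carrier.edgeLabel (e a) = G.carrier.edgeLabel a)
    (hs : ∀ a, H.carrier.source (e a) = (G.carrier.source a).map n)
    (ht : ∀ a, H.carrier.target (e a) = (G.carrier.target a).map n)
    (hl : ∀ i, n (G.left.node i) = H.left.node i)
    (hr : ∀ i, n (G.right.node i) = H.right.node i) : IsIso G H :=
  ⟨⟨n, e, hn, he, hs, ht⟩, n.bijective, e.bijective, hl, hr⟩

theorem IsIso.exists_equiv {v w : List S.Obj} {G H : OpenHypergraph S v w} (h : IsIso G H) :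
    ∃ (n : G.carrier.Node ≃ H.carrier.Node) (e : G.carrier.Edge ≃ H.carrier.Edge),
      (∀ a, H.carrier.nodeLabel (n a) = G.carrier.nodeLabel a) ∧
      (∀ a, H.carrier.edgeLabel (e a) = G.carrier.edgeLabel a) ∧
      (∀ a, H.carrier.source (e a) = (G.carrier.source a).map n) ∧
      (∀ a, H.carrier.target (e a) = (G.carrier.target a).map n) ∧
      (∀ i, n (G.left.node i) = H.left.node i) ∧
      (∀ i, n (G.right.node i) = H.right.node i) := by
  obtain ⟨f, h₁, h₂, hl, hr⟩ := h
  exact ⟨Equiv.ofBijective _ h₁, Equiv.ofBijective _ h₂, f.nodeLabel, f.edgeLabel, f.source,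
    f.target, hl, hr⟩

/-- Isomorphism of open hypergraphs as an equivalence relation. -/
def setoid (S : Signature.{u, v}) (v w : List S.Obj) : Setoid (OpenHypergraph S v w) where
  r := IsIso
  iseqv :=
    { refl := fun G => isIso_of_equiv (Equiv.refl _) (Equiv.refl _) (by simp) (by simp) (by simp)
        (by simp) (by simp) (by simp)
      symm := fun h => by
        obtain ⟨n, e, hn, he, hs, ht, hl, hr⟩ := h.exists_equiv
        refine isIso_of_equiv n.symm e.symm (fun a => ?_) (fun a => ?_) (fun a => ?_) (fun a => ?_)
          (fun i => ?_) (fun i => ?_)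
        · rw [← hn, n.apply_symm_apply]
        · rw [← he, e.apply_symm_apply]
        · have := hs (e.symm a)
          rw [e.apply_symm_apply] at this
          simp [this]
        · have := ht (e.symm a)
          rw [e.apply_symm_apply] at this
          simp [this]
        · rw [← hl, n.symm_apply_apply]
        · rw [← hr, n.symm_apply_apply]
      trans := fun h h' => by
        obtain ⟨n, e, hn, he, hs, ht, hl, hr⟩ := h.exists_equiv
        obtain ⟨n', e', hn', he', hs', ht', hl', hr'⟩ := h'.exists_equiv
        exact isIso_of_equiv (n.trans n') (e.trans e') (by simp [hn, hn']) (by simp [he, he'])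
          (by simp [hs, hs']) (by simp [ht, ht']) (by simp [hl, hl']) (by simp [hr, hr']) }

/-- The relation that glues the right interface of `G` to the left interface of `H`. -/
inductive Glue {u v w : List S.Obj} (G : OpenHypergraph S u v) (H : OpenHypergraph S v w) :
    G.carrier.Node ⊕ H.carrier.Node → G.carrier.Node ⊕ H.carrier.Node → Prop
  | glue (i : Fin v.length) : Glue G H (.inl (G.right.node i)) (.inr (H.left.node i))

/-- The pushout of the carriers of two composable open hypergraphs over their common interface. -/
@[reducible]
def pushout {u v w : List S.Obj} (G : OpenHypergraph S u v) (H : OpenHypergraph S v w) :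
    Hypergraph S where
  Node := Quot (Glue G H)
  Edge := G.carrier.Edge ⊕ H.carrier.Edge
  finite_node := by
    have := G.carrier.finite_node
    have := H.carrier.finite_node
    exact Quot.finite _
  finite_edge := by
    have := G.carrier.finite_edge
    have := H.carrier.finite_edge
    exact inferInstance
  nodeLabel := Quot.lift (Sum.elim G.carrier.nodeLabel H.carrier.nodeLabel) (by
    rintro _ _ ⟨i⟩
    exact (G.right.nodeLabel i).trans (H.left.nodeLabel i).symm)
  edgeLabel := Sum.elim G.carrier.edgeLabel H.carrier.edgeLabel
  source := Sum.elim (fun e => (G.carrier.source e).map fun n => Quot.mk _ (.inl n))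
    (fun e => (H.carrier.source e).map fun n => Quot.mk _ (.inr n))
  target := Sum.elim (fun e => (G.carrier.target e).map fun n => Quot.mk _ (.inl n))
    (fun e => (H.carrier.target e).map fun n => Quot.mk _ (.inr n))
  map_source := by
    rintro (e | e)
    · simpa [Function.comp_def] using G.carrier.map_source e
    · simpa [Function.comp_def] using H.carrier.map_source e
  map_target := by
    rintro (e | e)
    · simpa [Function.comp_def] using G.carrier.map_target e
    · simpa [Function.comp_def] using H.carrier.map_target e

/-- Sequential composition of open hypergraphs, by pushout. -/
@[reducible]
def comp {u v w : List S.Obj} (G : OpenHypergraph S u v) (H : OpenHypergraph S v w) :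
    OpenHypergraph S u w where
  carrier := pushout G H
  left := Hypergraph.ofDiscrete (fun i => Quot.mk _ (.inl (G.left.node i))) G.left.nodeLabel
  right := Hypergraph.ofDiscrete (fun i => Quot.mk _ (.inr (H.right.node i))) H.right.nodeLabel

/-- Positions in a concatenation of words. -/
def position {A : Type u} (v w : List A) : Fin (v ++ w).length ≃ Fin v.length ⊕ Fin w.length :=
  (finCongr List.length_append).trans finSumFinEquiv.symm

theorem get_position {A : Type u} (v w : List A) (i : Fin (v ++ w).length) :
    Sum.elim v.get w.get (position v w i) = (v ++ w).get i := by
  obtain ⟨j, rfl⟩ := (position v w).symm.surjective i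
  rw [Equiv.apply_symm_apply]
  rcases j with j | j <;> simp [position]

/-- The disjoint union of two hypergraphs. -/
@[reducible]
def disjointUnion (G H : Hypergraph S) : Hypergraph S where
  Node := G.Node ⊕ H.Node
  Edge := G.Edge ⊕ H.Edge
  finite_node := by
    have := G.finite_node
    have := H.finite_node
    exact inferInstance
  finite_edge := by
    have := G.finite_edge
    have := H.finite_edge
    exact inferInstance
  nodeLabel := Sum.elim G.nodeLabel H.nodeLabel
  edgeLabel := Sum.elim G.edgeLabel H.edgeLabel
  source := Sum.elim (fun e => (G.source e).map .inl) (fun e => (H.source e).map .inr)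
  target := Sum.elim (fun e => (G.target e).map .inl) (fun e => (H.target e).map .inr)
  map_source := by
    rintro (e | e)
    · simpa [Function.comp_def] using G.map_source e
    · simpa [Function.comp_def] using H.map_source e
  map_target := by
    rintro (e | e)
    · simpa [Function.comp_def] using G.map_target e
    · simpa [Function.comp_def] using H.map_target e

/-- Parallel composition of open hypergraphs: the disjoint union of carriers and interfaces. -/
@[reducible]
def tensor {v₁ w₁ v₂ w₂ : List S.Obj} (G : OpenHypergraph S v₁ w₁) (H : OpenHypergraph S v₂ w₂) :
    OpenHypergraph S (v₁ ++ v₂) (w₁ ++ w₂) where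
  carrier := disjointUnion G.carrier H.carrier
  left := Hypergraph.ofDiscrete (fun i => Sum.map G.left.node H.left.node (position v₁ v₂ i))
    (fun i => by
      rw [← get_position]
      rcases position v₁ v₂ i with j | j
      · exact G.left.nodeLabel j
      · exact H.left.nodeLabel j)
  right := Hypergraph.ofDiscrete (fun i => Sum.map G.right.node H.right.node (position w₁ w₂ i))
    (fun i => by
      rw [← get_position]
      rcases position w₁ w₂ i with j | j
      · exact G.right.nodeLabel j
      · exact H.right.nodeLabel j)

/-- The discrete open hypergraph on a word `v` whose left interface is the identity and whose right
interface lists the positions of `v` in the order given by `f`. -/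
@[reducible]
def wiring {v w : List S.Obj} (f : Fin w.length → Fin v.length)
    (hf : ∀ i, v.get (f i) = w.get i) : OpenHypergraph S v w where
  carrier := Hypergraph.discrete v
  left := Hypergraph.ofDiscrete id (fun _ => rfl)
  right := Hypergraph.ofDiscrete f hf

/-- The identity open hypergraph. -/
def idn (w : List S.Obj) : OpenHypergraph S w w := wiring id fun _ => rfl

/-- The block permutation of positions that exchanges `v` and `w`. -/
def swapPosition {A : Type u} (v w : List A) : Fin (w ++ v).length ≃ Fin (v ++ w).length :=
  ((position w v).trans (Equiv.sumComm _ _)).trans (position v w).symm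

theorem get_swapPosition {A : Type u} (v w : List A) (i : Fin (w ++ v).length) :
    (v ++ w).get (swapPosition v w i) = (w ++ v).get i := by
  rw [← get_position, ← get_position]
  simp only [swapPosition, Equiv.trans_apply, Equiv.apply_symm_apply]
  rcases position w v i with j | j <;> rfl

/-- The symmetry open hypergraph. -/
def symm (v w : List S.Obj) : OpenHypergraph S (v ++ w) (w ++ v) :=
  wiring (swapPosition v w) (get_swapPosition v w)

theorem comp_congr {u v w : List S.Obj} {G G' : OpenHypergraph S u v} {H H' : OpenHypergraph S v w}
    (hG : IsIso G G') (hH : IsIso H H') : IsIso (comp G H) (comp G' H') := by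
  obtain ⟨n, e, hn, he, hs, ht, hl, hr⟩ := hG.exists_equiv
  obtain ⟨n', e', hn', he', hs', ht', hl', hr'⟩ := hH.exists_equiv
  have hg : ∀ a b, Glue G H a b ↔ Glue G' H' (Equiv.sumCongr n n' a) (Equiv.sumCongr n n' b) := by
    intro a b
    constructor
    · rintro ⟨i⟩
      have := Glue.glue (G := G') (H := H') i
      rw [← hr, ← hl'] at this
      exact this
    · intro h
      generalize hA : Equiv.sumCongr n n' a = A at h
      generalize hB : Equiv.sumCongr n n' b = B at h
      obtain ⟨i⟩ := h
      rcases a with a | a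
      · rcases b with b | b
        · simp at hB
        · simp only [Equiv.sumCongr_apply, Sum.map_inl, Sum.map_inr, Sum.inl.injEq,
            Sum.inr.injEq, ← hr, ← hl', EmbeddingLike.apply_eq_iff_eq] at hA hB
          subst hA hB
          exact Glue.glue i
      · simp at hA
  refine isIso_of_equiv (Quot.congr (Equiv.sumCongr n n') hg) (Equiv.sumCongr e e') ?_ ?_ ?_ ?_ ?_ ?_
  · rintro ⟨a | a⟩
    · exact hn a
    · exact hn' a
  · rintro (a | a)
    · exact he a
    · exact he' a
  · rintro (a | a)
    · change ((G'.carrier.source (e a)).map _) = ((G.carrier.source a).map _).map _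
      rw [hs, List.map_map, List.map_map]; rfl
    · change ((H'.carrier.source (e' a)).map _) = ((H.carrier.source a).map _).map _
      rw [hs', List.map_map, List.map_map]; rfl
  · rintro (a | a)
    · change ((G'.carrier.target (e a)).map _) = ((G.carrier.target a).map _).map _
      rw [ht, List.map_map, List.map_map]; rfl
    · change ((H'.carrier.target (e' a)).map _) = ((H.carrier.target a).map _).map _
      rw [ht', List.map_map, List.map_map]; rfl
  · intro i
    exact congrArg (fun a => Quot.mk (Glue G' H') (.inl a)) (hl i)
  · intro i
    exact congrArg (fun a => Quot.mk (Glue G' H') (.inr a)) (hr' i)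

theorem tensor_congr {v₁ w₁ v₂ w₂ : List S.Obj} {G G' : OpenHypergraph S v₁ w₁}
    {H H' : OpenHypergraph S v₂ w₂} (hG : IsIso G G') (hH : IsIso H H') :
    IsIso (tensor G H) (tensor G' H') := by
  obtain ⟨n, e, hn, he, hs, ht, hl, hr⟩ := hG.exists_equiv
  obtain ⟨n', e', hn', he', hs', ht', hl', hr'⟩ := hH.exists_equiv
  refine isIso_of_equiv (Equiv.sumCongr n n') (Equiv.sumCongr e e') ?_ ?_ ?_ ?_ ?_ ?_
  · rintro (a | a)
    · exact hn a
    · exact hn' a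
  · rintro (a | a)
    · exact he a
    · exact he' a
  · rintro (a | a)
    · change ((G'.carrier.source (e a)).map _) = ((G.carrier.source a).map _).map _
      rw [hs, List.map_map, List.map_map]; rfl
    · change ((H'.carrier.source (e' a)).map _) = ((H.carrier.source a).map _).map _
      rw [hs', List.map_map, List.map_map]; rfl
  · rintro (a | a)
    · change ((G'.carrier.target (e a)).map _) = ((G.carrier.target a).map _).map _
      rw [ht, List.map_map, List.map_map]; rfl
    · change ((H'.carrier.target (e' a)).map _) = ((H.carrier.target a).map _).map _
      rw [ht', List.map_map, List.map_map]; rfl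
  · intro i
    change Sum.map n n' (Sum.map _ _ (position v₁ v₂ i)) = Sum.map _ _ (position v₁ v₂ i)
    rcases position v₁ v₂ i with j | j
    · exact congrArg Sum.inl (hl j)
    · exact congrArg Sum.inr (hl' j)
  · intro i
    change Sum.map n n' (Sum.map _ _ (position w₁ w₂ i)) = Sum.map _ _ (position w₁ w₂ i)
    rcases position w₁ w₂ i with j | j
    · exact congrArg Sum.inl (hr j)
    · exact congrArg Sum.inr (hr' j)

theorem comp_assoc {u v w z : List S.Obj} (G : OpenHypergraph S u v) (H : OpenHypergraph S v w)
    (K : OpenHypergraph S w z) : IsIso (comp (comp G H) K) (comp G (comp H K)) := by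
  let f : Quot (Glue (comp G H) K) → Quot (Glue G (comp H K)) :=
    Quot.lift (Sum.elim
      (Quot.lift (Sum.elim (fun a => Quot.mk _ (.inl a))
          (fun b => Quot.mk _ (.inr (Quot.mk _ (.inl b)))))
        (by rintro _ _ ⟨i⟩; exact Quot.sound (Glue.glue (G := G) (H := comp H K) i)))
      (fun c => Quot.mk _ (.inr (Quot.mk _ (.inr c)))))
      (by
        rintro _ _ ⟨i⟩
        exact congrArg (fun q => Quot.mk (Glue G (comp H K)) (.inr q))
          (Quot.sound (Glue.glue (G := H) (H := K) i)))
  let g : Quot (Glue G (comp H K)) → Quot (Glue (comp G H) K) :=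
    Quot.lift (Sum.elim (fun a => Quot.mk _ (.inl (Quot.mk _ (.inl a))))
      (Quot.lift (Sum.elim (fun b => Quot.mk _ (.inl (Quot.mk _ (.inr b))))
          (fun c => Quot.mk _ (.inr c)))
        (by rintro _ _ ⟨i⟩; exact Quot.sound (Glue.glue (G := comp G H) (H := K) i))))
      (by
        rintro _ _ ⟨i⟩
        exact congrArg (fun q => Quot.mk (Glue (comp G H) K) (.inl q))
          (Quot.sound (Glue.glue (G := G) (H := H) i)))
  let n : Quot (Glue (comp G H) K) ≃ Quot (Glue G (comp H K)) :=
    ⟨f, g, by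
      rintro ⟨⟨q⟩ | c⟩
      · obtain ⟨a | b, rfl⟩ := Quot.exists_rep q <;> rfl
      · rfl, by
      rintro ⟨a | ⟨q⟩⟩
      · rfl
      · obtain ⟨b | c, rfl⟩ := Quot.exists_rep q <;> rfl⟩
  refine isIso_of_equiv n (Equiv.sumAssoc _ _ _) ?_ ?_ ?_ ?_ (fun _ => rfl) (fun _ => rfl)
  · rintro ⟨⟨q⟩ | c⟩
    · obtain ⟨a | b, rfl⟩ := Quot.exists_rep q <;> rfl
    · rfl
  · rintro ((a | b) | c) <;> rfl
  · rintro ((a | b) | c)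
    · change (G.carrier.source a).map _ = (((G.carrier.source a).map _).map _).map _
      simp only [List.map_map]; rfl
    · change ((H.carrier.source b).map _).map _ = (((H.carrier.source b).map _).map _).map _
      simp only [List.map_map]; rfl
    · change ((K.carrier.source c).map _).map _ = ((K.carrier.source c).map _).map _
      simp only [List.map_map]; rfl
  · rintro ((a | b) | c)
    · change (G.carrier.target a).map _ = (((G.carrier.target a).map _).map _).map _
      simp only [List.map_map]; rfl
    · change ((H.carrier.target b).map _).map _ = (((H.carrier.target b).map _).map _).map _
      simp only [List.map_map]; rfl
    · change ((K.carrier.target c).map _).map _ = ((K.carrier.target c).map _).map _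
      simp only [List.map_map]; rfl

/-- An open hypergraph with its right interface reindexed. -/
@[reducible]
def reindexRight {u v w : List S.Obj} (G : OpenHypergraph S u v) (f : Fin w.length → Fin v.length)
    (hf : ∀ i, v.get (f i) = w.get i) : OpenHypergraph S u w where
  carrier := G.carrier
  left := G.left
  right := Hypergraph.ofDiscrete (fun i => G.right.node (f i))
    (fun i => (G.right.nodeLabel (f i)).trans (hf i))

/-- An open hypergraph with its left interface reindexed. -/
@[reducible]
def reindexLeft {u v w : List S.Obj} (G : OpenHypergraph S v w) (f : Fin u.length → Fin v.length)
    (hf : ∀ i, v.get (f i) = u.get i) : OpenHypergraph S u w where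
  carrier := G.carrier
  left := Hypergraph.ofDiscrete (fun i => G.left.node (f i))
    (fun i => (G.left.nodeLabel (f i)).trans (hf i))
  right := G.right

theorem comp_wiring {u v w : List S.Obj} (G : OpenHypergraph S u v)
    (f : Fin w.length → Fin v.length) (hf : ∀ i, v.get (f i) = w.get i) :
    IsIso (comp G (wiring f hf)) (reindexRight G f hf) := by
  let n : Quot (Glue G (wiring (S := S) f hf)) ≃ G.carrier.Node :=
    { toFun := Quot.lift (Sum.elim id G.right.node) (by rintro _ _ ⟨i⟩; rfl)
      invFun := fun a => Quot.mk _ (.inl a)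
      left_inv := by
        rintro ⟨a | j⟩
        · rfl
        · exact Quot.sound (Glue.glue (G := G) (H := wiring f hf) j)
      right_inv := fun _ => rfl }
  refine isIso_of_equiv n (Equiv.sumEmpty _ Empty) ?_ ?_ ?_ ?_ (fun _ => rfl) (fun _ => rfl)
  · rintro ⟨a | j⟩
    · rfl
    · exact G.right.nodeLabel j
  · rintro (a | a)
    · rfl
    · exact a.elim
  · rintro (a | a)
    · change G.carrier.source a = ((G.carrier.source a).map _).map _
      rw [List.map_map]; exact (List.map_id _).symm
    · exact a.elim
  · rintro (a | a)
    · change G.carrier.target a = ((G.carrier.target a).map _).map _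
      rw [List.map_map]; exact (List.map_id _).symm
    · exact a.elim

theorem wiring_comp {u v w : List S.Obj} (f : Fin v.length ≃ Fin u.length)
    (hf : ∀ i, u.get (f i) = v.get i) (G : OpenHypergraph S v w) :
    IsIso (comp (wiring f hf) G) (reindexLeft G f.symm
      (fun i => by rw [← hf, Equiv.apply_symm_apply])) := by
  let n : Quot (Glue (wiring (S := S) f hf) G) ≃ G.carrier.Node :=
    { toFun := Quot.lift (Sum.elim (fun j => G.left.node (f.symm j)) id) (by
        rintro _ _ ⟨i⟩
        exact congrArg G.left.node (f.symm_apply_apply i))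
      invFun := fun a => Quot.mk _ (.inr a)
      left_inv := by
        rintro ⟨j | a⟩
        · have := Quot.sound (Glue.glue (G := wiring f hf) (H := G) (f.symm j))
          refine this.symm.trans ?_
          exact congrArg (fun q => Quot.mk _ (Sum.inl q)) (f.apply_symm_apply j)
        · rfl
      right_inv := fun _ => rfl }
  refine isIso_of_equiv n (Equiv.emptySum Empty _) ?_ ?_ ?_ ?_ (fun _ => rfl) (fun _ => rfl)
  · rintro ⟨j | a⟩
    · refine (G.left.nodeLabel (f.symm j)).trans ?_
      change v.get (f.symm j) = u.get j
      rw [← hf, Equiv.apply_symm_apply]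
    · rfl
  · rintro (a | a)
    · exact a.elim
    · rfl
  · rintro (a | a)
    · exact a.elim
    · change G.carrier.source a = ((G.carrier.source a).map _).map _
      rw [List.map_map]; exact (List.map_id _).symm
  · rintro (a | a)
    · exact a.elim
    · change G.carrier.target a = ((G.carrier.target a).map _).map _
      rw [List.map_map]; exact (List.map_id _).symm

theorem tensor_comp {u₁ v₁ w₁ u₂ v₂ w₂ : List S.Obj} (G₁ : OpenHypergraph S u₁ v₁)
    (H₁ : OpenHypergraph S v₁ w₁) (G₂ : OpenHypergraph S u₂ v₂) (H₂ : OpenHypergraph S v₂ w₂) :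
    IsIso (comp (tensor G₁ G₂) (tensor H₁ H₂)) (tensor (comp G₁ H₁) (comp G₂ H₂)) := by
  have key : ∀ i, Glue (tensor G₁ G₂) (tensor H₁ H₂)
      (.inl (Sum.map G₁.right.node G₂.right.node i))
      (.inr (Sum.map H₁.left.node H₂.left.node i)) := by
    intro i
    have := Glue.glue (G := tensor G₁ G₂) (H := tensor H₁ H₂) ((position v₁ v₂).symm i)
    simp only [tensor, Hypergraph.ofDiscrete, Equiv.apply_symm_apply] at this
    exact this
  let f : Quot (Glue (tensor G₁ G₂) (tensor H₁ H₂)) → Quot (Glue G₁ H₁) ⊕ Quot (Glue G₂ H₂) :=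
    Quot.lift (Sum.elim (Sum.map (fun a => Quot.mk _ (.inl a)) (fun a => Quot.mk _ (.inl a)))
        (Sum.map (fun a => Quot.mk _ (.inr a)) (fun a => Quot.mk _ (.inr a)))) (by
      rintro _ _ ⟨i⟩
      change Sum.map _ _ (Sum.map _ _ (position v₁ v₂ i)) =
        Sum.map _ _ (Sum.map _ _ (position v₁ v₂ i))
      rcases position v₁ v₂ i with j | j
      · exact congrArg Sum.inl (Quot.sound (Glue.glue j))
      · exact congrArg Sum.inr (Quot.sound (Glue.glue j)))
  let g : Quot (Glue G₁ H₁) ⊕ Quot (Glue G₂ H₂) → Quot (Glue (tensor G₁ G₂) (tensor H₁ H₂)) :=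
    Sum.elim
      (Quot.lift (Sum.elim (fun a => Quot.mk _ (.inl (.inl a))) (fun a => Quot.mk _ (.inr (.inl a))))
        (by rintro _ _ ⟨i⟩; exact Quot.sound (key (.inl i))))
      (Quot.lift (Sum.elim (fun a => Quot.mk _ (.inl (.inr a))) (fun a => Quot.mk _ (.inr (.inr a))))
        (by rintro _ _ ⟨i⟩; exact Quot.sound (key (.inr i))))
  let n : Quot (Glue (tensor G₁ G₂) (tensor H₁ H₂)) ≃ Quot (Glue G₁ H₁) ⊕ Quot (Glue G₂ H₂) :=
    ⟨f, g, by rintro ⟨(a | a) | (a | a)⟩ <;> rfl, by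
      rintro (q | q) <;> obtain ⟨a | a, rfl⟩ := Quot.exists_rep q <;> rfl⟩
  refine isIso_of_equiv n (Equiv.sumSumSumComm _ _ _ _) ?_ ?_ ?_ ?_ ?_ ?_
  · rintro ⟨(a | a) | (a | a)⟩ <;> rfl
  · rintro ((a | a) | (a | a)) <;> rfl
  · rintro ((a | a) | (a | a)) <;>
    · change (List.map _ _).map _ = ((List.map _ _).map _).map _
      simp only [List.map_map]; rfl
  · rintro ((a | a) | (a | a)) <;>
    · change (List.map _ _).map _ = ((List.map _ _).map _).map _
      simp only [List.map_map]; rfl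
  · intro i
    change Sum.map _ _ (Sum.map _ _ (position u₁ u₂ i)) = Sum.map _ _ (position u₁ u₂ i)
    rcases position u₁ u₂ i with j | j <;> rfl
  · intro i
    change Sum.map _ _ (Sum.map _ _ (position w₁ w₂ i)) = Sum.map _ _ (position w₁ w₂ i)
    rcases position w₁ w₂ i with j | j <;> rfl

/-- The class of an open hypergraph up to isomorphism. -/
def cls {v w : List S.Obj} (G : OpenHypergraph S v w) : Quotient (setoid S v w) :=
  Quotient.mk (setoid S v w) G

theorem cls_eq {v w : List S.Obj} {G H : OpenHypergraph S v w} (h : IsIso G H) : cls G = cls H :=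
  Quotient.sound h

theorem cls_heq {v v' w w' : List S.Obj} (hv : v = v') (hw : w = w')
    {G : OpenHypergraph S v w} {H : OpenHypergraph S v' w'}
    (n : G.carrier.Node ≃ H.carrier.Node) (e : G.carrier.Edge ≃ H.carrier.Edge)
    (hn : ∀ a, H.carrier.nodeLabel (n a) = G.carrier.nodeLabel a)
    (he : ∀ a, H.carrier.edgeLabel (e a) = G.carrier.edgeLabel a)
    (hs : ∀ a, H.carrier.source (e a) = (G.carrier.source a).map n)
    (ht : ∀ a, H.carrier.target (e a) = (G.carrier.target a).map n)
    (hl : ∀ i, n (G.left.node i) = H.left.node (Fin.cast (congrArg List.length hv) i))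
    (hr : ∀ i, n (G.right.node i) = H.right.node (Fin.cast (congrArg List.length hw) i)) :
    HEq (cls G) (cls H) := by
  subst hv hw
  exact heq_of_eq (cls_eq (isIso_of_equiv n e hn he hs ht hl hr))

theorem position_symm_inl {A : Type u} (v w : List A) (j : Fin v.length) :
    ((position v w).symm (.inl j)).val = j.val := by
  simp [position]

theorem position_symm_inr {A : Type u} (v w : List A) (j : Fin w.length) :
    ((position v w).symm (.inr j)).val = v.length + j.val := by
  simp [position]

theorem position_assoc {A : Type u} (u v w : List A) (i : Fin ((u ++ v) ++ w).length) :
    Equiv.sumAssoc _ _ _ (Sum.map (position u v) id (position (u ++ v) w i)) =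
      Sum.map id (position v w) (position u (v ++ w)
        (Fin.cast (congrArg List.length (List.append_assoc u v w)) i)) := by
  obtain ⟨i, rfl⟩ := (position (u ++ v) w).symm.surjective i
  rw [Equiv.apply_symm_apply]
  rcases i with i | i
  · obtain ⟨i, rfl⟩ := (position u v).symm.surjective i
    rcases i with i | i
    · have : (Fin.cast (congrArg List.length (List.append_assoc u v w))
          ((position (u ++ v) w).symm (.inl ((position u v).symm (.inl i))))) =
          (position u (v ++ w)).symm (.inl i) := by
        ext; simp [position_symm_inl]
      rw [this]; simp
    · have : (Fin.cast (congrArg List.length (List.append_assoc u v w))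
          ((position (u ++ v) w).symm (.inl ((position u v).symm (.inr i))))) =
          (position u (v ++ w)).symm (.inr ((position v w).symm (.inl i))) := by
        ext; simp [position_symm_inl, position_symm_inr]
      rw [this]; simp
  · have : (Fin.cast (congrArg List.length (List.append_assoc u v w))
        ((position (u ++ v) w).symm (.inr i))) =
        (position u (v ++ w)).symm (.inr ((position v w).symm (.inr i))) := by
      ext; simp [position_symm_inr, Nat.add_assoc]
    rw [this]; simp

theorem tensor_assoc {v₁ w₁ v₂ w₂ v₃ w₃ : List S.Obj} (G₁ : OpenHypergraph S v₁ w₁)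
    (G₂ : OpenHypergraph S v₂ w₂) (G₃ : OpenHypergraph S v₃ w₃) :
    HEq (cls (tensor (tensor G₁ G₂) G₃)) (cls (tensor G₁ (tensor G₂ G₃))) := by
  have key {X₁ X₂ X₃ : Type} (u v w : List S.Obj) (f : Fin u.length → X₁) (g : Fin v.length → X₂)
      (h : Fin w.length → X₃) (i : Fin ((u ++ v) ++ w).length) :
      Equiv.sumAssoc _ _ _ (Sum.map (fun j => Sum.map f g (position u v j)) h
        (position (u ++ v) w i)) =
      Sum.map f (fun j => Sum.map g h (position v w j)) (position u (v ++ w)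
        (Fin.cast (congrArg List.length (List.append_assoc u v w)) i)) := by
    have e := congrArg (Sum.map f (Sum.map g h)) (position_assoc u v w i)
    rw [Sum.map_map] at e
    refine Eq.trans ?_ e
    rcases position (u ++ v) w i with j | j
    · simp only [Sum.map_inl]
      rcases position u v j with k | k <;> rfl
    · rfl
  refine cls_heq (List.append_assoc _ _ _) (List.append_assoc _ _ _) (Equiv.sumAssoc _ _ _)
    (Equiv.sumAssoc _ _ _) ?_ ?_ ?_ ?_ ?_ ?_
  · rintro ((a | a) | a) <;> rfl
  · rintro ((a | a) | a) <;> rfl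
  · rintro ((a | a) | a) <;> simp [Function.comp_def]
  · rintro ((a | a) | a) <;> simp [Function.comp_def]
  · exact key _ _ _ _ _ _
  · exact key _ _ _ _ _ _

theorem idn_tensor {v w : List S.Obj} (G : OpenHypergraph S v w) :
    HEq (cls (tensor (idn []) G)) (cls G) := by
  have key {X : Type} (u : List S.Obj) (f : Fin ([] : List S.Obj).length → Fin 0)
      (g : Fin u.length → X) (i : Fin ([] ++ u).length) :
      Equiv.emptySum (Fin 0) X (Sum.map f g (position [] u i)) = g i := by
    obtain ⟨i, rfl⟩ := (position [] u).symm.surjective i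
    rw [Equiv.apply_symm_apply]
    rcases i with i | i
    · exact i.elim0
    · refine congrArg g ?_
      ext; simpa using (position_symm_inr [] u i).symm
  refine cls_heq rfl rfl (Equiv.emptySum (Fin 0) _) (Equiv.emptySum Empty _) ?_ ?_ ?_ ?_ ?_ ?_
  · rintro (a | a)
    · exact a.elim0
    · rfl
  · rintro (a | a)
    · exact a.elim
    · rfl
  · rintro (a | a)
    · exact a.elim
    · simp only [Sum.elim_inr, List.map_map]
      exact (List.map_id (G.carrier.source a)).symm
  · rintro (a | a)
    · exact a.elim
    · simp only [Sum.elim_inr, List.map_map]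
      exact (List.map_id (G.carrier.target a)).symm
  · exact key _ _ _
  · exact key _ _ _

theorem tensor_idn {v w : List S.Obj} (G : OpenHypergraph S v w) :
    HEq (cls (tensor G (idn []))) (cls G) := by
  have key {X : Type} (u : List S.Obj) (f : Fin ([] : List S.Obj).length → Fin 0)
      (g : Fin u.length → X) (i : Fin (u ++ []).length) :
      Equiv.sumEmpty X (Fin 0) (Sum.map g f (position u [] i)) =
        g (Fin.cast (congrArg List.length (List.append_nil u)) i) := by
    obtain ⟨i, rfl⟩ := (position u []).symm.surjective i
    rw [Equiv.apply_symm_apply]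
    rcases i with i | i
    · refine congrArg g ?_
      ext; simpa using (position_symm_inl u [] i).symm
    · exact i.elim0
  refine cls_heq (List.append_nil v) (List.append_nil w) (Equiv.sumEmpty _ (Fin 0))
    (Equiv.sumEmpty _ Empty) ?_ ?_ ?_ ?_ ?_ ?_
  · rintro (a | a)
    · rfl
    · exact a.elim0
  · rintro (a | a)
    · rfl
    · exact a.elim
  · rintro (a | a)
    · simp only [Sum.elim_inl, List.map_map]
      exact (List.map_id (G.carrier.source a)).symm
    · exact a.elim
  · rintro (a | a)
    · simp only [Sum.elim_inl, List.map_map]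
      exact (List.map_id (G.carrier.target a)).symm
    · exact a.elim
  · exact key _ _ _
  · exact key _ _ _

theorem tensor_wiring {v w v' w' : List S.Obj} (f : Fin w.length → Fin v.length)
    (hf : ∀ i, v.get (f i) = w.get i) (g : Fin w'.length → Fin v'.length)
    (hg : ∀ i, v'.get (g i) = w'.get i) :
    IsIso (tensor (wiring (S := S) f hf) (wiring g hg))
      (wiring (fun i => (position v v').symm (Sum.map f g (position w w' i))) (fun i => by
        rw [← get_position, ← get_position, Equiv.apply_symm_apply]
        rcases position w w' i with j | j
        · exact hf j
        · exact hg j)) := by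
  refine isIso_of_equiv (position v v').symm (Equiv.sumEmpty Empty Empty) ?_ ?_ ?_ ?_ ?_ ?_
  · intro a
    change (v ++ v').get _ = _
    rw [← get_position, Equiv.apply_symm_apply]
  · rintro (a | a) <;> exact a.elim
  · rintro (a | a) <;> exact a.elim
  · rintro (a | a) <;> exact a.elim
  · intro i
    change (position v v').symm (Sum.map id id (position v v' i)) = i
    rw [Sum.map_id_id, id, Equiv.symm_apply_apply]
  · intro i
    rfl

theorem tensor_idn_idn (v w : List S.Obj) :
    IsIso (tensor (idn v) (idn (S := S) w)) (idn (v ++ w)) := by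
  have := tensor_wiring (S := S) (v := v) (v' := w) id (fun _ => rfl) id (fun _ => rfl)
  refine (setoid S _ _).trans this ?_
  refine isIso_of_equiv (Equiv.refl _) (Equiv.refl _) (fun _ => rfl) (fun a => a.elim)
    (fun a => a.elim) (fun a => a.elim) (fun _ => rfl) ?_
  intro i
  simp
  rfl

theorem symm_natural (u : List S.Obj) {v w : List S.Obj} (G : OpenHypergraph S v w) :
    cls (comp (tensor (idn u) G) (symm u w)) = cls (comp (symm u v) (tensor G (idn u))) := by
  rw [symm, symm, cls_eq (comp_wiring _ _ _), cls_eq (wiring_comp _ _ _)]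
  refine cls_eq (isIso_of_equiv (Equiv.sumComm _ _) (Equiv.sumComm _ _) ?_ ?_ ?_ ?_ ?_ ?_)
  · rintro (a | a) <;> rfl
  · rintro (a | a) <;> rfl
  · rintro (a | a)
    · exact a.elim
    · simp [Function.comp_def]
  · rintro (a | a)
    · exact a.elim
    · simp [Function.comp_def]
  · intro i
    simp only [swapPosition, Equiv.symm_trans_apply, Equiv.symm_symm, Equiv.apply_symm_apply]
    rcases position u v i with j | j <;> rfl
  · intro i
    simp only [swapPosition, Equiv.trans_apply, Equiv.apply_symm_apply]
    rcases position w u i with j | j <;> rfl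

theorem symm_symm (v w : List S.Obj) :
    cls (comp (symm v w) (symm w v)) = cls (idn (S := S) (v ++ w)) := by
  rw [symm, symm, cls_eq (comp_wiring _ _ _)]
  refine cls_eq (isIso_of_equiv (Equiv.refl _) (Equiv.refl _) (fun _ => rfl) (fun a => a.elim)
    (fun a => a.elim) (fun a => a.elim) (fun _ => rfl) ?_)
  intro i
  simp [swapPosition]
  rfl

/-- The hypergraph with a single hyperedge, labelled with `d`, all of whose sources and targets are
distinct nodes. -/
def opCarrier (d : S.Op) : Hypergraph S where
  Node := Fin (S.arity d).length ⊕ Fin (S.coarity d).length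
  Edge := Unit
  finite_node := inferInstance
  finite_edge := inferInstance
  nodeLabel := Sum.elim (S.arity d).get (S.coarity d).get
  edgeLabel _ := d
  source _ := (List.finRange _).map .inl
  target _ := (List.finRange _).map .inr
  map_source _ := by simp [Function.comp_def]
  map_target _ := by simp [Function.comp_def]

/-- The open hypergraph of an operation: its interfaces are the sources and the targets of the
unique hyperedge. -/
def ofOp (d : S.Op) : OpenHypergraph S (S.arity d) (S.coarity d) where
  carrier := opCarrier d
  left := Hypergraph.ofDiscrete .inl (fun _ => rfl)
  right := Hypergraph.ofDiscrete .inr (fun _ => rfl)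

/-- The open hypergraph with a single node and no hyperedges, all of whose ports are attached to
this node. -/
def spider (x : S.Obj) (v w : List S.Obj) (hv : ∀ a ∈ v, a = x) (hw : ∀ a ∈ w, a = x) :
    OpenHypergraph S v w where
  carrier := Hypergraph.discrete [x]
  left := Hypergraph.ofDiscrete (fun _ => (0 : Fin 1)) (fun _ => (hv _ (List.get_mem _ _)).symm)
  right := Hypergraph.ofDiscrete (fun _ => (0 : Fin 1)) (fun _ => (hw _ (List.get_mem _ _)).symm)

/-- The open hypergraph of a Frobenius generator. -/
def ofFrobOp : (d : FrobOp S.Obj) → OpenHypergraph S d.arity d.coarity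
  | .comult x => spider x [x] [x, x] (by simp) (by simp)
  | .counit x => spider x [x] [] (by simp) (by simp)
  | .mult x => spider x [x, x] [x] (by simp) (by simp)
  | .unit x => spider x [] [x] (by simp) (by simp)

end OpenHypergraph

/-- Morphisms `v ⟶ w` of the category of open hypergraphs: isomorphism classes of cospans. -/
def HypHom (S : Signature.{u, v}) (v w : List S.Obj) : Type (max 1 u v) :=
  Quotient (OpenHypergraph.setoid S v w)

namespace HypHom

variable {S : Signature.{u, v}}

/-- The isomorphism class of an open hypergraph. -/
def mk {v w : List S.Obj} (G : OpenHypergraph S v w) : HypHom S v w := OpenHypergraph.cls G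

/-- Sequential composition of isomorphism classes of open hypergraphs. -/
def comp {u v w : List S.Obj} (c : HypHom S u v) (d : HypHom S v w) : HypHom S u w :=
  Quotient.map₂ OpenHypergraph.comp (fun _ _ h _ _ h' => OpenHypergraph.comp_congr h h') c d

/-- Parallel composition of isomorphism classes of open hypergraphs. -/
def tensor {v₁ w₁ v₂ w₂ : List S.Obj} (c : HypHom S v₁ w₁) (d : HypHom S v₂ w₂) :
    HypHom S (v₁ ++ v₂) (w₁ ++ w₂) :=
  Quotient.map₂ OpenHypergraph.tensor (fun _ _ h _ _ h' => OpenHypergraph.tensor_congr h h') c d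

theorem id_comp {v w : List S.Obj} (c : HypHom S v w) : comp (mk (.idn v)) c = c := by
  induction c using Quotient.inductionOn with | _ G => ?_
  refine (OpenHypergraph.cls_eq (OpenHypergraph.wiring_comp (Equiv.refl _) (fun _ => rfl) G)).trans ?_
  exact OpenHypergraph.cls_eq (OpenHypergraph.isIso_of_equiv (Equiv.refl _) (Equiv.refl _)
    (fun _ => rfl) (fun _ => rfl) (by simp) (by simp) (fun _ => rfl) (fun _ => rfl))

theorem comp_id {v w : List S.Obj} (c : HypHom S v w) : comp c (mk (.idn w)) = c := by
  induction c using Quotient.inductionOn with | _ G => ?_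
  refine (OpenHypergraph.cls_eq (OpenHypergraph.comp_wiring G id (fun _ => rfl))).trans ?_
  exact OpenHypergraph.cls_eq (OpenHypergraph.isIso_of_equiv (Equiv.refl _) (Equiv.refl _)
    (fun _ => rfl) (fun _ => rfl) (by simp) (by simp) (fun _ => rfl) (fun _ => rfl))

theorem assoc {u v w z : List S.Obj} (a : HypHom S u v) (b : HypHom S v w) (c : HypHom S w z) :
    comp (comp a b) c = comp a (comp b c) := by
  induction a using Quotient.inductionOn
  induction b using Quotient.inductionOn
  induction c using Quotient.inductionOn
  exact OpenHypergraph.cls_eq (OpenHypergraph.comp_assoc _ _ _)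

theorem symm_append (u v w : List S.Obj) :
    HEq (mk (S := S) (.symm u (v ++ w)))
      (comp (tensor (mk (.symm u v)) (mk (.idn w)))
        (comp (mk (.wiring (finCongr (congrArg List.length (List.append_assoc v u w).symm))
          (by simp))) (tensor (mk (.idn v)) (mk (.symm u w))))) := by
  have h₁ := OpenHypergraph.cls_eq (OpenHypergraph.tensor_wiring (S := S) _
    (OpenHypergraph.get_swapPosition u v) id (fun i : Fin w.length => rfl))
  have h₂ := OpenHypergraph.cls_eq (OpenHypergraph.tensor_wiring (S := S) id
    (fun i : Fin v.length => rfl) _ (OpenHypergraph.get_swapPosition u w))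
  have e₁ : tensor (mk (.symm u v)) (mk (.idn w)) = mk (S := S) _ := h₁
  have e₂ : tensor (mk (.idn v)) (mk (.symm u w)) = mk (S := S) _ := h₂
  rw [e₁, e₂]
  have e₃ {a b c d : List S.Obj} (f : Fin b.length → Fin a.length) (hf)
      (g : Fin c.length → Fin b.length) (hg) (k : Fin d.length → Fin c.length) (hk) :
      comp (mk (S := S) (.wiring f hf)) (comp (mk (.wiring g hg)) (mk (.wiring k hk))) =
        mk (.wiring (fun i => f (g (k i))) (fun i => by rw [hf, hg, hk])) := by
    have h₃ : comp (mk (S := S) (.wiring g hg)) (mk (.wiring k hk)) = mk _ :=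
      OpenHypergraph.cls_eq (OpenHypergraph.comp_wiring _ k hk)
    rw [h₃]
    exact OpenHypergraph.cls_eq (OpenHypergraph.comp_wiring _ _ _)
  rw [e₃]
  refine OpenHypergraph.cls_heq (List.append_assoc u v w).symm (List.append_assoc v w u)
    (finCongr (congrArg List.length (List.append_assoc u v w).symm)) (Equiv.refl _)
    ?_ (fun a => a.elim) (fun a => a.elim) (fun a => a.elim) (fun i => rfl) ?_
  · intro i
    change ((u ++ v) ++ w).get (Fin.cast (by simp) i) = (u ++ (v ++ w)).get i
    simp
    rfl
  · have hL {x y : List S.Obj} (j : Fin y.length) : OpenHypergraph.swapPosition x y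
        ((OpenHypergraph.position y x).symm (.inl j)) =
        (OpenHypergraph.position x y).symm (.inr j) := by simp [OpenHypergraph.swapPosition]
    have hR {x y : List S.Obj} (j : Fin x.length) : OpenHypergraph.swapPosition x y
        ((OpenHypergraph.position y x).symm (.inr j)) =
        (OpenHypergraph.position x y).symm (.inl j) := by simp [OpenHypergraph.swapPosition]
    intro i
    obtain ⟨i, rfl⟩ := (OpenHypergraph.position (v ++ w) u).symm.surjective i
    change Fin.cast (congrArg List.length (List.append_assoc u v w).symm)
        (OpenHypergraph.swapPosition u (v ++ w) _) =
      (OpenHypergraph.position (u ++ v) w).symm (Sum.map (OpenHypergraph.swapPosition u v) id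
        (OpenHypergraph.position (v ++ u) w
        (Fin.cast (congrArg List.length (List.append_assoc v u w).symm)
          ((OpenHypergraph.position v (u ++ w)).symm (Sum.map id (OpenHypergraph.swapPosition u w)
          (OpenHypergraph.position v (w ++ u)
            (Fin.cast (congrArg List.length (List.append_assoc v w u)) _)))))))
    rcases i with i | i
    · obtain ⟨i, rfl⟩ := (OpenHypergraph.position v w).symm.surjective i
      rcases i with i | i
      · have c₁ : Fin.cast (congrArg List.length (List.append_assoc v w u))
            ((OpenHypergraph.position (v ++ w) u).symm (.inl
              ((OpenHypergraph.position v w).symm (.inl i)))) =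
            (OpenHypergraph.position v (w ++ u)).symm (.inl i) := by
          ext; simp [OpenHypergraph.position_symm_inl]
        have c₂ : Fin.cast (congrArg List.length (List.append_assoc v u w).symm)
            ((OpenHypergraph.position v (u ++ w)).symm (.inl i)) =
            (OpenHypergraph.position (v ++ u) w).symm (.inl
              ((OpenHypergraph.position v u).symm (.inl i))) := by
          ext; simp [OpenHypergraph.position_symm_inl]
        rw [c₁, Equiv.apply_symm_apply, Sum.map_inl, id, c₂, Equiv.apply_symm_apply, Sum.map_inl,
          hL, hL]
        ext; simp [OpenHypergraph.position_symm_inl, OpenHypergraph.position_symm_inr]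
      · have c₁ : Fin.cast (congrArg List.length (List.append_assoc v w u))
            ((OpenHypergraph.position (v ++ w) u).symm (.inl
              ((OpenHypergraph.position v w).symm (.inr i)))) =
            (OpenHypergraph.position v (w ++ u)).symm (.inr
              ((OpenHypergraph.position w u).symm (.inl i))) := by
          ext; simp [OpenHypergraph.position_symm_inl, OpenHypergraph.position_symm_inr]
        have c₂ : Fin.cast (congrArg List.length (List.append_assoc v u w).symm)
            ((OpenHypergraph.position v (u ++ w)).symm (.inr
              ((OpenHypergraph.position u w).symm (.inr i)))) =
            (OpenHypergraph.position (v ++ u) w).symm (.inr i) := by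
          ext; simp [OpenHypergraph.position_symm_inr, Nat.add_assoc]
        rw [c₁, Equiv.apply_symm_apply, Sum.map_inr, hL, hL, c₂, Equiv.apply_symm_apply,
          Sum.map_inr, id]
        ext; simp [OpenHypergraph.position_symm_inr, Nat.add_assoc]
    · have c₁ : Fin.cast (congrArg List.length (List.append_assoc v w u))
          ((OpenHypergraph.position (v ++ w) u).symm (.inr i)) =
          (OpenHypergraph.position v (w ++ u)).symm (.inr
            ((OpenHypergraph.position w u).symm (.inr i))) := by
        ext; simp [OpenHypergraph.position_symm_inr, Nat.add_assoc]
      have c₂ : Fin.cast (congrArg List.length (List.append_assoc v u w).symm)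
          ((OpenHypergraph.position v (u ++ w)).symm (.inr
            ((OpenHypergraph.position u w).symm (.inl i)))) =
          (OpenHypergraph.position (v ++ u) w).symm (.inl
            ((OpenHypergraph.position v u).symm (.inr i))) := by
        ext; simp [OpenHypergraph.position_symm_inl, OpenHypergraph.position_symm_inr]
      rw [c₁, Equiv.apply_symm_apply, Sum.map_inr, hR, hR, c₂, Equiv.apply_symm_apply,
        Sum.map_inl, hR]
      ext; simp [OpenHypergraph.position_symm_inl]

end HypHom

/-- The category of open hypergraphs labelled in `S`: objects are words of generating objects,
identified with discrete hypergraphs, and morphisms are isomorphism classes of open hypergraphs. -/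
structure Hyp (S : Signature.{u, v}) where
  word : List S.Obj

instance (S : Signature.{u, v}) : Category (Hyp S) where
  Hom X Y := HypHom S X.word Y.word
  id X := HypHom.mk (.idn X.word)
  comp f g := HypHom.comp f g
  id_comp := HypHom.id_comp
  comp_id := HypHom.comp_id
  assoc := HypHom.assoc

theorem Hyp.eqToHom_eq {S : Signature.{u, v}} {X Y : Hyp S} (h : X = Y) :
    eqToHom h = HypHom.mk (.wiring (finCongr (by rw [h])) (by subst h; simp)) := by
  subst h
  rfl

instance (S : Signature.{u, v}) : StrictSMC (Hyp S) where
  tensorObj X Y := ⟨X.word ++ Y.word⟩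
  unit := ⟨[]⟩
  tensorHom f g := HypHom.tensor f g
  symm X Y := HypHom.mk (.symm X.word Y.word)
  tensorObj_assoc X Y Z := congrArg Hyp.mk (List.append_assoc _ _ _)
  unit_tensorObj _ := rfl
  tensorObj_unit X := congrArg Hyp.mk (List.append_nil _)
  tensorHom_id X Y := OpenHypergraph.cls_eq (OpenHypergraph.tensor_idn_idn _ _)
  tensorHom_comp c₁ d₁ c₂ d₂ := by
    induction c₁ using Quotient.inductionOn
    induction d₁ using Quotient.inductionOn
    induction c₂ using Quotient.inductionOn
    induction d₂ using Quotient.inductionOn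
    exact OpenHypergraph.cls_eq (OpenHypergraph.tensor_comp _ _ _ _)
  tensorHom_assoc c₁ c₂ c₃ := by
    induction c₁ using Quotient.inductionOn
    induction c₂ using Quotient.inductionOn
    induction c₃ using Quotient.inductionOn
    exact OpenHypergraph.tensor_assoc _ _ _
  unit_tensorHom c := by
    induction c using Quotient.inductionOn
    exact OpenHypergraph.idn_tensor _
  tensorHom_unit c := by
    induction c using Quotient.inductionOn
    exact OpenHypergraph.tensor_idn _
  symm_natural X _ _ c := by
    induction c using Quotient.inductionOn
    exact OpenHypergraph.symm_natural X.word _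
  symm_symm X Y := OpenHypergraph.symm_symm X.word Y.word
  symm_tensor X Y Z := by
    rw [Hyp.eqToHom_eq]
    exact HypHom.symm_append _ _ _

/-- The interpretation of the operations of `S + scFrob` as open hypergraphs. -/
def interpOp (S : Signature.{u, v}) :
    (d : S.addFrob.Op) → HypHom S (S.addFrob.arity d) (S.addFrob.coarity d)
  | Sum.inl d => HypHom.mk (.ofOp d)
  | Sum.inr d => HypHom.mk (.ofFrobOp d)

/-- The interpretation of terms over `S + scFrob` as open hypergraphs labelled in `S`. -/
def interp (S : Signature.{u, v}) :
    {v w : List S.Obj} → Term S.addFrob v w → HypHom S v w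
  | _, _, .op d => interpOp S d
  | _, _, .idn x => HypHom.mk (OpenHypergraph.idn (S := S) [x])
  | _, _, .swap x y => HypHom.mk (OpenHypergraph.symm (S := S) [x] [y])
  | _, _, .null => HypHom.mk (.idn [])
  | _, _, .seq c d => HypHom.comp (interp S c) (interp S d)
  | _, _, .par c d => HypHom.tensor (interp S c) (interp S d)

end StringDiag

open StringDiag

/-! Soundness is a check of axioms. Fullness is a decomposition of hypergraphs. The hard point is
faithfulness: two terms with isomorphic hypergraphs must be provably equal. It is proved by building
a semantics of open hypergraphs inside the free category itself, using a form of regular logic that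
is available in any symmetric monoidal category with special commutative Frobenius structures.

The monoid parts make the generating objects commutative monoid objects, and for these the tensor
product is the coproduct. A finite set `N` of sorted variables therefore has a free object `free N`,
the coproduct of its sorts, and a map of contexts acts on free objects by renaming (`map`). The
global elements of `free N` form a commutative monoid. They are read as formulas in the variables
`N`, with multiplication as conjunction. The comultiplication applied to the unit yields the
equality predicate, and the counit yields existential quantification. The Frobenius, special and
counit laws become substitution of equals, reflexivity and the one-point rule (quantifying a
variable that equals a given one is substitution).

Equations and quantifiers define an inverse image `pull f`, contravariant in `f`. Two facts carry
the semantics: the Beck-Chevalley condition for pushout squares (`pull_comp_map_of_isPush`) and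
Frobenius reciprocity (`copair_map_pull`). A cospan of contexts with a formula on its apex denotes
the morphism `sem`: rename along the left leg, multiply by the formula, pull back along the right
leg. By the two facts, composition of such morphisms is pushout with conjunction of the formulas
(`sem_comp`), and tensoring is disjoint union (`sem_tensor`). Every morphism between free objects
has this form for a formula on the disjoint union of the contexts (`exists_sem_eq`), so each
operation of the signature can be represented by a formula. A hypergraph then denotes the
conjunction of the formulas of its hyperedges, and this depends only on its isomorphism class.

A word is isomorphic to the free object on its positions (`wordIso`). Induction on terms shows that
this isomorphism intertwines a term with the denotation of its interpretation (`wordIso_denote`).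
Hence the interpretation determines the class of the term.

For fullness, the nodes of a hypergraph are listed as a word `L`. The hypergraph is then a map of
words into `L`, followed by its hyperedges attached one at a time to `L`, followed by a reversed map
of words. Maps of words are generated by transpositions, folds and initial maps, which are
interpretations of symmetries and Frobenius generators. -/

namespace StringDiag

open MonoidalCategory MonObj Limits

set_option linter.unusedSectionVars false

universe u₁ v₁

/-! ### Commutative monoid objects: products with global elements, inclusions and copairings. -/

section CommutativeMonoids

variable {C : Type u₁} [Category.{v₁} C] [MonoidalCategory C] [SymmetricCategory C]

/-- The product of a generalized element of a monoid object with a global element. -/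
def act {B : C} [MonObj B] {Z : C} (X : Z ⟶ B) (T : 𝟙_ C ⟶ B) : Z ⟶ B :=
  (ρ_ Z).inv ≫ (X ⊗ₘ T) ≫ μ

section

variable {B B' D D' Z Z' : C} [MonObj B] [MonObj B'] [MonObj D] [MonObj D']

theorem act_one (X : Z ⟶ B) : act X η = X := by
  simp [act, mon_tauto]

theorem comp_act (f : Z' ⟶ Z) (X : Z ⟶ B) (T : 𝟙_ C ⟶ B) : f ≫ act X T = act (f ≫ X) T := by
  simp [act, MonoidalCategory.tensorHom_def]

theorem act_comp (X : Z ⟶ B) (T : 𝟙_ C ⟶ B) (f : B ⟶ B') [IsMonHom f] :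
    act X T ≫ f = act (X ≫ f) (T ≫ f) := by
  simp [act]

/-- Associativity of `μ`: a global factor can be absorbed into the right-hand argument of a product.
-/
theorem mul_act (U : Z ⟶ B) (V : Z' ⟶ B) (T : 𝟙_ C ⟶ B) :
    act ((U ⊗ₘ V) ≫ μ) T = (U ⊗ₘ act V T) ≫ μ := by
  have h₁ : ((U ⊗ₘ V) ≫ μ ⊗ₘ T) = ((U ⊗ₘ V) ⊗ₘ T) ≫ μ ▷ B := by
    rw [← tensorHom_id, tensorHom_comp_tensorHom, Category.comp_id]
  have h₂ : (U ⊗ₘ act V T) = Z ◁ (ρ_ Z').inv ≫ (U ⊗ₘ (V ⊗ₘ T)) ≫ B ◁ μ := by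
    rw [← id_tensorHom, ← id_tensorHom, tensorHom_comp_tensorHom, tensorHom_comp_tensorHom,
      Category.comp_id, Category.id_comp]
    rfl
  rw [act, h₁, h₂]
  simp only [Category.assoc, MonObj.mul_assoc]
  rw [associator_naturality_assoc, rightUnitor_tensor_inv_assoc, Iso.inv_hom_id_assoc]

theorem act_act (X : Z ⟶ B) (S T : 𝟙_ C ⟶ B) : act (act X S) T = act X (act S T) := by
  have h := mul_act X S T
  rw [act.eq_1 X S, ← comp_act, h]
  rfl

theorem act_eq [IsCommMonObj B] (X : Z ⟶ B) (T : 𝟙_ C ⟶ B) :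
    act X T = (λ_ Z).inv ≫ (T ⊗ₘ X) ≫ μ := by
  rw [act, ← IsCommMonObj.mul_comm B, BraidedCategory.braiding_naturality_assoc]
  simp

theorem act_comm [IsCommMonObj B] (S T : 𝟙_ C ⟶ B) : act S T = act T S := by
  rw [act_eq, act, unitors_inv_equal]

/-- The left inclusion into a tensor product of monoid objects. -/
def inlHom (B D : C) [MonObj D] : B ⟶ B ⊗ D := (ρ_ B).inv ≫ B ◁ η

/-- The right inclusion into a tensor product of monoid objects. -/
def inrHom (B D : C) [MonObj B] : D ⟶ B ⊗ D := (λ_ D).inv ≫ η ▷ D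

/-- With this instance the inclusions `inlHom` and `inrHom` are homomorphisms by inference, being
unitors followed by a whiskered unit. -/
instance isMonHom_one : IsMonHom (η : 𝟙_ C ⟶ B) where
  one_hom := Category.id_comp _
  mul_hom := by
    rw [tensorHom_def', Category.assoc, MonObj.one_mul, leftUnitor_naturality]
    rfl

instance : IsMonHom (inlHom B D) := by
  unfold inlHom; infer_instance

instance : IsMonHom (inrHom B D) := by
  unfold inrHom; infer_instance

/-- This is where commutativity enters. It makes copairings of homomorphisms into homomorphisms, so
that the tensor product is a coproduct. -/
instance isMonHom_mul [IsCommMonObj B] : IsMonHom (μ : B ⊗ B ⟶ B) where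
  one_hom := by
    rw [tensorObj.one_def, Category.assoc]
    exact (act_eq _ _).symm.trans (act_one _)
  mul_hom := by simp [tensorObj.mul_def]

/-- An element coming from the first factor has the unit as its second component, so multiplying by
it affects only the first factor. -/
theorem inl_mul (U : Z ⟶ B) (V : Z' ⟶ B ⊗ D) :
    ((U ≫ inlHom B D) ⊗ₘ V) ≫ μ = (U ⊗ₘ V) ≫ (α_ B B D).inv ≫ μ ▷ D := by
  have h : inlHom B D ▷ (B ⊗ D) ≫ μ = (α_ B B D).inv ≫ μ ▷ D := by
    have h₁ : inlHom B D = (ρ_ B).inv ≫ (𝟙 B ⊗ₘ η) := by rw [inlHom, id_tensorHom]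
    rw [h₁, tensorObj.mul_def, comp_whiskerRight, Category.assoc, tensorμ_natural_left_assoc,
      tensorHom_comp_tensorHom, id_whiskerRight, Category.id_comp, MonObj.one_mul]
    simp only [tensorμ]
    have h₂ : (μ ⊗ₘ (λ_ D).hom : (B ⊗ B) ⊗ (𝟙_ C ⊗ D) ⟶ B ⊗ D) = (B ⊗ B) ◁ (λ_ D).hom ≫ μ ▷ D := by
      rw [tensorHom_def']
    rw [h₂]
    simp only [braiding_tensorUnit_left, Category.assoc]
    monoidal
  rw [← h, ← tensorHom_id, tensorHom_comp_tensorHom_assoc, Category.comp_id]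

/-- Linearity over the first factor. The point is that `d` need not be a homomorphism; the counit of
a Frobenius structure will not be one in general. -/
theorem inl_mul_whisker {E : C} (U : Z ⟶ B) (V : Z' ⟶ B ⊗ D) [MonObj E] (d : D ⟶ E) :
    (((U ≫ inlHom B D) ⊗ₘ V) ≫ μ) ≫ B ◁ d = ((U ≫ inlHom B E) ⊗ₘ (V ≫ B ◁ d)) ≫ μ := by
  rw [inl_mul, inl_mul]
  have h : U ⊗ₘ (V ≫ B ◁ d) = (U ⊗ₘ V) ≫ B ◁ B ◁ d := by
    rw [← id_tensorHom B (B ◁ d), tensorHom_comp_tensorHom, Category.comp_id]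
  rw [h]
  simp only [Category.assoc]
  rw [associator_inv_naturality_right_assoc, whisker_exchange]

theorem act_inl_whisker {E : C} (U : Z ⟶ B) (T : 𝟙_ C ⟶ B ⊗ D) [MonObj E] (d : D ⟶ E) :
    act (U ≫ inlHom B D) T ≫ B ◁ d = act (U ≫ inlHom B E) (T ≫ B ◁ d) := by
  rw [act, act, Category.assoc, inl_mul_whisker]

/-- The morphism out of a tensor product given by morphisms to a monoid object. -/
def copair {Z Z' : C} (f : Z ⟶ B) (g : Z' ⟶ B) : Z ⊗ Z' ⟶ B := (f ⊗ₘ g) ≫ μ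

instance (f : D ⟶ B) (g : D' ⟶ B) [IsCommMonObj B] [IsMonHom f] [IsMonHom g] :
    IsMonHom (copair f g) := by
  unfold copair; infer_instance

theorem inl_copair (f : Z ⟶ B) (g : D ⟶ B) [IsMonHom g] :
    inlHom Z D ≫ copair f g = f := by
  rw [inlHom, copair, ← id_tensorHom, Category.assoc, tensorHom_comp_tensorHom_assoc,
    IsMonHom.one_hom, Category.id_comp]
  exact act_one f

theorem inr_copair [IsCommMonObj B] (f : D ⟶ B) (g : Z ⟶ B) [IsMonHom f] :
    inrHom D Z ≫ copair f g = g := by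
  rw [inrHom, copair, ← tensorHom_id, Category.assoc, tensorHom_comp_tensorHom_assoc,
    IsMonHom.one_hom, Category.id_comp, ← act_eq, act_one]

theorem copair_inl_inr [IsCommMonObj B] [IsCommMonObj D] :
    copair (inlHom B D) (inrHom B D) = 𝟙 (B ⊗ D) := by
  have h := inl_mul (D := D) (𝟙 B) (inrHom B D)
  rw [Category.id_comp] at h
  rw [copair, h, inrHom, id_tensorHom, MonoidalCategory.whiskerLeft_comp,
    Category.assoc, associator_inv_naturality_middle_assoc, ← comp_whiskerRight, MonObj.mul_one]
  monoidal

theorem copair_comp {f : Z ⟶ B} {g : Z' ⟶ B} (k : B ⟶ D) [IsMonHom k] :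
    copair f g ≫ k = copair (f ≫ k) (g ≫ k) := by
  simp [copair]

theorem copair_unique [IsCommMonObj B] [IsCommMonObj D] (f : B ⊗ D ⟶ D') [IsMonHom f] :
    f = copair (inlHom B D ≫ f) (inrHom B D ≫ f) := by
  rw [← copair_comp, copair_inl_inr, Category.id_comp]

/-- The morphism that discards the second factor by means of a morphism to the unit. -/
def discard (B : C) (d : D ⟶ 𝟙_ C) : B ⊗ D ⟶ B := B ◁ d ≫ (ρ_ B).hom

theorem inlHom_unit : inlHom B (𝟙_ C) ≫ (ρ_ B).hom = 𝟙 B := by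
  change ((ρ_ B).inv ≫ B ◁ 𝟙 _) ≫ (ρ_ B).hom = 𝟙 B
  simp

theorem inl_mul_discard (U : Z ⟶ B) (V : Z' ⟶ B ⊗ D) (d : D ⟶ 𝟙_ C) :
    (((U ≫ inlHom B D) ⊗ₘ V) ≫ μ) ≫ discard B d = (U ⊗ₘ (V ≫ discard B d)) ≫ μ := by
  rw [discard, ← Category.assoc, inl_mul_whisker, Category.assoc, IsMonHom.mul_hom,
    tensorHom_comp_tensorHom_assoc, Category.assoc, Category.assoc, inlHom_unit, Category.comp_id]

/-- Logically, a conjunct that does not mention the quantified variable can be moved out of the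
scope of the quantifier. -/
theorem act_discard [IsCommMonObj B] [IsCommMonObj D] (X : Z ⟶ B ⊗ D) (T : 𝟙_ C ⟶ B)
    (d : D ⟶ 𝟙_ C) :
    act X (T ≫ inlHom B D) ≫ discard B d = act (X ≫ discard B d) T := by
  rw [act_eq, act_eq, Category.assoc, inl_mul_discard]

/-- Global elements of a commutative monoid object form a commutative monoid. -/
instance globalElements [IsCommMonObj B] : CommMonoid (𝟙_ C ⟶ B) where
  mul := act
  one := η
  mul_assoc := act_act
  one_mul T := (act_comm _ _).trans (act_one T)
  mul_one := act_one
  mul_comm := act_comm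

theorem act_mul [IsCommMonObj B] (X : Z ⟶ B) (S T : 𝟙_ C ⟶ B) :
    act X (S * T) = act (act X S) T := (act_act X S T).symm

theorem global_mul_eq [IsCommMonObj B] (S T : 𝟙_ C ⟶ B) : S * T = act S T := rfl

theorem global_one_eq [IsCommMonObj B] : (1 : 𝟙_ C ⟶ B) = η := rfl

/-- Postcomposition with a monoid homomorphism is a homomorphism on global elements. -/
def globalMap [IsCommMonObj B] [IsCommMonObj B'] (f : B ⟶ B') [IsMonHom f] :
    (𝟙_ C ⟶ B) →* (𝟙_ C ⟶ B') where
  toFun T := T ≫ f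
  map_one' := IsMonHom.one_hom f
  map_mul' S T := act_comp S T f

end

end CommutativeMonoids

/-! ### Frobenius structures as equality predicates. -/

section Frobenius

variable {C : Type u₁} [Category.{v₁} C] [MonoidalCategory C] [SymmetricCategory C]

/-- A family of special commutative Frobenius structures in a symmetric monoidal category. -/
structure FrobFamily (A : Type u) (C : Type u₁) [Category.{v₁} C] [MonoidalCategory C]
    [SymmetricCategory C] where
  obj : A → CommMon C
  comul (x : A) : (obj x).X ⟶ (obj x).X ⊗ (obj x).X
  counit (x : A) : (obj x).X ⟶ 𝟙_ C
  comul_counit (x : A) : comul x ≫ (obj x).X ◁ counit x = (ρ_ _).inv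
  cocomm (x : A) : comul x ≫ (β_ _ _).hom = comul x
  coassoc (x : A) : comul x ≫ comul x ▷ _ ≫ (α_ _ _ _).hom = comul x ≫ _ ◁ comul x
  frobenius (x : A) : _ ◁ comul x ≫ (α_ _ _ _).inv ≫ μ ▷ _ = μ ≫ comul x
  special (x : A) : comul x ≫ μ = 𝟙 _

variable {A : Type u} (Φ : FrobFamily A C)

section

variable {B B' : C} [MonObj B] [MonObj B'] {x : A}

namespace FrobFamily

/-- The Frobenius law says that the comultiplication is linear for multiplication on the left, hence
it is determined by its value at the unit. -/
theorem act_inl_comul (x : A) : act (inlHom _ _) (η ≫ Φ.comul x) = Φ.comul x := by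
  have h := inl_mul (𝟙 (Φ.obj x).X) (η ≫ Φ.comul x)
  rw [Category.id_comp] at h
  rw [act, h, id_tensorHom, MonoidalCategory.whiskerLeft_comp, Category.assoc, Φ.frobenius]
  simp

/-- The convolution product of morphisms out of a Frobenius object. -/
def conv (f g : (Φ.obj x).X ⟶ B) : (Φ.obj x).X ⟶ B := Φ.comul x ≫ copair f g

theorem conv_comm [IsCommMonObj B] (f g : (Φ.obj x).X ⟶ B) : Φ.conv f g = Φ.conv g f := by
  have h : copair f g = (β_ _ _).hom ≫ copair g f := by
    rw [copair, copair, ← BraidedCategory.braiding_naturality_assoc, IsCommMonObj.mul_comm]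
  rw [conv, conv, h, reassoc_of% Φ.cocomm]

theorem conv_assoc (f g h : (Φ.obj x).X ⟶ B) :
    Φ.conv (Φ.conv f g) h = Φ.conv f (Φ.conv g h) := by
  have h₁ : copair (Φ.conv f g) h = Φ.comul x ▷ _ ≫ ((f ⊗ₘ g) ⊗ₘ h) ≫ μ ▷ _ ≫ μ := by
    rw [copair, conv, copair, ← tensorHom_id, ← tensorHom_id, tensorHom_comp_tensorHom_assoc,
      tensorHom_comp_tensorHom_assoc]
    simp
  have h₂ : copair f (Φ.conv g h) = _ ◁ Φ.comul x ≫ (f ⊗ₘ g ⊗ₘ h) ≫ _ ◁ μ ≫ μ := by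
    rw [copair, conv, copair, ← id_tensorHom, ← id_tensorHom, tensorHom_comp_tensorHom_assoc,
      tensorHom_comp_tensorHom_assoc]
    simp
  rw [conv, h₁, conv, h₂, MonObj.mul_assoc, ← reassoc_of% Φ.coassoc, associator_naturality_assoc]

/-- The equality predicate between two elements of sort `x`. -/
def eqElt (a b : (Φ.obj x).X ⟶ B) : 𝟙_ C ⟶ B := η ≫ Φ.conv a b

theorem eqElt_comp (a b : (Φ.obj x).X ⟶ B) (f : B ⟶ B') [IsMonHom f] :
    Φ.eqElt a b ≫ f = Φ.eqElt (a ≫ f) (b ≫ f) := by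
  simp [eqElt, conv, copair_comp]

theorem eqElt_comm [IsCommMonObj B] (a b : (Φ.obj x).X ⟶ B) : Φ.eqElt a b = Φ.eqElt b a := by
  rw [eqElt, conv_comm, eqElt]

/-- A homomorphism moves past the multiplication, and the special law then cancels it against the
comultiplication. -/
theorem eqElt_self (a : (Φ.obj x).X ⟶ B) [IsMonHom a] : Φ.eqElt a a = η := by
  rw [eqElt, conv, copair, ← IsMonHom.mul_hom, reassoc_of% Φ.special, IsMonHom.one_hom]

/-- The image of `act_inl_comul` under `copair a b`. The right-hand side is symmetric in `a` and `b`
by `conv_comm`, which is what makes substitution of equals possible. -/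
theorem act_eqElt [IsCommMonObj B] (a b : (Φ.obj x).X ⟶ B) [IsMonHom a] [IsMonHom b] :
    act a (Φ.eqElt a b) = Φ.conv a b := by
  have h := congrArg (· ≫ copair a b) (Φ.act_inl_comul x)
  simp only [act_comp, inl_copair] at h
  rw [Category.assoc] at h
  exact h

theorem conv_act (a b : (Φ.obj x).X ⟶ B) (T : 𝟙_ C ⟶ B) :
    act (Φ.conv a b) T = Φ.conv a (act b T) := by
  rw [conv, ← comp_act, copair, mul_act]; rfl

/-- Both sides unfold to the unit followed by the convolution of the three elements, in different
orders. -/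
theorem eqElt_trans [IsCommMonObj B] (a b c : (Φ.obj x).X ⟶ B) [IsMonHom a] [IsMonHom b]
    [IsMonHom c] : Φ.eqElt a b * Φ.eqElt b c = Φ.eqElt a b * Φ.eqElt a c := by
  rw [global_mul_eq, global_mul_eq, eqElt.eq_1 Φ a b, ← comp_act, conv_act, act_eqElt,
    ← comp_act, Φ.conv_comm a b, conv_act, act_eqElt, ← conv_assoc, ← conv_assoc, Φ.conv_comm a b]

/-- The one-point rule for a single variable: requiring the variable to equal `a` and quantifying it
away substitutes `a` for it. -/
theorem act_eqElt_discard [IsCommMonObj B] (a : (Φ.obj x).X ⟶ B) [IsMonHom a] :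
    act (𝟙 (B ⊗ (Φ.obj x).X)) (Φ.eqElt (inrHom _ _) (a ≫ inlHom _ _)) ≫
      discard B (Φ.counit x) = copair (𝟙 B) a := by
  have h : Φ.conv (inrHom B (Φ.obj x).X) (a ≫ inlHom _ _) = Φ.comul x ≫ a ▷ _ := by
    rw [conv_comm, conv]
    congr 1
    have := copair_inl_inr (B := B) (D := (Φ.obj x).X)
    rw [copair] at this
    rw [copair, ← tensorHom_id, ← Category.comp_id (a ⊗ₘ _), ← this, tensorHom_comp_tensorHom_assoc,
      Category.id_comp]
  -- The generic element is the product of its two components. The equation multiplies only the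
  -- second one and turns it into a comultiplication, one leg of which the counit then removes.
  rw [← copair_inl_inr, copair, mul_act, act_eqElt, h]
  have h' := inl_mul_discard (𝟙 B) (Φ.comul x ≫ a ▷ _) (Φ.counit x)
  rw [Category.id_comp] at h'
  rw [h', discard, Category.assoc, ← whisker_exchange_assoc, reassoc_of% Φ.comul_counit]
  simp [copair]

end FrobFamily

end

end Frobenius

/-! ### The tensor product as coproduct of commutative monoid objects. -/

section Coproducts

variable {C : Type u₁} [Category.{v₁} C] [MonoidalCategory C] [SymmetricCategory C]

/-- The underlying morphism of a morphism of commutative monoid objects. -/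
def und {B D : CommMon C} (f : B ⟶ D) : B.X ⟶ D.X := f.hom.hom

instance {B D : CommMon C} (f : B ⟶ D) : IsMonHom (und f) :=
  inferInstanceAs (IsMonHom (Mon.Hom.hom f.hom))

@[simp]
theorem und_id (B : CommMon C) : und (𝟙 B) = 𝟙 B.X := rfl

@[simp]
theorem und_comp {B D E : CommMon C} (f : B ⟶ D) (g : D ⟶ E) : und (f ≫ g) = und f ≫ und g := rfl

/-- A monoid homomorphism as a morphism of commutative monoid objects. -/
def ofMonHom {B D : CommMon C} (f : B.X ⟶ D.X) [IsMonHom f] : B ⟶ D :=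
  CommMon.homMk (@Mon.Hom.mk C _ _ B.toMon D.toMon f ‹_›)

theorem und_injective {B D : CommMon C} {f g : B ⟶ D} (h : und f = und g) : f = g :=
  CommMon.hom_ext f g h

/-- The tensor product of commutative monoid objects. -/
@[reducible]
def prodObj (B D : CommMon C) : CommMon C := ⟨B.X ⊗ D.X⟩

theorem prodObj_hom_ext {B D E : CommMon C} {m m' : prodObj B D ⟶ E}
    (hl : inlHom B.X D.X ≫ und m = inlHom B.X D.X ≫ und m')
    (hr : inrHom B.X D.X ≫ und m = inrHom B.X D.X ≫ und m') : m = m' := by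
  refine und_injective ((copair_unique (B := B.X) (D := D.X) (und m)).trans
    (Eq.trans ?_ (copair_unique (B := B.X) (D := D.X) (und m')).symm))
  rw [hl, hr]

/-- The morphism out of a tensor product of commutative monoid objects. -/
def prodDesc {B D E : CommMon C} (f : B ⟶ E) (g : D ⟶ E) : prodObj B D ⟶ E :=
  ofMonHom (B := prodObj B D) (copair (und f) (und g))

/-- The copairing is a homomorphism by commutativity of the target. It is unique because the
identity of the tensor product is the product of the two inclusions. -/
instance (B D : CommMon C) : HasColimit (pair B D) :=
  ⟨⟨⟨BinaryCofan.mk (P := prodObj B D) (ofMonHom (inlHom B.X D.X)) (ofMonHom (inrHom B.X D.X)),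
    BinaryCofan.IsColimit.mk _ prodDesc
      (fun f g => und_injective (inl_copair (und f) (und g)))
      (fun f g => und_injective (inr_copair (und f) (und g)))
      (fun f g _ h₁ h₂ => prodObj_hom_ext
        ((congrArg und h₁).trans (inl_copair (und f) (und g)).symm)
        ((congrArg und h₂).trans (inr_copair (und f) (und g)).symm))⟩⟩⟩

instance : HasFiniteCoproducts (CommMon C) :=
  have := hasBinaryCoproducts_of_hasColimit_pair (CommMon C)
  hasFiniteCoproducts_of_has_binary_and_initial

end Coproducts

/-! ### Contexts of sorted variables. -/

/-- A context: a finite set of variables labelled with sorts. -/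
structure Cxt (A : Type u) where
  pt : Type
  lab : pt → A
  finite : Finite pt := by infer_instance

namespace Cxt

attribute [instance] Cxt.finite

variable {A : Type u}

/-- Maps of contexts. -/
@[ext]
structure Hom (N P : Cxt A) where
  toFun : N.pt → P.pt
  lab_eq (n : N.pt) : P.lab (toFun n) = N.lab n

instance : Category (Cxt A) where
  Hom := Hom
  id N := ⟨id, fun _ => rfl⟩
  comp f g := ⟨fun n => g.toFun (f.toFun n), fun n => (g.lab_eq _).trans (f.lab_eq n)⟩

@[simp]
theorem id_toFun (N : Cxt A) (n : N.pt) : (𝟙 N : N ⟶ N).toFun n = n := rfl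

@[simp]
theorem comp_toFun {N P Q : Cxt A} (f : N ⟶ P) (g : P ⟶ Q) (n : N.pt) :
    (f ≫ g).toFun n = g.toFun (f.toFun n) := rfl

@[ext]
theorem hom_ext {N P : Cxt A} {f g : N ⟶ P} (h : ∀ n, f.toFun n = g.toFun n) : f = g :=
  Hom.ext (funext h)

/-- The disjoint union of contexts. -/
@[reducible]
def sum (N P : Cxt A) : Cxt A := ⟨N.pt ⊕ P.pt, Sum.elim N.lab P.lab, inferInstance⟩

/-- The left inclusion. -/
def inl (N P : Cxt A) : N ⟶ N.sum P := ⟨Sum.inl, fun _ => rfl⟩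

/-- The right inclusion. -/
def inr (N P : Cxt A) : P ⟶ N.sum P := ⟨Sum.inr, fun _ => rfl⟩

/-- The map out of a disjoint union. -/
def desc {N P Q : Cxt A} (f : N ⟶ Q) (g : P ⟶ Q) : N.sum P ⟶ Q :=
  ⟨Sum.elim f.toFun g.toFun, by
    rintro (n | n)
    · exact f.lab_eq n
    · exact g.lab_eq n⟩

/-- The disjoint union of maps. -/
def sumMap {N P N' P' : Cxt A} (f : N ⟶ N') (g : P ⟶ P') : N.sum P ⟶ N'.sum P' :=
  desc (f ≫ inl _ _) (g ≫ inr _ _)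

end Cxt

/-! ### Simultaneous elimination of finitely many quantified variables. -/

section Discard

variable {C : Type u₁} [Category.{v₁} C] [MonoidalCategory C] [SymmetricCategory C]
  {A : Type u} (Φ : FrobFamily A C)

namespace FrobFamily

/-- A morphism to the unit that eliminates existentially quantified variables. -/
def IsDiscard {K : C} [MonObj K] [IsCommMonObj K] {α : Type} {ℓ : α → A}
    (i : ∀ a, (Φ.obj (ℓ a)).X ⟶ K) (ε : K ⟶ 𝟙_ C) : Prop :=
  ∀ (B : C) [MonObj B] [IsCommMonObj B] (h : K ⟶ B) [IsMonHom h],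
    act (𝟙 (B ⊗ K)) (∏ᶠ a, Φ.eqElt (i a ≫ inrHom B K) (i a ≫ h ≫ inlHom B K)) ≫ discard B ε =
      copair (𝟙 B) h

variable {Φ}

theorem finprod_comp {α : Type} [Finite α] {B B' : C} [MonObj B] [IsCommMonObj B] [MonObj B']
    [IsCommMonObj B'] (F : α → (𝟙_ C ⟶ B)) (f : B ⟶ B') [IsMonHom f] :
    (∏ᶠ a, F a) ≫ f = ∏ᶠ a, F a ≫ f :=
  (globalMap f).map_finprod (Set.toFinite _)

theorem act_eq_comp {B Z : C} [MonObj B] (X : Z ⟶ B) (T : 𝟙_ C ⟶ B) :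
    act X T = X ≫ act (𝟙 B) T := by
  rw [comp_act, Category.comp_id]

theorem comp_act_eqElt_discard {B Z : C} [MonObj B] [IsCommMonObj B] {x : A}
    (X : Z ⟶ B ⊗ (Φ.obj x).X) (a : (Φ.obj x).X ⟶ B) [IsMonHom a] :
    act X (Φ.eqElt (inrHom _ _) (a ≫ inlHom _ _)) ≫ discard B (Φ.counit x) =
      X ≫ copair (𝟙 B) a := by
  rw [act_eq_comp, Category.assoc, act_eqElt_discard]

theorem IsDiscard.act {K : C} [MonObj K] [IsCommMonObj K] {α : Type} {ℓ : α → A}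
    {i : ∀ a, (Φ.obj (ℓ a)).X ⟶ K} {ε : K ⟶ 𝟙_ C} (hε : Φ.IsDiscard i ε) {B Z : C} [MonObj B]
    [IsCommMonObj B] (X : Z ⟶ B ⊗ K) (h : K ⟶ B) [IsMonHom h] :
    act X (∏ᶠ a, Φ.eqElt (i a ≫ inrHom B K) (i a ≫ h ≫ inlHom B K)) ≫ discard B ε =
      X ≫ copair (𝟙 B) h := by
  rw [act_eq_comp, Category.assoc, hε B h]

/-- There are no equations, and the unit is the only homomorphism from the unit object. -/
theorem IsDiscard.empty {α : Type} [IsEmpty α] {ℓ : α → A} (i : ∀ a, (Φ.obj (ℓ a)).X ⟶ 𝟙_ C) :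
    Φ.IsDiscard i (𝟙 (𝟙_ C)) := by
  intro B _ _ h _
  have hh : h = η := by simpa using IsMonHom.one_hom h
  rw [finprod_of_isEmpty, global_one_eq, act_one, discard, hh]
  simp [copair]

theorem IsDiscard.of_iso {α : Type} [Finite α] {ℓ : α → A} {K K' : C} [MonObj K] [IsCommMonObj K]
    [MonObj K'] [IsCommMonObj K'] {i : ∀ a, (Φ.obj (ℓ a)).X ⟶ K} {i' : ∀ a, (Φ.obj (ℓ a)).X ⟶ K'}
    {ε : K ⟶ 𝟙_ C} (hε : Φ.IsDiscard i ε) (k : K' ≅ K) [IsMonHom k.hom]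
    (hk : ∀ a, i' a ≫ k.hom = i a) : Φ.IsDiscard i' (k.hom ≫ ε) := by
  intro B _ _ h _
  have h₁ : discard B (k.hom ≫ ε) = B ◁ k.hom ≫ discard B ε := by simp [discard]
  have h₂ := hε B (k.inv ≫ h)
  have h₃ : copair (𝟙 B) h = B ◁ k.hom ≫ copair (𝟙 B) (k.inv ≫ h) := by
    rw [copair, copair, ← id_tensorHom, tensorHom_comp_tensorHom_assoc]
    simp
  have hr : inrHom B K' ≫ B ◁ k.hom = k.hom ≫ inrHom B K := by
    rw [inrHom, inrHom, Category.assoc, ← whisker_exchange, ← leftUnitor_inv_naturality_assoc]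
  have hl : inlHom B K' ≫ B ◁ k.hom = inlHom B K := by
    rw [inlHom, inlHom, Category.assoc, ← MonoidalCategory.whiskerLeft_comp, IsMonHom.one_hom]
  rw [h₁, h₃, ← h₂, ← Category.assoc, act_comp, Category.id_comp, ← Category.assoc (B ◁ k.hom),
    comp_act, Category.comp_id, finprod_comp]
  congr 2
  refine finprod_congr fun a => ?_
  rw [eqElt_comp, Category.assoc, hr, ← hk]
  simp [hl]

theorem IsDiscard.of_equiv {α β : Type} (e : β ≃ α) {ℓ : α → A} {K : C} [MonObj K]
    [IsCommMonObj K] {i : ∀ a, (Φ.obj (ℓ a)).X ⟶ K} {ε : K ⟶ 𝟙_ C}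
    (hε : Φ.IsDiscard (ℓ := fun b => ℓ (e b)) (fun b => i (e b)) ε) : Φ.IsDiscard i ε := by
  intro B _ _ h _
  rw [← hε B h, finprod_comp_equiv e (f := fun a =>
    Φ.eqElt (i a ≫ inrHom B K) (i a ≫ h ≫ inlHom B K))]

theorem copair_assoc {B X Y Z : C} [MonObj B] (f : X ⟶ B) (g : Y ⟶ B) (k : Z ⟶ B) :
    (α_ X Y Z).inv ≫ copair (copair f g) k = copair f (copair g k) := by
  have h₁ : copair (copair f g) k = ((f ⊗ₘ g) ⊗ₘ k) ≫ μ ▷ _ ≫ μ := by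
    rw [copair, copair, ← tensorHom_id, tensorHom_comp_tensorHom_assoc, Category.comp_id]
  have h₂ : copair f (copair g k) = (f ⊗ₘ g ⊗ₘ k) ≫ _ ◁ μ ≫ μ := by
    rw [copair, copair, ← id_tensorHom, tensorHom_comp_tensorHom_assoc, Category.comp_id]
  rw [h₁, h₂, MonObj.mul_assoc, associator_naturality_assoc, Iso.inv_hom_id_assoc]

/-- Describes the associator by its values on the three summands, so that variables and equations
can be pushed through it. -/
theorem associator_inv_eq_copair (B K X : C) [MonObj B] [IsCommMonObj B] [MonObj K]
    [IsCommMonObj K] [MonObj X] [IsCommMonObj X] :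
    (α_ B K X).inv = copair (inlHom B K ≫ inlHom (B ⊗ K) X)
      (copair (inrHom B K ≫ inlHom (B ⊗ K) X) (inrHom (B ⊗ K) X)) := by
  rw [← copair_assoc, ← copair_comp, copair_inl_inr, Category.id_comp, copair_inl_inr,
    Category.comp_id]

/-- The variables are eliminated one after the other: the equation for `none` is used up by the
one-point rule, and the remaining equations, which do not mention that variable, pass through its
quantifier and are handled by `hε`. -/
theorem IsDiscard.option {α : Type} [Finite α] {ℓ : Option α → A} {K : C} [MonObj K]
    [IsCommMonObj K] {i : ∀ a, (Φ.obj (ℓ (some a))).X ⟶ K} {ε : K ⟶ 𝟙_ C}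
    (hε : Φ.IsDiscard (ℓ := fun a => ℓ (some a)) i ε)
    (i' : ∀ a, (Φ.obj (ℓ a)).X ⟶ K ⊗ _)
    (h₁ : ∀ a, i' (some a) = i a ≫ inlHom _ _) (h₂ : i' none = inrHom _ _) :
    Φ.IsDiscard i' (discard K (Φ.counit (ℓ none)) ≫ ε) := by
  intro B _ _ h _
  have e₁ : discard B (discard K (Φ.counit (ℓ none)) ≫ ε) =
      (α_ B K _).inv ≫ discard (B ⊗ K) (Φ.counit (ℓ none)) ≫ discard B ε := by
    simp [discard]
  -- After rebracketing, the last variable ranges over the right factor, and its value, which lies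
  -- in `B`, has to be included into `B ⊗ K` first.
  have e₂ : (∏ᶠ a, Φ.eqElt (i' a ≫ inrHom B (K ⊗ _)) (i' a ≫ h ≫ inlHom B (K ⊗ _))) ≫
      (α_ B K _).inv =
      Φ.eqElt (inrHom (B ⊗ K) (Φ.obj (ℓ none)).X) (((inrHom K (Φ.obj (ℓ none)).X ≫ h) ≫ inlHom B K) ≫ inlHom (B ⊗ K) _) *
      ((∏ᶠ a, Φ.eqElt (i a ≫ inrHom B K) (i a ≫ (inlHom K (Φ.obj (ℓ none)).X ≫ h) ≫ inlHom B K)) ≫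
        inlHom (B ⊗ K) _) := by
    have := Fintype.ofFinite α
    rw [finprod_comp, finprod_comp, finprod_eq_prod_of_fintype, finprod_eq_prod_of_fintype,
      Fintype.prod_option]
    congr 1
    · rw [eqElt_comp, h₂]
      simp only [Category.assoc, associator_inv_eq_copair, inl_copair, inr_copair]
    · refine Finset.prod_congr rfl fun a _ => ?_
      rw [eqElt_comp, eqElt_comp, h₁]
      simp only [Category.assoc, associator_inv_eq_copair, inl_copair, inr_copair]
  rw [e₁, ← Category.assoc, act_comp, e₂, Category.id_comp, act_mul, ← Category.assoc,
    act_discard, comp_act_eqElt_discard, hε.act, Category.assoc, copair_comp, Category.id_comp,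
    Category.assoc, inl_copair, copair_assoc, Category.comp_id, ← copair_comp, copair_inl_inr,
    Category.id_comp]

end FrobFamily

end Discard

/-! ### Free objects on contexts and the existence of quantifiers. -/

section Contexts

variable {C : Type u₁} [Category.{v₁} C] [MonoidalCategory C] [SymmetricCategory C]
  {A : Type u} (Φ : FrobFamily A C)

namespace FrobFamily

/-- The commutative monoid object freely generated by the variables of a context. -/
noncomputable def free (N : Cxt A) : CommMon C := ∐ fun n => Φ.obj (N.lab n)

/-- The variables of a context. -/
noncomputable def var (N : Cxt A) (n : N.pt) {x : A} (h : N.lab n = x) : Φ.obj x ⟶ Φ.free N :=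
  eqToHom (by rw [h]) ≫ Sigma.ι (fun n => Φ.obj (N.lab n)) n

/-- Evaluation of the variables of a context. -/
noncomputable def eval {N : Cxt A} {K : CommMon C} (f : ∀ n, Φ.obj (N.lab n) ⟶ K) :
    Φ.free N ⟶ K := Sigma.desc f

theorem var_eval {N : Cxt A} {K : CommMon C} (f : ∀ n, Φ.obj (N.lab n) ⟶ K) (n : N.pt) :
    Φ.var N n rfl ≫ Φ.eval f = f n := by
  change (eqToHom _ ≫ Sigma.ι (fun n => Φ.obj (N.lab n)) n) ≫ Sigma.desc f = f n
  simp

theorem free_hom_ext {N : Cxt A} {K : CommMon C} {f g : Φ.free N ⟶ K}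
    (h : ∀ n, Φ.var N n rfl ≫ f = Φ.var N n rfl ≫ g) : f = g :=
  Sigma.hom_ext _ _ fun n => by
    have := h n
    change (eqToHom _ ≫ Sigma.ι (fun n => Φ.obj (N.lab n)) n) ≫ f =
      (eqToHom _ ≫ Sigma.ι (fun n => Φ.obj (N.lab n)) n) ≫ g at this
    simpa using this

/-- Renaming of variables. -/
noncomputable def freeMap {N P : Cxt A} (f : N ⟶ P) : Φ.free N ⟶ Φ.free P :=
  Φ.eval fun n => Φ.var P (f.toFun n) (f.lab_eq n)

theorem var_freeMap {N P : Cxt A} (f : N ⟶ P) (n : N.pt) {x : A} (h : N.lab n = x) :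
    Φ.var N n h ≫ Φ.freeMap f = Φ.var P (f.toFun n) ((f.lab_eq n).trans h) := by
  subst h
  exact Φ.var_eval _ n

theorem freeMap_id (N : Cxt A) : Φ.freeMap (𝟙 N) = 𝟙 _ :=
  Φ.free_hom_ext fun n => by rw [var_freeMap, Category.comp_id]; rfl

theorem freeMap_comp {N P Q : Cxt A} (f : N ⟶ P) (g : P ⟶ Q) :
    Φ.freeMap (f ≫ g) = Φ.freeMap f ≫ Φ.freeMap g :=
  Φ.free_hom_ext fun n => by
    rw [← Category.assoc, var_freeMap, var_freeMap, var_freeMap]; rfl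

/-- Renaming of variables along an equivalence. -/
noncomputable def freeIso {N P : Cxt A} (f : N ⟶ P) (g : P ⟶ N) (h₁ : f ≫ g = 𝟙 N)
    (h₂ : g ≫ f = 𝟙 P) : (Φ.free N).X ≅ (Φ.free P).X where
  hom := und (Φ.freeMap f)
  inv := und (Φ.freeMap g)
  hom_inv_id := by rw [← und_comp, ← freeMap_comp, h₁, freeMap_id, und_id]
  inv_hom_id := by rw [← und_comp, ← freeMap_comp, h₂, freeMap_id, und_id]

instance {N P : Cxt A} (f : N ⟶ P) (g : P ⟶ N) (h₁ : f ≫ g = 𝟙 N) (h₂ : g ≫ f = 𝟙 P) :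
    IsMonHom (Φ.freeIso f g h₁ h₂).hom :=
  inferInstanceAs (IsMonHom (und (Φ.freeMap f)))

theorem exists_isDiscard_of_equiv {α β : Type} (e : α ≃ β) [Finite α] [Finite β] (ℓ : β → A)
    (h : ∃ ε : (Φ.free ⟨α, fun a => ℓ (e a), inferInstance⟩).X ⟶ 𝟙_ C,
      Φ.IsDiscard (fun n => und (Φ.var ⟨α, fun a => ℓ (e a), inferInstance⟩ n rfl)) ε) :
    ∃ ε : (Φ.free ⟨β, ℓ, inferInstance⟩).X ⟶ 𝟙_ C,
      Φ.IsDiscard (fun n => und (Φ.var ⟨β, ℓ, inferInstance⟩ n rfl)) ε := by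
  obtain ⟨ε, hε⟩ := h
  let N : Cxt A := ⟨α, fun a => ℓ (e a), inferInstance⟩
  let P : Cxt A := ⟨β, ℓ, inferInstance⟩
  let f : N ⟶ P := ⟨e, fun _ => rfl⟩
  let g : P ⟶ N := ⟨e.symm, fun b => congrArg ℓ (e.apply_symm_apply b)⟩
  have h₁ : g ≫ f = 𝟙 P := Cxt.hom_ext fun b => e.apply_symm_apply b
  have h₂ : f ≫ g = 𝟙 N := Cxt.hom_ext fun b => e.symm_apply_apply b
  refine ⟨(Φ.freeIso g f h₁ h₂).hom ≫ ε, IsDiscard.of_equiv e (hε.of_iso _ fun a => ?_)⟩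
  change und (Φ.var P (f.toFun a) _) ≫ und (Φ.freeMap g) = _
  have h₃ : Φ.var P (f.toFun a) rfl = Φ.var N a rfl ≫ Φ.freeMap f := (Φ.var_freeMap f a rfl).symm
  rw [← und_comp, h₃, Category.assoc, ← freeMap_comp, h₂, freeMap_id, Category.comp_id]

theorem exists_isDiscard_empty (ℓ : PEmpty → A) :
    ∃ ε : (Φ.free ⟨PEmpty, ℓ, inferInstance⟩).X ⟶ 𝟙_ C,
      Φ.IsDiscard (fun n => und (Φ.var ⟨PEmpty, ℓ, inferInstance⟩ n rfl)) ε := by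
  let N : Cxt A := ⟨PEmpty, ℓ, inferInstance⟩
  let f : Φ.free N ⟶ CommMon.trivial C := Φ.eval fun n => n.elim
  let g : CommMon.trivial C ⟶ Φ.free N := default
  let k : (Φ.free N).X ≅ 𝟙_ C :=
    ⟨und f, und g, by
      have : f ≫ g = 𝟙 _ := Φ.free_hom_ext fun n => n.elim
      exact congrArg und this, by
      have : g ≫ f = 𝟙 _ := Subsingleton.elim _ _
      exact congrArg und this⟩
  have : IsMonHom k.hom := inferInstanceAs (IsMonHom (und f))
  exact ⟨_, (IsDiscard.empty fun n => n.elim).of_iso k fun n => n.elim⟩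

/-- The free object on `Option α` is that on `α` tensored with one more sort; the mutually inverse
homomorphisms are compared on variables, and `IsDiscard.option` is transported along them. -/
theorem exists_isDiscard_option {α : Type} [Finite α] (ℓ : Option α → A)
    (h : ∃ ε : (Φ.free ⟨α, fun a => ℓ (some a), inferInstance⟩).X ⟶ 𝟙_ C,
      Φ.IsDiscard (fun n => und (Φ.var ⟨α, fun a => ℓ (some a), inferInstance⟩ n rfl)) ε) :
    ∃ ε : (Φ.free ⟨Option α, ℓ, inferInstance⟩).X ⟶ 𝟙_ C,
      Φ.IsDiscard (fun n => und (Φ.var ⟨Option α, ℓ, inferInstance⟩ n rfl)) ε := by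
  obtain ⟨ε, hε⟩ := h
  let N : Cxt A := ⟨α, fun a => ℓ (some a), inferInstance⟩
  let P : Cxt A := ⟨Option α, ℓ, inferInstance⟩
  let s : N ⟶ P := ⟨some, fun _ => rfl⟩
  let i : ∀ a, Φ.obj (ℓ a) ⟶ prodObj (Φ.free N) (Φ.obj (ℓ none)) := fun a =>
    match a with
    | none => ofMonHom (D := prodObj _ _) (inrHom (Φ.free N).X (Φ.obj (ℓ none)).X)
    | some a => Φ.var N a rfl ≫
        ofMonHom (D := prodObj _ _) (inlHom (Φ.free N).X (Φ.obj (ℓ none)).X)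
  let f : Φ.free P ⟶ prodObj (Φ.free N) (Φ.obj (ℓ none)) := Φ.eval i
  let g : prodObj (Φ.free N) (Φ.obj (ℓ none)) ⟶ Φ.free P :=
    prodDesc (Φ.freeMap s) (Φ.var P none rfl)
  have hl : ofMonHom (D := prodObj _ _) (inlHom (Φ.free N).X (Φ.obj (ℓ none)).X) ≫ g =
      Φ.freeMap s := und_injective
      (inl_copair (und (Φ.freeMap s)) (und (Φ.var P none (x := ℓ none) rfl)))
  have hr : ofMonHom (D := prodObj _ _) (inrHom (Φ.free N).X (Φ.obj (ℓ none)).X) ≫ g =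
      Φ.var P none rfl := und_injective
      (inr_copair (und (Φ.freeMap s)) (und (Φ.var P none (x := ℓ none) rfl)))
  have h₁ : f ≫ g = 𝟙 _ := Φ.free_hom_ext fun n => by
    rw [← Category.assoc, var_eval, Category.comp_id]
    rcases n with _ | n
    · exact hr
    · change (Φ.var N n rfl ≫ _) ≫ g = _
      rw [Category.assoc, hl, var_freeMap]
  have h₂ : g ≫ f = 𝟙 _ := by
    refine prodObj_hom_ext ?_ ?_
    · change und (ofMonHom (D := prodObj _ _) (inlHom (Φ.free N).X (Φ.obj (ℓ none)).X) ≫ g ≫ f) = und (ofMonHom (D := prodObj _ _) _ ≫ 𝟙 _)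
      rw [← Category.assoc, hl, Category.comp_id]
      congr 1
      refine Φ.free_hom_ext fun n => ?_
      rw [← Category.assoc, var_freeMap]
      exact Φ.var_eval (N := P) i (some n)
    · change und (ofMonHom (D := prodObj _ _) (inrHom (Φ.free N).X (Φ.obj (ℓ none)).X) ≫ g ≫ f) = und (ofMonHom (D := prodObj _ _) _ ≫ 𝟙 _)
      rw [← Category.assoc, hr, Category.comp_id]
      congr 1
      exact Φ.var_eval (N := P) i none
  let k : (Φ.free P).X ≅ (Φ.free N).X ⊗ (Φ.obj (ℓ none)).X :=
    ⟨und f, und g, by rw [← und_comp, h₁, und_id], by rw [← und_comp, h₂, und_id]⟩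
  have : IsMonHom k.hom := inferInstanceAs (IsMonHom (und f))
  exact ⟨_, (hε.option (fun a => und (i a)) (fun _ => rfl) rfl).of_iso k
    fun a => congrArg und (Φ.var_eval (N := P) i a)⟩

/-- Only existence is recorded, since the free objects are coproducts known up to isomorphism. The
characterizing property suffices until `var_pull_zero` recovers the actual counit. -/
theorem exists_isDiscard (N : Cxt A) :
    ∃ ε : (Φ.free N).X ⟶ 𝟙_ C, Φ.IsDiscard (fun n => und (Φ.var N n rfl)) ε := by
  obtain ⟨α, ℓ, hα⟩ := N
  have key : ∀ ℓ : α → A, ∃ ε : (Φ.free ⟨α, ℓ, hα⟩).X ⟶ 𝟙_ C,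
      Φ.IsDiscard (fun n => und (Φ.var ⟨α, ℓ, hα⟩ n rfl)) ε := by
    clear ℓ
    -- The induction changes the index type, so the labelling and the finiteness proof are
    -- quantified inside the motive.
    refine Finite.induction_empty_option (P := fun α => ∀ (hα : Finite α) (ℓ : α → A),
      ∃ ε : (Φ.free ⟨α, ℓ, hα⟩).X ⟶ 𝟙_ C,
        Φ.IsDiscard (fun n => und (Φ.var ⟨α, ℓ, hα⟩ n rfl)) ε) ?_ ?_ ?_ α hα
    · intro α β e ih _ ℓ
      have : Finite α := Finite.of_equiv β e.symm
      exact Φ.exists_isDiscard_of_equiv e ℓ (ih _ _)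
    · intro _ ℓ
      exact Φ.exists_isDiscard_empty ℓ
    · intro α _ ih _ ℓ
      exact Φ.exists_isDiscard_option ℓ (ih _ _)
  exact key ℓ

end FrobFamily

end Contexts

/-! ### Existential quantification over a summand of a context. -/

section Quantifiers

variable {C : Type u₁} [Category.{v₁} C] [MonoidalCategory C] [SymmetricCategory C]
  {A : Type u} (Φ : FrobFamily A C)

theorem tensor_copair {B X Y X' Y' : C} [MonObj B] (a : X' ⟶ X) (b : Y' ⟶ Y) (f : X ⟶ B)
    (g : Y ⟶ B) : (a ⊗ₘ b) ≫ copair f g = copair (a ≫ f) (b ≫ g) := by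
  simp [copair]

/-- The exchange of the last two factors. -/
def exchange (B X Y : C) : (B ⊗ X) ⊗ Y ⟶ (B ⊗ Y) ⊗ X :=
  (α_ B X Y).hom ≫ B ◁ (β_ X Y).hom ≫ (α_ B Y X).inv

theorem exchange_copair {B X Y Z : C} [MonObj Z] [IsCommMonObj Z] (f : B ⟶ Z) (g : X ⟶ Z)
    (k : Y ⟶ Z) :
    exchange B X Y ≫ copair (copair f k) g = copair (copair f g) k := by
  have h : (β_ X Y).hom ≫ copair k g = copair g k := by
    rw [copair, copair, ← BraidedCategory.braiding_naturality_assoc, IsCommMonObj.mul_comm]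
  rw [exchange, Category.assoc, Category.assoc, FrobFamily.copair_assoc, ← id_tensorHom,
    tensor_copair, h, Category.id_comp, ← FrobFamily.copair_assoc, Iso.hom_inv_id_assoc]

theorem exchange_discard_whisker (B : C) {X Y : C} (e : Y ⟶ 𝟙_ C) :
    exchange B X Y ≫ discard B e ▷ X = discard (B ⊗ X) e := by
  have h : (β_ X Y).hom ≫ e ▷ X = X ◁ e ≫ (ρ_ X).hom ≫ (λ_ X).inv := by
    rw [← BraidedCategory.braiding_naturality_right, braiding_tensorUnit_right]
  have h' : (α_ B Y X).inv ≫ (B ◁ e) ▷ X = B ◁ e ▷ X ≫ (α_ B (𝟙_ C) X).inv :=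
    (associator_inv_naturality_middle B e X).symm
  simp only [exchange, discard, Category.assoc, comp_whiskerRight]
  rw [reassoc_of% h', ← MonoidalCategory.whiskerLeft_comp_assoc, h]
  monoidal

theorem exchange_whisker_discard (B : C) {X X' Y : C} (g : X ⟶ X') (e : Y ⟶ 𝟙_ C) :
    exchange B X Y ≫ (B ⊗ Y) ◁ g ≫ discard B e ▷ X' = discard (B ⊗ X) e ≫ B ◁ g := by
  rw [whisker_exchange, reassoc_of% exchange_discard_whisker]

/-- Naturality of the braiding with respect to morphisms to the unit; this is the source of the
commutation of two quantifiers. -/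
theorem exchange_discard (B : C) {X Y : C} (d : X ⟶ 𝟙_ C) (e : Y ⟶ 𝟙_ C) :
    exchange B X Y ≫ discard (B ⊗ Y) d ≫ discard B e = discard (B ⊗ X) e ≫ discard B d := by
  have h := exchange_whisker_discard B d e
  rw [discard, Category.assoc, ← rightUnitor_naturality, reassoc_of% h]
  rfl

namespace FrobFamily

/-- Renaming of variables, in the ambient category. -/
noncomputable def map {N P : Cxt A} (f : N ⟶ P) : (Φ.free N).X ⟶ (Φ.free P).X :=
  und (Φ.freeMap f)

instance {N P : Cxt A} (f : N ⟶ P) : IsMonHom (Φ.map f) :=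
  inferInstanceAs (IsMonHom (und (Φ.freeMap f)))

@[simp]
theorem map_id (N : Cxt A) : Φ.map (𝟙 N) = 𝟙 _ := by rw [map, freeMap_id, und_id]

theorem map_comp {N P Q : Cxt A} (f : N ⟶ P) (g : P ⟶ Q) :
    Φ.map (f ≫ g) = Φ.map f ≫ Φ.map g := by rw [map, freeMap_comp, und_comp]; rfl

theorem freeHom_ext {N : Cxt A} {K : CommMon C} {f g : (Φ.free N).X ⟶ K.X} [IsMonHom f]
    [IsMonHom g] (h : ∀ n, und (Φ.var N n rfl) ≫ f = und (Φ.var N n rfl) ≫ g) : f = g :=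
  congrArg und (Φ.free_hom_ext (f := ofMonHom f) (g := ofMonHom g)
    fun n => und_injective (h n))

theorem und_var_map {N P : Cxt A} (f : N ⟶ P) (n : N.pt) {x : A} (h : N.lab n = x) :
    und (Φ.var N n h) ≫ Φ.map f = und (Φ.var P (f.toFun n) ((f.lab_eq n).trans h)) := by
  rw [map, ← und_comp, var_freeMap]

/-- The variables of a disjoint union, in the tensor product. -/
noncomputable def splitHom (N P : Cxt A) :
    Φ.free (N.sum P) ⟶ prodObj (Φ.free N) (Φ.free P) :=
  Φ.eval fun n => match n with
    | .inl n => Φ.var N n rfl ≫ ofMonHom (D := prodObj _ _) (inlHom (Φ.free N).X (Φ.free P).X)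
    | .inr n => Φ.var P n rfl ≫ ofMonHom (D := prodObj _ _) (inrHom (Φ.free N).X (Φ.free P).X)

theorem inl_splitHom (N P : Cxt A) :
    Φ.map (Cxt.inl N P) ≫ und (Φ.splitHom N P) = inlHom (Φ.free N).X (Φ.free P).X := by
  have : Φ.freeMap (Cxt.inl N P) ≫ Φ.splitHom N P =
      ofMonHom (D := prodObj _ _) (inlHom (Φ.free N).X (Φ.free P).X) :=
    Φ.free_hom_ext fun n => by
      rw [← Category.assoc, var_freeMap]
      exact Φ.var_eval (N := N.sum P) _ (Sum.inl n)
  exact congrArg und this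

theorem inr_splitHom (N P : Cxt A) :
    Φ.map (Cxt.inr N P) ≫ und (Φ.splitHom N P) = inrHom (Φ.free N).X (Φ.free P).X := by
  have : Φ.freeMap (Cxt.inr N P) ≫ Φ.splitHom N P =
      ofMonHom (D := prodObj _ _) (inrHom (Φ.free N).X (Φ.free P).X) :=
    Φ.free_hom_ext fun n => by
      rw [← Category.assoc, var_freeMap]
      exact Φ.var_eval (N := N.sum P) _ (Sum.inr n)
  exact congrArg und this

/-- The object of a disjoint union of contexts is a tensor product. -/
noncomputable def split (N P : Cxt A) :
    (Φ.free (N.sum P)).X ≅ (Φ.free N).X ⊗ (Φ.free P).X where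
  hom := und (Φ.splitHom N P)
  inv := copair (Φ.map (Cxt.inl N P)) (Φ.map (Cxt.inr N P))
  hom_inv_id := by
    refine Φ.freeHom_ext fun n => ?_
    rw [Category.comp_id]
    rcases n with n | n
    · have h := Φ.und_var_map (Cxt.inl N P) n rfl
      have k : Φ.map (Cxt.inl N P) ≫ und (Φ.splitHom N P) ≫
          copair (Φ.map (Cxt.inl N P)) (Φ.map (Cxt.inr N P)) = Φ.map (Cxt.inl N P) := by
        rw [← Category.assoc, inl_splitHom, inl_copair]
      refine (congrArg (· ≫ und (Φ.splitHom N P) ≫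
        copair (Φ.map (Cxt.inl N P)) (Φ.map (Cxt.inr N P))) h.symm).trans (Eq.trans ?_ h)
      rw [Category.assoc, k]
    · have h := Φ.und_var_map (Cxt.inr N P) n rfl
      have k : Φ.map (Cxt.inr N P) ≫ und (Φ.splitHom N P) ≫
          copair (Φ.map (Cxt.inl N P)) (Φ.map (Cxt.inr N P)) = Φ.map (Cxt.inr N P) := by
        rw [← Category.assoc, inr_splitHom, inr_copair]
      refine (congrArg (· ≫ und (Φ.splitHom N P) ≫
        copair (Φ.map (Cxt.inl N P)) (Φ.map (Cxt.inr N P))) h.symm).trans (Eq.trans ?_ h)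
      rw [Category.assoc, k]
  inv_hom_id := by
    rw [copair_comp, inl_splitHom, inr_splitHom, copair_inl_inr]

instance (N P : Cxt A) : IsMonHom (Φ.split N P).hom :=
  inferInstanceAs (IsMonHom (und (Φ.splitHom N P)))

theorem inl_split (N P : Cxt A) :
    Φ.map (Cxt.inl N P) ≫ (Φ.split N P).hom = inlHom (Φ.free N).X (Φ.free P).X :=
  Φ.inl_splitHom N P

theorem inr_split (N P : Cxt A) :
    Φ.map (Cxt.inr N P) ≫ (Φ.split N P).hom = inrHom (Φ.free N).X (Φ.free P).X :=
  Φ.inr_splitHom N P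

theorem inlHom_split_inv (N P : Cxt A) :
    inlHom (Φ.free N).X (Φ.free P).X ≫ (Φ.split N P).inv = Φ.map (Cxt.inl N P) := by
  rw [← inl_split, Category.assoc, Iso.hom_inv_id, Category.comp_id]

instance (N P : Cxt A) : IsMonHom (Φ.split N P).inv :=
  inferInstanceAs (IsMonHom (copair (Φ.map (Cxt.inl N P)) (Φ.map (Cxt.inr N P))))

theorem split_inv_map {N P Q : Cxt A} (f : N.sum P ⟶ Q) :
    (Φ.split N P).inv ≫ Φ.map f =
      copair (Φ.map (Cxt.inl N P ≫ f)) (Φ.map (Cxt.inr N P ≫ f)) := by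
  rw [map_comp, map_comp]
  exact copair_comp _

theorem map_sumMap_split {N P N' P' : Cxt A} (f : N ⟶ N') (g : P ⟶ P') :
    Φ.map (Cxt.sumMap f g) ≫ (Φ.split N' P').hom =
      (Φ.split N P).hom ≫ (Φ.map f ⊗ₘ Φ.map g) := by
  rw [← Iso.eq_comp_inv, Category.assoc, ← Iso.inv_comp_eq, split_inv_map]
  change _ = _ ≫ copair _ _
  rw [tensor_copair, ← map_comp, ← map_comp]
  rfl

theorem var_inl_split (N P : Cxt A) (n : N.pt) {x : A} (h : N.lab n = x) :
    und (Φ.var (N.sum P) (.inl n) h) ≫ (Φ.split N P).hom =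
      und (Φ.var N n h) ≫ inlHom (Φ.free N).X (Φ.free P).X := by
  rw [← inl_split, ← Category.assoc, und_var_map]
  rfl

theorem var_inr_split (N P : Cxt A) (p : P.pt) {x : A} (h : P.lab p = x) :
    und (Φ.var (N.sum P) (.inr p) h) ≫ (Φ.split N P).hom =
      und (Φ.var P p h) ≫ inrHom (Φ.free N).X (Φ.free P).X := by
  rw [← inr_split, ← Category.assoc, und_var_map]
  rfl

/-- Existential elimination of the variables of a context. -/
noncomputable def eps (N : Cxt A) : (Φ.free N).X ⟶ 𝟙_ C := (Φ.exists_isDiscard N).choose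

theorem isDiscard_eps (N : Cxt A) : Φ.IsDiscard (fun n => und (Φ.var N n rfl)) (Φ.eps N) :=
  (Φ.exists_isDiscard N).choose_spec

/-- Existential quantification over the second summand of a context. -/
noncomputable def ex (N P : Cxt A) : (Φ.free (N.sum P)).X ⟶ (Φ.free N).X :=
  (Φ.split N P).hom ≫ discard _ (Φ.eps P)

/-- The action of a morphism on the second summand of a context. -/
noncomputable def par (N : Cxt A) {P Q : Cxt A} (g : (Φ.free P).X ⟶ (Φ.free Q).X) :
    (Φ.free (N.sum P)).X ⟶ (Φ.free (N.sum Q)).X :=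
  (Φ.split N P).hom ≫ (Φ.free N).X ◁ g ≫ (Φ.split N Q).inv

/-- Renaming the free variables touches only the first tensor factor and quantification only the
second. -/
theorem map_ex {N N' : Cxt A} (f : N ⟶ N') (P : Cxt A) :
    Φ.map (Cxt.sumMap f (𝟙 P)) ≫ Φ.ex N' P = Φ.ex N P ≫ Φ.map f := by
  rw [ex, ex, ← Category.assoc, map_sumMap_split, map_id, tensorHom_id, discard, discard,
    Category.assoc, ← whisker_exchange_assoc, rightUnitor_naturality]
  simp only [Category.assoc]

section

variable {Z : C}

theorem act_ex {N P : Cxt A} (X : Z ⟶ (Φ.free (N.sum P)).X) (T : 𝟙_ C ⟶ (Φ.free N).X) :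
    act X (T ≫ Φ.map (Cxt.inl N P)) ≫ Φ.ex N P = act (X ≫ Φ.ex N P) T := by
  rw [ex, ← Category.assoc, act_comp, Category.assoc, inl_split, act_discard, Category.assoc]

/-- Linearity over the variables of `N`, again for an arbitrary morphism `g` rather than a
homomorphism; it is used in `exists_sem_eq`. -/
theorem act_inl_par {N P Q : Cxt A} (X : Z ⟶ (Φ.free N).X) (T : 𝟙_ C ⟶ (Φ.free (N.sum P)).X)
    (g : (Φ.free P).X ⟶ (Φ.free Q).X) :
    act (X ≫ Φ.map (Cxt.inl N P)) T ≫ Φ.par N g =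
      act (X ≫ Φ.map (Cxt.inl N Q)) (T ≫ Φ.par N g) := by
  rw [par, ← Category.assoc, act_comp, Category.assoc, inl_split, ← Category.assoc,
    act_inl_whisker, act_comp, Category.assoc, inlHom_split_inv]
  simp only [Category.assoc]

end

/-- The predicate that two variables are equal. -/
noncomputable def eqv (N : Cxt A) (a b : N.pt) (h : N.lab a = N.lab b) : 𝟙_ C ⟶ (Φ.free N).X :=
  Φ.eqElt (und (Φ.var N a rfl)) (und (Φ.var N b h.symm))

/-- Absorbs the transport between propositionally equal sorts, so that later statements mention only
the variables. -/
theorem eqElt_var {N : Cxt A} {x : A} (a b : N.pt) (ha : N.lab a = x) (hb : N.lab b = x) :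
    Φ.eqElt (und (Φ.var N a ha)) (und (Φ.var N b hb)) = Φ.eqv N a b (ha.trans hb.symm) := by
  subst ha
  rfl

theorem eqv_map {N P : Cxt A} (f : N ⟶ P) (a b : N.pt) (h : N.lab a = N.lab b)
    (h' : P.lab (f.toFun a) = P.lab (f.toFun b)) :
    Φ.eqv N a b h ≫ Φ.map f = Φ.eqv P (f.toFun a) (f.toFun b) h' := by
  rw [eqv, eqElt_comp, und_var_map, und_var_map, eqElt_var]

theorem eqv_self (N : Cxt A) (a : N.pt) (h : N.lab a = N.lab a) : Φ.eqv N a a h = 1 :=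
  Φ.eqElt_self _

theorem eqv_comm (N : Cxt A) (a b : N.pt) (h : N.lab a = N.lab b) :
    Φ.eqv N a b h = Φ.eqv N b a h.symm := by
  rw [eqv, eqElt_comm, eqElt_var]

theorem eqv_trans (N : Cxt A) (a b c : N.pt) (h : N.lab a = N.lab b) (h' : N.lab b = N.lab c) :
    Φ.eqv N a b h * Φ.eqv N b c h' = Φ.eqv N a b h * Φ.eqv N a c (h.trans h') := by
  have := Φ.eqElt_trans (und (Φ.var N a rfl)) (und (Φ.var N b h.symm))
    (und (Φ.var N c (h.trans h').symm))
  refine Eq.trans ?_ this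
  rw [eqElt_var, eqElt_var]

/-- Existential quantification of a variable that equals another one is substitution. -/
theorem act_eqv_ex {Z : C} {N P : Cxt A} (X : Z ⟶ (Φ.free (N.sum P)).X) (a : P ⟶ N) :
    act X (∏ᶠ p : P.pt, Φ.eqv (N.sum P) (.inr p) (.inl (a.toFun p)) (a.lab_eq p).symm) ≫
      Φ.ex N P = X ≫ Φ.map (Cxt.desc (𝟙 N) a) := by
  have h₁ : Φ.map (Cxt.desc (𝟙 N) a) =
      (Φ.split N P).hom ≫ copair (𝟙 _) (Φ.map a) := by
    rw [← Iso.inv_comp_eq, split_inv_map, ← Φ.map_id N]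
    rfl
  rw [ex, ← Category.assoc, act_comp, finprod_comp, h₁, ← Category.assoc,
    ← (Φ.isDiscard_eps P).act]
  congr 3
  funext p
  refine (Φ.eqElt_comp _ _ _).trans ?_
  refine congrArg₂ Φ.eqElt (Φ.var_inr_split N P p rfl) ((Φ.var_inl_split N P _ _).trans ?_)
  exact (congrArg (· ≫ inlHom (Φ.free N).X (Φ.free P).X) (Φ.und_var_map a p rfl).symm).trans
    (Category.assoc _ _ _)

theorem whisker_discard {B B' D : C} (f : B ⟶ B') (d : D ⟶ 𝟙_ C) :
    f ▷ D ≫ discard B' d = discard B d ≫ f := by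
  rw [discard, discard, ← whisker_exchange_assoc, rightUnitor_naturality, Category.assoc]

/-- Exchange of the last two summands of a context. -/
def _root_.StringDiag.Cxt.exchange (N P Q : Cxt A) : (N.sum P).sum Q ⟶ (N.sum Q).sum P :=
  Cxt.desc (Cxt.desc (Cxt.inl _ _ ≫ Cxt.inl _ _) (Cxt.inr _ _)) (Cxt.inr _ _ ≫ Cxt.inl _ _)

/-- The object of a disjoint union of three contexts is a tensor product. -/
noncomputable def split₃ (N P Q : Cxt A) :
    (Φ.free ((N.sum P).sum Q)).X ≅ ((Φ.free N).X ⊗ (Φ.free P).X) ⊗ (Φ.free Q).X :=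
  Φ.split (N.sum P) Q ≪≫ whiskerRightIso (Φ.split N P) _

theorem split₃_inv_map {N P Q R : Cxt A} (f : (N.sum P).sum Q ⟶ R) :
    (Φ.split₃ N P Q).inv ≫ Φ.map f = copair (copair (Φ.map (Cxt.inl _ _ ≫ Cxt.inl _ _ ≫ f))
      (Φ.map (Cxt.inr _ _ ≫ Cxt.inl _ _ ≫ f))) (Φ.map (Cxt.inr _ _ ≫ f)) := by
  rw [split₃, Iso.trans_inv, Category.assoc, split_inv_map, whiskerRightIso_inv, ← tensorHom_id,
    tensor_copair, split_inv_map, Category.id_comp]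

theorem map_exchange (N P Q : Cxt A) :
    Φ.map (Cxt.exchange N P Q) =
      (Φ.split₃ N P Q).hom ≫ exchange _ _ _ ≫ (Φ.split₃ N Q P).inv := by
  rw [← Iso.inv_comp_eq, split₃_inv_map, ← Category.comp_id (Φ.split₃ N Q P).inv, ← map_id,
    split₃_inv_map, exchange_copair]
  rfl

theorem ex_ex_eq (N P Q : Cxt A) : Φ.ex (N.sum P) Q ≫ Φ.ex N P =
    (Φ.split₃ N P Q).hom ≫ discard (_ ⊗ _) (Φ.eps Q) ≫ discard _ (Φ.eps P) := by
  rw [ex, ex, split₃, Category.assoc, Iso.trans_hom, Category.assoc, whiskerRightIso_hom,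
    reassoc_of% (whisker_discard (Φ.split N P).hom (Φ.eps Q))]

theorem exchange_ex_ex (N P Q : Cxt A) :
    Φ.map (Cxt.exchange N P Q) ≫ Φ.ex (N.sum Q) P ≫ Φ.ex N Q = Φ.ex (N.sum P) Q ≫ Φ.ex N P := by
  rw [map_exchange, ex_ex_eq, ex_ex_eq]
  simp only [Category.assoc, Iso.inv_hom_id_assoc]
  rw [exchange_discard]

end FrobFamily

end Quantifiers

end StringDiag

namespace StringDiag

open MonoidalCategory Limits

set_option linter.unusedSectionVars false

universe u₁ v₁

/-! ### Conjunctions of equations, inverse images, and the Beck-Chevalley condition. -/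

section Equations

variable {C : Type u₁} [Category.{v₁} C] [MonoidalCategory C] [SymmetricCategory C]
  {A : Type u} (Φ : FrobFamily A C)

namespace FrobFamily

/-- The conjunction of the equations between the values of two maps of contexts. -/
noncomputable def eqm {I N : Cxt A} (f g : I ⟶ N) : 𝟙_ C ⟶ (Φ.free N).X :=
  ∏ᶠ i, Φ.eqv N (f.toFun i) (g.toFun i) ((f.lab_eq i).trans (g.lab_eq i).symm)

/-- A predicate entails the equality of two variables. -/
def Holds {N : Cxt A} (T : 𝟙_ C ⟶ (Φ.free N).X) (a b : N.pt) : Prop :=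
  ∃ h : N.lab a = N.lab b, T * Φ.eqv N a b h = T

variable {Φ}

theorem Holds.refl {N : Cxt A} (T : 𝟙_ C ⟶ (Φ.free N).X) (a : N.pt) : Φ.Holds T a a :=
  ⟨rfl, by rw [eqv_self, mul_one]⟩

theorem Holds.symm {N : Cxt A} {T : 𝟙_ C ⟶ (Φ.free N).X} {a b : N.pt} (h : Φ.Holds T a b) :
    Φ.Holds T b a :=
  ⟨h.1.symm, by rw [← eqv_comm]; exact h.2⟩

theorem Holds.trans {N : Cxt A} {T : 𝟙_ C ⟶ (Φ.free N).X} {a b c : N.pt} (h : Φ.Holds T a b)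
    (h' : Φ.Holds T b c) : Φ.Holds T a c := by
  obtain ⟨h₁, h₂⟩ := h
  obtain ⟨h₃, h₄⟩ := h'
  refine ⟨h₁.trans h₃, ?_⟩
  rw [← h₂, mul_assoc, ← Φ.eqv_trans N a b c h₁ h₃, ← mul_assoc, h₂, h₄]

theorem Holds.mul_right {N : Cxt A} {T : 𝟙_ C ⟶ (Φ.free N).X} {a b : N.pt} (h : Φ.Holds T a b)
    (S : 𝟙_ C ⟶ (Φ.free N).X) : Φ.Holds (T * S) a b :=
  ⟨h.1, by rw [mul_right_comm, h.2]⟩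

theorem Holds.mul_left {N : Cxt A} {T : 𝟙_ C ⟶ (Φ.free N).X} {a b : N.pt} (h : Φ.Holds T a b)
    (S : 𝟙_ C ⟶ (Φ.free N).X) : Φ.Holds (S * T) a b :=
  ⟨h.1, by rw [mul_assoc, h.2]⟩

variable (Φ)

/-- Equality predicates are idempotent: this is transitivity along `a`, `b`, `a`, followed by
symmetry and reflexivity. -/
theorem holds_eqv {N : Cxt A} (a b : N.pt) (h : N.lab a = N.lab b) :
    Φ.Holds (Φ.eqv N a b h) a b :=
  ⟨h, by
    have := Φ.eqv_trans N a b a h h.symm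
    rwa [eqv_self, mul_one, Φ.eqv_comm N b a] at this⟩

theorem holds_eqm {I N : Cxt A} (f g : I ⟶ N) (i : I.pt) :
    Φ.Holds (Φ.eqm f g) (f.toFun i) (g.toFun i) := by
  have := Fintype.ofFinite I.pt
  classical
  rw [eqm, finprod_eq_prod_of_fintype, ← Finset.mul_prod_erase _ _ (Finset.mem_univ i)]
  exact (Φ.holds_eqv _ _ _).mul_right _

theorem mul_eqm {I N : Cxt A} {f g : I ⟶ N} {T : 𝟙_ C ⟶ (Φ.free N).X}
    (h : ∀ i, Φ.Holds T (f.toFun i) (g.toFun i)) : T * Φ.eqm f g = T := by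
  have := Fintype.ofFinite I.pt
  rw [eqm, finprod_eq_prod_of_fintype]
  refine Finset.prod_induction _ (fun S => T * S = T) (fun a b ha hb => ?_) (mul_one T)
    fun i _ => (h i).2
  rw [← mul_assoc, ha, hb]

theorem eqm_comm {I N : Cxt A} (f g : I ⟶ N) : Φ.eqm f g = Φ.eqm g f := by
  unfold eqm
  congr 1
  funext i
  rw [eqv_comm]

theorem eqm_map {I N P : Cxt A} (f g : I ⟶ N) (h : N ⟶ P) :
    Φ.eqm f g ≫ Φ.map h = Φ.eqm (f ≫ h) (g ≫ h) := by
  rw [eqm, finprod_comp]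
  unfold eqm
  congr 1
  funext i
  exact Φ.eqv_map _ _ _ _ _

theorem mul_map {N P : Cxt A} (S T : 𝟙_ C ⟶ (Φ.free N).X) (h : N ⟶ P) :
    (S * T) ≫ Φ.map h = S ≫ Φ.map h * T ≫ Φ.map h :=
  act_comp S T (Φ.map h)

/-- Antisymmetry of entailment, where `S` entails `T` means that `S` absorbs `T` as a factor. -/
theorem eq_of_mul_eq {N : Cxt A} {S T : 𝟙_ C ⟶ (Φ.free N).X} (h : S * T = S) (h' : T * S = T) :
    S = T := by
  rw [← h, mul_comm, h']

/-- Systems of equations can be compared by reasoning about single equations: `Holds` is an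
equivalence relation, so the hypotheses are chains of equalities between variables. -/
theorem eqm_mul_eqm_congr {I J I' J' N : Cxt A} {f g : I ⟶ N} {h k : J ⟶ N} {f' g' : I' ⟶ N}
    {h' k' : J' ⟶ N}
    (h₁ : ∀ i, Φ.Holds (Φ.eqm f g * Φ.eqm h k) (f'.toFun i) (g'.toFun i))
    (h₂ : ∀ i, Φ.Holds (Φ.eqm f g * Φ.eqm h k) (h'.toFun i) (k'.toFun i))
    (h₃ : ∀ i, Φ.Holds (Φ.eqm f' g' * Φ.eqm h' k') (f.toFun i) (g.toFun i))
    (h₄ : ∀ i, Φ.Holds (Φ.eqm f' g' * Φ.eqm h' k') (h.toFun i) (k.toFun i)) :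
    Φ.eqm f g * Φ.eqm h k = Φ.eqm f' g' * Φ.eqm h' k' := by
  refine Φ.eq_of_mul_eq ?_ ?_
  · rw [← mul_assoc, Φ.mul_eqm h₁, Φ.mul_eqm h₂]
  · rw [← mul_assoc, Φ.mul_eqm h₃, Φ.mul_eqm h₄]

theorem act_eqm_ex {Z : C} {N P : Cxt A} (X : Z ⟶ (Φ.free (N.sum P)).X) (a : P ⟶ N) :
    act X (Φ.eqm (Cxt.inr N P) (a ≫ Cxt.inl N P)) ≫ Φ.ex N P =
      X ≫ Φ.map (Cxt.desc (𝟙 N) a) :=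
  Φ.act_eqv_ex X a

/-- The one-point rule read backwards. It turns a renaming into fresh variables, equations and a
quantifier, so that all operations acquire the same shape. -/
theorem map_eq_act_eqm_ex {N P : Cxt A} (a : P ⟶ N) :
    Φ.map a = act (Φ.map (Cxt.inr N P)) (Φ.eqm (Cxt.inr N P) (a ≫ Cxt.inl N P)) ≫ Φ.ex N P := by
  rw [act_eqm_ex, ← map_comp]
  rfl

/-- Fresh variables that are defined by equations and then quantified can be removed. This is the
clean-up step in the calculations with inverse images. -/
theorem act_mul_eqm_ex {Z : C} {N P : Cxt A} (X : Z ⟶ (Φ.free N).X) (T : 𝟙_ C ⟶ (Φ.free N).X)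
    (a : P ⟶ N) :
    act (X ≫ Φ.map (Cxt.inl N P))
      (Φ.eqm (Cxt.inr N P) (a ≫ Cxt.inl N P) * T ≫ Φ.map (Cxt.inl N P)) ≫ Φ.ex N P =
      act X T := by
  rw [act_mul, act_ex, act_eqm_ex, Category.assoc, ← map_comp]
  have : Cxt.inl N P ≫ Cxt.desc (𝟙 N) a = 𝟙 N := rfl
  rw [this, map_id, Category.comp_id]

/-- Substitution of equals. -/
theorem act_map_eqm {I N : Cxt A} (f g : I ⟶ N) :
    act (Φ.map f) (Φ.eqm f g) = act (Φ.map g) (Φ.eqm f g) := by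
  -- Both sides become quantifications over a fresh copy of `I`. It remains to see that "fresh
  -- equals `f`" and "fresh equals `g`" are interchangeable once `f = g` is assumed.
  rw [Φ.map_eq_act_eqm_ex f, Φ.map_eq_act_eqm_ex g, ← act_ex, ← act_ex, ← act_mul, ← act_mul,
    eqm_map]
  congr 2
  have hf := Φ.holds_eqm (Cxt.inr N I) (f ≫ Cxt.inl N I)
  have hg := Φ.holds_eqm (Cxt.inr N I) (g ≫ Cxt.inl N I)
  have h := Φ.holds_eqm (f ≫ Cxt.inl N I) (g ≫ Cxt.inl N I)
  exact Φ.eqm_mul_eqm_congr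
    (fun i => ((hf i).mul_right _).trans ((h i).mul_left _)) (fun i => (h i).mul_left _)
    (fun i => ((hg i).mul_right _).trans ((h i).mul_left _).symm) (fun i => (h i).mul_left _)

/-- The inverse image of predicates along a map of contexts. -/
noncomputable def pull {I N : Cxt A} (f : I ⟶ N) : (Φ.free N).X ⟶ (Φ.free I).X :=
  act (Φ.map (Cxt.inr I N)) (Φ.eqm (Cxt.inl I N) (f ≫ Cxt.inr I N)) ≫ Φ.ex I N

theorem pull_id (I : Cxt A) : Φ.pull (𝟙 I) = 𝟙 _ := by
  rw [pull, Category.id_comp, eqm_comm]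
  exact (Φ.act_eqm_ex _ (𝟙 I)).trans (by rw [← map_comp, ← map_id]; rfl)

/-- The normal form of an inverse image followed by a renaming: quantify over `N`, subject to the
equations imposed by the span on the variables of `P` and `N`. -/
theorem pull_comp_map {I N P : Cxt A} (f : I ⟶ N) (g : I ⟶ P) :
    Φ.pull f ≫ Φ.map g =
      act (Φ.map (Cxt.inr P N)) (Φ.eqm (g ≫ Cxt.inl P N) (f ≫ Cxt.inr P N)) ≫ Φ.ex P N := by
  rw [pull, Category.assoc, ← map_ex, ← Category.assoc, act_comp, eqm_map, ← map_comp]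
  rfl

theorem act_ex_ex {Z : C} {N P Q : Cxt A} (X : Z ⟶ (Φ.free ((N.sum P).sum Q)).X)
    (T : 𝟙_ C ⟶ (Φ.free ((N.sum P).sum Q)).X) : act X T ≫ Φ.ex (N.sum P) Q ≫ Φ.ex N P =
      act (X ≫ Φ.map (Cxt.exchange N P Q)) (T ≫ Φ.map (Cxt.exchange N P Q)) ≫
        Φ.ex (N.sum Q) P ≫ Φ.ex N Q := by
  rw [← act_comp, Category.assoc, exchange_ex_ex]

/-- The composite quantifies over `N` and `Q` subject to `n = g n` and `i = f i`. After the order of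
the quantifiers is exchanged, the first equations define the variables of `N`, which can be
eliminated, leaving `i = g (f i)`. -/
theorem pull_comp {I N Q : Cxt A} (f : I ⟶ N) (g : N ⟶ Q) :
    Φ.pull (f ≫ g) = Φ.pull g ≫ Φ.pull f := by
  rw [pull.eq_1 Φ f, ← Category.assoc (Φ.pull g), comp_act, pull_comp_map, ← act_ex,
    ← act_mul, Category.assoc, act_ex_ex, mul_map, eqm_map, eqm_map, eqm_map, ← map_comp]
  have h₁ : Φ.eqm ((Cxt.inr I N ≫ Cxt.inl (I.sum N) Q) ≫ Cxt.exchange I N Q)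
      ((g ≫ Cxt.inr (I.sum N) Q) ≫ Cxt.exchange I N Q) *
      Φ.eqm ((Cxt.inl I N ≫ Cxt.inl (I.sum N) Q) ≫ Cxt.exchange I N Q)
      (((f ≫ Cxt.inr I N) ≫ Cxt.inl (I.sum N) Q) ≫ Cxt.exchange I N Q) =
      Φ.eqm (Cxt.inr (I.sum Q) N) ((g ≫ Cxt.inr I Q) ≫ Cxt.inl (I.sum Q) N) *
      Φ.eqm (Cxt.inl I Q) ((f ≫ g) ≫ Cxt.inr I Q) ≫ Φ.map (Cxt.inl (I.sum Q) N) := by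
    rw [eqm_map]
    have h₁ := Φ.holds_eqm (Cxt.inr (I.sum Q) N) ((g ≫ Cxt.inr I Q) ≫ Cxt.inl (I.sum Q) N)
    have h₂ := Φ.holds_eqm (Cxt.inl I Q ≫ Cxt.inl (I.sum Q) N)
      (((f ≫ g) ≫ Cxt.inr I Q) ≫ Cxt.inl (I.sum Q) N)
    have h₃ := Φ.holds_eqm (Cxt.inl I Q ≫ Cxt.inl (I.sum Q) N) (f ≫ Cxt.inr (I.sum Q) N)
    change Φ.eqm (Cxt.inr (I.sum Q) N) ((g ≫ Cxt.inr I Q) ≫ Cxt.inl (I.sum Q) N) *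
      Φ.eqm (Cxt.inl I Q ≫ Cxt.inl (I.sum Q) N) (f ≫ Cxt.inr (I.sum Q) N) = _
    exact Φ.eqm_mul_eqm_congr (fun i => (h₁ i).mul_right _)
      (fun i => ((h₃ i).mul_left _).trans ((h₁ (f.toFun i)).mul_right _))
      (fun i => (h₁ i).mul_right _)
      (fun i => ((h₂ i).mul_left _).trans ((h₁ (f.toFun i)).mul_right _).symm)
  rw [h₁, ← Category.assoc, pull]
  refine congrArg (· ≫ Φ.ex I Q) ?_
  refine Eq.trans ?_ (congrArg (fun x => act x _ ≫ _) (Φ.map_comp _ (Cxt.inl (I.sum Q) N))).symm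
  exact (Φ.act_mul_eqm_ex _ _ (g ≫ Cxt.inr I Q)).symm

/-- Commutative squares of contexts whose underlying squares of sets are pushouts. -/
structure _root_.StringDiag.Cxt.IsPush {I N P Q : Cxt A} (f : I ⟶ N) (g : I ⟶ P) (a : N ⟶ Q)
    (b : P ⟶ Q) : Prop where
  w (i : I.pt) : a.toFun (f.toFun i) = b.toFun (g.toFun i)
  surj : Function.Surjective (Cxt.desc b a).toFun
  ker (r : (P.sum N).pt → (P.sum N).pt → Prop) (hr : Equivalence r)
    (h : ∀ i, r (.inl (g.toFun i)) (.inr (f.toFun i))) (x y : (P.sum N).pt)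
    (hxy : (Cxt.desc b a).toFun x = (Cxt.desc b a).toFun y) : r x y

/-- The Beck-Chevalley condition. Both sides are brought to quantifications over `N` and `Q`; the
right-hand one has the equations `n = a n` and `p = b p`. Since the square is a pushout, these
amount to the equations `g i = f i` together with a definition of each variable of `Q` by a
preimage, so `Q` can be eliminated. -/
theorem pull_comp_map_of_isPush {I N P Q : Cxt A} {f : I ⟶ N} {g : I ⟶ P} {a : N ⟶ Q}
    {b : P ⟶ Q} (h : Cxt.IsPush f g a b) :
    Φ.pull f ≫ Φ.map g = Φ.map a ≫ Φ.pull b := by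
  have hs : ∀ q, (Cxt.desc b a).toFun (Function.surjInv h.surj q) = q :=
    Function.surjInv_eq h.surj
  -- A choice of preimages in `P + N`; these provide the defining equations for the variables of
  -- `Q`.
  let s : Q ⟶ P.sum N := ⟨Function.surjInv h.surj, fun q => by
    rw [← (Cxt.desc b a).lab_eq, hs]⟩
  rw [pull_comp_map, pull.eq_1 Φ b, ← Category.assoc (Φ.map a), comp_act, ← map_comp,
    Φ.map_eq_act_eqm_ex (a ≫ Cxt.inr P Q), ← act_ex, ← act_mul, Category.assoc, act_ex_ex, mul_map,
    eqm_map, eqm_map, eqm_map]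
  have h₁ : Φ.eqm (Cxt.inr (P.sum Q) N ≫ Cxt.exchange P Q N)
      (((a ≫ Cxt.inr P Q) ≫ Cxt.inl (P.sum Q) N) ≫ Cxt.exchange P Q N) *
      Φ.eqm ((Cxt.inl P Q ≫ Cxt.inl (P.sum Q) N) ≫ Cxt.exchange P Q N)
      (((b ≫ Cxt.inr P Q) ≫ Cxt.inl (P.sum Q) N) ≫ Cxt.exchange P Q N) =
      Φ.eqm (Cxt.inr (P.sum N) Q) (s ≫ Cxt.inl (P.sum N) Q) *
      Φ.eqm (g ≫ Cxt.inl P N) (f ≫ Cxt.inr P N) ≫ Φ.map (Cxt.inl (P.sum N) Q) := by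
    rw [eqm_map]
    change Φ.eqm (Cxt.inr P N ≫ Cxt.inl (P.sum N) Q) (a ≫ Cxt.inr (P.sum N) Q) *
      Φ.eqm (Cxt.inl P N ≫ Cxt.inl (P.sum N) Q) (b ≫ Cxt.inr (P.sum N) Q) = _
    have h₁ := Φ.holds_eqm (Cxt.inr P N ≫ Cxt.inl (P.sum N) Q) (a ≫ Cxt.inr (P.sum N) Q)
    have h₂ := Φ.holds_eqm (Cxt.inl P N ≫ Cxt.inl (P.sum N) Q) (b ≫ Cxt.inr (P.sum N) Q)
    have h₃ := Φ.holds_eqm (Cxt.inr (P.sum N) Q) (s ≫ Cxt.inl (P.sum N) Q)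
    have h₄ := Φ.holds_eqm ((g ≫ Cxt.inl P N) ≫ Cxt.inl (P.sum N) Q)
      ((f ≫ Cxt.inr P N) ≫ Cxt.inl (P.sum N) Q)
    -- The minimality of the kernel is applied to the relation of provable equality under the glued
    -- equations. This is why `IsPush.ker` ranges over all equivalence relations.
    have h₅ : ∀ x y : (P.sum N).pt, (Cxt.desc b a).toFun x = (Cxt.desc b a).toFun y →
        Φ.Holds (Φ.eqm (Cxt.inr (P.sum N) Q) (s ≫ Cxt.inl (P.sum N) Q) *
          Φ.eqm ((g ≫ Cxt.inl P N) ≫ Cxt.inl (P.sum N) Q)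
            ((f ≫ Cxt.inr P N) ≫ Cxt.inl (P.sum N) Q)) (.inl x) (.inl y) :=
      h.ker _ ⟨fun _ => Holds.refl _ _, fun h => h.symm, fun h h' => h.trans h'⟩ fun i => (h₄ i).mul_left _
    refine Φ.eqm_mul_eqm_congr (fun q => ?_) (fun i => ?_) (fun n => ?_) (fun p => ?_)
    · have := hs q
      change Φ.Holds (N := (P.sum N).sum Q) _ (.inr q) (.inl (Function.surjInv h.surj q))
      -- Replacing `q` by the image of its chosen preimage allows a case distinction on whether that
      -- preimage comes from `P` or from `N`.
      revert this
      generalize Function.surjInv h.surj q = x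
      rintro rfl
      rcases x with p | n
      · exact (h₂ p).symm.mul_left _
      · exact (h₁ n).symm.mul_right _
    · refine ((h₂ (g.toFun i)).mul_left _).trans (Holds.trans ?_ ((h₁ (f.toFun i)).symm.mul_right _))
      change Φ.Holds (N := (P.sum N).sum Q) _ (.inr _) (.inr _)
      rw [h.w]
      exact Holds.refl _ _
    · refine Holds.trans ?_ ((h₃ (a.toFun n)).symm.mul_right _)
      exact h₅ (.inr n) _ (hs (a.toFun n)).symm
    · refine Holds.trans ?_ ((h₃ (b.toFun p)).symm.mul_right _)
      exact h₅ (.inl p) _ (hs (b.toFun p)).symm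
  rw [h₁, ← Category.assoc]
  refine congrArg (· ≫ Φ.ex P N) ?_
  rw [← map_comp]
  refine Eq.trans ?_ (congrArg (fun x => act x _ ≫ _) (Φ.map_comp _ (Cxt.inl (P.sum N) Q))).symm
  exact (Φ.act_mul_eqm_ex _ _ s).symm

/-- The quantified variables of `P` are defined by the equations `p = g p`, so the one-point rule
removes them together with those equations. -/
theorem pull_ex {I P Q : Cxt A} (g : I.sum P ⟶ Q) :
    Φ.pull g ≫ Φ.ex I P = Φ.pull (Cxt.inl I P ≫ g) := by
  rw [pull, Category.assoc, act_ex_ex, eqm_map]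
  have h₁ : Φ.eqm (Cxt.inl (I.sum P) Q ≫ Cxt.exchange I P Q)
      ((g ≫ Cxt.inr (I.sum P) Q) ≫ Cxt.exchange I P Q) =
      Φ.eqm (Cxt.inr (I.sum Q) P) (((Cxt.inr I P ≫ g) ≫ Cxt.inr I Q) ≫ Cxt.inl (I.sum Q) P) *
      Φ.eqm (Cxt.inl I Q) ((Cxt.inl I P ≫ g) ≫ Cxt.inr I Q) ≫ Φ.map (Cxt.inl (I.sum Q) P) := by
    rw [eqm_map]
    have h := Φ.holds_eqm (Cxt.inl (I.sum P) Q ≫ Cxt.exchange I P Q)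
      ((g ≫ Cxt.inr (I.sum P) Q) ≫ Cxt.exchange I P Q)
    have h₁ := Φ.holds_eqm (Cxt.inr (I.sum Q) P)
      (((Cxt.inr I P ≫ g) ≫ Cxt.inr I Q) ≫ Cxt.inl (I.sum Q) P)
    have h₂ := Φ.holds_eqm (Cxt.inl I Q ≫ Cxt.inl (I.sum Q) P)
      (((Cxt.inl I P ≫ g) ≫ Cxt.inr I Q) ≫ Cxt.inl (I.sum Q) P)
    refine Φ.eq_of_mul_eq ?_ ?_
    · rw [← mul_assoc, Φ.mul_eqm (f := Cxt.inr (I.sum Q) P) fun i => h (.inr i)]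
      exact Φ.mul_eqm fun i => h (.inl i)
    · refine mul_eqm _ ?_
      rintro (i | i)
      · exact (h₂ i).mul_left _
      · exact (h₁ i).mul_right _
  rw [h₁, ← Category.assoc, pull]
  refine congrArg (· ≫ Φ.ex I Q) ?_
  refine Eq.trans ?_ (Φ.act_mul_eqm_ex (Φ.map (Cxt.inr I Q)) _ ((Cxt.inr I P ≫ g) ≫ Cxt.inr I Q))
  rw [← map_comp, ← map_comp]
  rfl

/-- Makes quantifiers instances of `pull`, so that functoriality of `pull` applies to them. -/
theorem ex_eq_pull (N P : Cxt A) : Φ.ex N P = Φ.pull (Cxt.inl N P) := by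
  have h := Φ.pull_ex (𝟙 (N.sum P))
  rw [pull_id, Category.id_comp] at h
  exact h

theorem copair_act {B : C} [MonObj B] {Z Z' : C} (U : Z ⟶ B) (V : Z' ⟶ B) (T : 𝟙_ C ⟶ B) :
    act (copair U V) T = copair U (act V T) := mul_act U V T

theorem copair_comm {B : C} [MonObj B] [IsCommMonObj B] {Z Z' : C} (U : Z ⟶ B) (V : Z' ⟶ B) :
    copair U V = (β_ _ _).hom ≫ copair V U := by
  rw [copair, copair, ← BraidedCategory.braiding_naturality_assoc, IsCommMonObj.mul_comm]

theorem copair_act_left {B : C} [MonObj B] [IsCommMonObj B] {Z Z' : C} (U : Z ⟶ B) (V : Z' ⟶ B)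
    (T : 𝟙_ C ⟶ B) : act (copair U V) T = copair (act U T) V := by
  rw [copair_comm, ← comp_act, copair_act, copair_comm, SymmetricCategory.symmetry_assoc]

theorem copair_inl_ex {Z Z' : C} {N P : Cxt A} (U : Z ⟶ (Φ.free N).X)
    (V : Z' ⟶ (Φ.free (N.sum P)).X) :
    copair (U ≫ Φ.map (Cxt.inl N P)) V ≫ Φ.ex N P = copair U (V ≫ Φ.ex N P) := by
  rw [ex, ← Category.assoc, copair_comp, Category.assoc, inl_split, copair, inl_mul_discard,
    Category.assoc, copair]

/-- Frobenius reciprocity. -/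
theorem copair_map_pull {Z Z' : C} {I N : Cxt A} (f : I ⟶ N) (U : Z ⟶ (Φ.free I).X)
    (V : Z' ⟶ (Φ.free N).X) :
    copair (U ≫ Φ.map f) V ≫ Φ.pull f = copair U (V ≫ Φ.pull f) := by
  rw [pull, ← Category.assoc, comp_act, copair_comp, Category.assoc, ← map_comp, copair_act_left,
    ← comp_act, eqm_comm, act_map_eqm, comp_act, ← copair_act_left, copair_act, copair_inl_ex,
    ← Category.assoc, comp_act]

/-- Reciprocity in the form needed to compose cospans: a formula on `I`, pushed forward along `f`,
can be applied after pulling back instead. -/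
theorem act_map_pull {Z : C} {I N : Cxt A} (f : I ⟶ N) (X : Z ⟶ (Φ.free N).X)
    (T : 𝟙_ C ⟶ (Φ.free I).X) :
    act X (T ≫ Φ.map f) ≫ Φ.pull f = act (X ≫ Φ.pull f) T := by
  rw [act_eq, act_eq, Category.assoc]
  exact congrArg (_ ≫ ·) (Φ.copair_map_pull f T X)

theorem isPush_id {I N : Cxt A} (f : I ⟶ N) (g : N ⟶ I) (h : f ≫ g = 𝟙 I) (h' : g ≫ f = 𝟙 N) :
    Cxt.IsPush f (𝟙 I) g (𝟙 I) where
  w i := congrArg (fun k => Cxt.Hom.toFun k i) h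
  surj i := ⟨.inl i, rfl⟩
  ker r hr hi := by
    have key : ∀ x, r (.inl ((Cxt.desc (𝟙 I) g).toFun x)) x := by
      rintro (i | n)
      · exact hr.refl _
      · have h₁ := hi (g.toFun n)
        have h₂ : f.toFun (g.toFun n) = n := congrArg (fun k => Cxt.Hom.toFun k n) h'
        rw [h₂] at h₁
        exact h₁
    intro x y hxy
    refine hr.trans (hr.symm (key x)) ?_
    rw [hxy]
    exact key y

/-- The Beck-Chevalley condition for the square whose other two sides are an identity and the
inverse of `f`. -/
theorem pull_eq_map {I N : Cxt A} (f : I ⟶ N) (g : N ⟶ I) (h : f ≫ g = 𝟙 I) (h' : g ≫ f = 𝟙 N) :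
    Φ.pull f = Φ.map g := by
  have := Φ.pull_comp_map_of_isPush (isPush_id f g h h')
  rwa [map_id, Category.comp_id, pull_id, Category.comp_id] at this

end FrobFamily

end Equations

/-! ### Morphisms denoted by cospans with a formula. -/

section Cospans

variable {C : Type u₁} [Category.{v₁} C] [MonoidalCategory C] [SymmetricCategory C]
  {A : Type u} (Φ : FrobFamily A C)

/-- To bound the kernel it suffices to connect each point with the chosen representative of its
image. -/
theorem Cxt.IsPush.of_section {I N P Q : Cxt A} {f : I ⟶ N} {g : I ⟶ P} {a : N ⟶ Q}
    {b : P ⟶ Q} (w : ∀ i, a.toFun (f.toFun i) = b.toFun (g.toFun i)) (c : Q.pt → (P.sum N).pt)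
    (hc : ∀ q, (Cxt.desc b a).toFun (c q) = q)
    (h : ∀ r : (P.sum N).pt → (P.sum N).pt → Prop, Equivalence r →
      (∀ i, r (.inl (g.toFun i)) (.inr (f.toFun i))) → ∀ x, r x (c ((Cxt.desc b a).toFun x))) :
    Cxt.IsPush f g a b where
  w := w
  surj q := ⟨c q, hc q⟩
  ker r hr hi x y hxy := by
    refine hr.trans (h r hr hi x) ?_
    rw [hxy]
    exact hr.symm (h r hr hi y)

namespace FrobFamily

theorem copair_pull_right {Z Z' : C} {I N : Cxt A} (f : I ⟶ N) (V : Z ⟶ (Φ.free N).X)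
    (U : Z' ⟶ (Φ.free I).X) :
    copair V (U ≫ Φ.map f) ≫ Φ.pull f = copair (V ≫ Φ.pull f) U := by
  rw [copair_comm, Category.assoc, copair_map_pull, copair_comm, SymmetricCategory.symmetry_assoc]

theorem isPush_inl {I N : Cxt A} (f : I ⟶ N) (P : Cxt A) :
    Cxt.IsPush f (Cxt.inl I P) (Cxt.inl N P) (Cxt.sumMap f (𝟙 P)) :=
  .of_section (fun _ => rfl) (Sum.elim (fun n => .inr n) (fun p => .inl (.inr p)))
    (by rintro (n | p) <;> rfl) (by
      rintro r hr hi ((i | p) | n)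
      · exact hi i
      · exact hr.refl _
      · exact hr.refl _)

theorem isPush_inr {I N : Cxt A} (f : I ⟶ N) (P : Cxt A) :
    Cxt.IsPush f (Cxt.inr P I) (Cxt.inr P N) (Cxt.sumMap (𝟙 P) f) :=
  .of_section (fun _ => rfl) (Sum.elim (fun p => .inl (.inl p)) (fun n => .inr n))
    (by rintro (n | p) <;> rfl) (by
      rintro r hr hi ((p | i) | n)
      · exact hr.refl _
      · exact hi i
      · exact hr.refl _)

theorem split_inv_eq (N P : Cxt A) :
    (Φ.split N P).inv = copair (Φ.map (Cxt.inl N P)) (Φ.map (Cxt.inr N P)) := rfl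

theorem split_inv_pull_left {I N : Cxt A} (f : I ⟶ N) (P : Cxt A) :
    (Φ.split N P).inv ≫ Φ.pull (Cxt.sumMap f (𝟙 P)) = Φ.pull f ▷ _ ≫ (Φ.split I P).inv := by
  have h : Φ.map (Cxt.inr N P) = Φ.map (Cxt.inr I P) ≫ Φ.map (Cxt.sumMap f (𝟙 P)) := by
    rw [← map_comp]; rfl
  rw [split_inv_eq, split_inv_eq, h, copair_pull_right, ← tensorHom_id, tensor_copair,
    Category.id_comp, Φ.pull_comp_map_of_isPush (isPush_inl f P)]

theorem split_inv_pull_right {I N : Cxt A} (f : I ⟶ N) (P : Cxt A) :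
    (Φ.split P N).inv ≫ Φ.pull (Cxt.sumMap (𝟙 P) f) = _ ◁ Φ.pull f ≫ (Φ.split P I).inv := by
  have h : Φ.map (Cxt.inl P N) = Φ.map (Cxt.inl P I) ≫ Φ.map (Cxt.sumMap (𝟙 P) f) := by
    rw [← map_comp]; rfl
  rw [split_inv_eq, split_inv_eq, h, copair_map_pull, ← id_tensorHom, tensor_copair,
    Category.id_comp, Φ.pull_comp_map_of_isPush (isPush_inr f P)]

/-- Inverse images are compatible with disjoint unions. The two components are treated separately,
each by reciprocity and the Beck-Chevalley condition for the evident pushout square. -/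
theorem split_inv_pull {I N J P : Cxt A} (f : I ⟶ N) (g : J ⟶ P) :
    (Φ.split N P).inv ≫ Φ.pull (Cxt.sumMap f g) =
      (Φ.pull f ⊗ₘ Φ.pull g) ≫ (Φ.split I J).inv := by
  have h : Cxt.sumMap f g = Cxt.sumMap f (𝟙 J) ≫ Cxt.sumMap (𝟙 N) g :=
    Cxt.hom_ext (by rintro (i | j) <;> rfl)
  rw [h, pull_comp, ← Category.assoc, split_inv_pull_right, Category.assoc, split_inv_pull_left,
    MonoidalCategory.tensorHom_def', Category.assoc]

/-- The morphism defined by a cospan of contexts and a predicate on its carrier. -/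
noncomputable def sem {V N W : Cxt A} (p : V ⟶ N) (T : 𝟙_ C ⟶ (Φ.free N).X) (q : W ⟶ N) :
    (Φ.free V).X ⟶ (Φ.free W).X :=
  act (Φ.map p) T ≫ Φ.pull q

theorem sem_iso {V W N N' : Cxt A} (p : V ⟶ N) (T : 𝟙_ C ⟶ (Φ.free N).X) (q : W ⟶ N)
    (f : N ⟶ N') (g : N' ⟶ N) (h : f ≫ g = 𝟙 N) (h' : g ≫ f = 𝟙 N') :
    Φ.sem (p ≫ f) (T ≫ Φ.map f) (q ≫ f) = Φ.sem p T q := by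
  rw [sem, map_comp, ← act_comp, pull_comp, Φ.pull_eq_map f g h h', Category.assoc,
    ← Category.assoc (Φ.map f), ← map_comp, h, map_id, Category.id_comp, sem]

/-- Beck-Chevalley replaces pulling back to `V` and renaming into `P` by renaming into the pushout
and pulling back to `P`. Reciprocity then moves the second formula to the pushout as well. -/
theorem sem_comp {U V W N P Q : Cxt A} {p : U ⟶ N} {T : 𝟙_ C ⟶ (Φ.free N).X} {q : V ⟶ N}
    {p' : V ⟶ P} {T' : 𝟙_ C ⟶ (Φ.free P).X} {q' : W ⟶ P} {a : N ⟶ Q} {b : P ⟶ Q}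
    (h : Cxt.IsPush q p' a b) :
    Φ.sem p T q ≫ Φ.sem p' T' q' =
      Φ.sem (p ≫ a) (T ≫ Φ.map a * T' ≫ Φ.map b) (q' ≫ b) := by
  rw [sem, sem, sem, Category.assoc, ← Category.assoc (Φ.pull q), comp_act,
    pull_comp_map_of_isPush _ h, pull_comp, ← Category.assoc (act _ _) (Φ.pull b), act_mul,
    act_map_pull, map_comp, ← act_comp, Category.assoc,
    ← Category.assoc (act (Φ.map p) T) (act _ _), comp_act]

theorem sem_tensor {V N W V' N' W' : Cxt A} (p : V ⟶ N) (T : 𝟙_ C ⟶ (Φ.free N).X) (q : W ⟶ N)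
    (p' : V' ⟶ N') (T' : 𝟙_ C ⟶ (Φ.free N').X) (q' : W' ⟶ N') :
    (Φ.sem p T q ⊗ₘ Φ.sem p' T' q') ≫ (Φ.split W W').inv =
      (Φ.split V V').inv ≫ Φ.sem (Cxt.sumMap p p')
        (T ≫ Φ.map (Cxt.inl N N') * T' ≫ Φ.map (Cxt.inr N N')) (Cxt.sumMap q q') := by
  have h : (Φ.split V V').inv ≫ Φ.map (Cxt.sumMap p p') =
      copair (Φ.map p ≫ Φ.map (Cxt.inl N N')) (Φ.map p' ≫ Φ.map (Cxt.inr N N')) := by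
    rw [split_inv_map, ← map_comp, ← map_comp]
    rfl
  rw [sem, sem, sem, ← tensorHom_comp_tensorHom, Category.assoc, ← split_inv_pull,
    ← Category.assoc, ← Category.assoc, comp_act, h, split_inv_eq, tensor_copair, act_comp,
    act_comp, act_mul, copair_act_left, copair_act]

theorem split_inv_swap (V W : Cxt A) :
    (Φ.split V W).inv ≫ Φ.map (Cxt.desc (Cxt.inr W V) (Cxt.inl W V)) =
      (β_ _ _).hom ≫ (Φ.split W V).inv := by
  rw [split_inv_map, split_inv_eq, copair_comm]
  rfl

theorem swap_swap (V W : Cxt A) : Cxt.desc (Cxt.inr W V) (Cxt.inl W V) ≫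
    Cxt.desc (Cxt.inr V W) (Cxt.inl V W) = 𝟙 (V.sum W) :=
  Cxt.hom_ext (by rintro (i | j) <;> rfl)

theorem pull_inr (V W : Cxt A) :
    Φ.pull (Cxt.inr V W) = Φ.map (Cxt.desc (Cxt.inr W V) (Cxt.inl W V)) ≫ Φ.ex W V := by
  rw [ex_eq_pull, ← Φ.pull_eq_map _ _ (swap_swap W V) (swap_swap V W), ← pull_comp]
  rfl

/-- Inverse image along the right inclusion discards the first tensor factor, which commutes with
any morphism on the second. -/
theorem par_pull_inr (U : Cxt A) {V W : Cxt A} (h : (Φ.free V).X ⟶ (Φ.free W).X) :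
    Φ.par U h ≫ Φ.pull (Cxt.inr U W) = Φ.pull (Cxt.inr U V) ≫ h := by
  have key (V : Cxt A) : Φ.pull (Cxt.inr U V) =
      (Φ.split U V).hom ≫ Φ.eps U ▷ _ ≫ (λ_ _).hom := by
    rw [← Iso.inv_comp_eq, pull_inr, ← Category.assoc, split_inv_swap, ex, discard, Category.assoc,
      Iso.inv_hom_id_assoc, ← BraidedCategory.braiding_naturality_left_assoc]
    simp
  rw [key, key, par, Category.assoc, Category.assoc, Iso.inv_hom_id_assoc, whisker_exchange_assoc,
    leftUnitor_naturality]
  simp only [Category.assoc]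

/-- The predicate that defines a morphism. -/
theorem exists_sem_eq {V W : Cxt A} (h : (Φ.free V).X ⟶ (Φ.free W).X) :
    ∃ T : 𝟙_ C ⟶ (Φ.free (V.sum W)).X, Φ.sem (Cxt.inl V W) T (Cxt.inr V W) = h := by
  -- The name of `h`: the equality predicate on two copies of `V`, with `h` applied to the second
  -- copy. Linearity of `h` over the first copy and the one-point rule recover `h` itself.
  refine ⟨Φ.eqm (Cxt.inl V V) (Cxt.inr V V) ≫ Φ.par V h, ?_⟩
  have h₁ := Φ.act_inl_par (𝟙 _) (Φ.eqm (Cxt.inl V V) (Cxt.inr V V)) h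
  rw [Category.id_comp, Category.id_comp] at h₁
  rw [sem, ← h₁, Category.assoc, par_pull_inr, pull_inr, ← Category.assoc, ← Category.assoc,
    act_comp, eqm_map, ← map_comp]
  have h₂ := Φ.act_eqm_ex (Φ.map (Cxt.inr V V)) (𝟙 V)
  rw [← map_comp] at h₂
  refine (congrArg (· ≫ h) h₂).trans ?_
  change Φ.map (𝟙 V) ≫ h = h
  rw [map_id, Category.id_comp]

/-- When `g` has a section `s`, each quantified `n` is defined by the equation `n = s n`. The other
equations say that every `i` agrees with the representative `s (g i)` of its fibre. -/
theorem pull_eq_of_section {W N : Cxt A} (g : W ⟶ N) (s : N ⟶ W) (hs : s ≫ g = 𝟙 N) :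
    Φ.pull g = act (Φ.map s) (Φ.eqm (𝟙 W) (g ≫ s)) := by
  have h₀ (n : N.pt) : g.toFun (s.toFun n) = n := congrArg (fun k => Cxt.Hom.toFun k n) hs
  have h₁ : Φ.eqm (Cxt.inl W N) (g ≫ Cxt.inr W N) =
      Φ.eqm (Cxt.inr W N) (s ≫ Cxt.inl W N) *
        Φ.eqm (𝟙 W) (g ≫ s) ≫ Φ.map (Cxt.inl W N) := by
    rw [eqm_map]
    have h := Φ.holds_eqm (Cxt.inl W N) (g ≫ Cxt.inr W N)
    have h₁ := Φ.holds_eqm (Cxt.inr W N) (s ≫ Cxt.inl W N)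
    have h₂ := Φ.holds_eqm (𝟙 W ≫ Cxt.inl W N) ((g ≫ s) ≫ Cxt.inl W N)
    have h₃ (n : N.pt) : Φ.Holds (Φ.eqm (Cxt.inl W N) (g ≫ Cxt.inr W N)) (.inr n)
        (.inl (s.toFun n)) := by
      have := (h (s.toFun n)).symm
      change Φ.Holds (N := W.sum N) _ (.inr (g.toFun (s.toFun n))) _ at this
      rwa [h₀] at this
    refine Φ.eq_of_mul_eq ?_ ?_
    · rw [← mul_assoc, Φ.mul_eqm (f := Cxt.inr W N) h₃]
      exact Φ.mul_eqm fun i => (h i).trans (h₃ _)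
    · exact Φ.mul_eqm fun i => ((h₂ i).mul_left _).trans ((h₁ _).symm.mul_right _)
  rw [pull, h₁, ← act_mul_eqm_ex Φ (Φ.map s) _ s, act_mul, act_mul, act_map_eqm, map_comp]

/-- The context with a single variable. -/
@[reducible]
def _root_.StringDiag.Cxt.one (x : A) : Cxt A := ⟨Unit, fun _ => x, inferInstance⟩

/-- The context without variables. -/
@[reducible]
def _root_.StringDiag.Cxt.zero : Cxt A := ⟨Empty, Empty.elim, inferInstance⟩

/-- The object of a context with a single variable. -/
noncomputable def varIso (x : A) : (Φ.obj x).X ≅ (Φ.free (Cxt.one x)).X where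
  hom := und (Φ.var (Cxt.one x) () rfl)
  inv := und (Φ.eval (N := Cxt.one x) fun _ => 𝟙 (Φ.obj x))
  hom_inv_id := by
    rw [← und_comp, Φ.var_eval (N := Cxt.one x), und_id]
  inv_hom_id := by
    rw [← und_comp, ← und_id]
    refine congrArg und (Φ.free_hom_ext fun n => ?_)
    rw [← Category.assoc, Φ.var_eval (N := Cxt.one x), Category.id_comp, Category.comp_id]

/-- The object of a context without variables. -/
noncomputable def zeroIso : 𝟙_ C ≅ (Φ.free (Cxt.zero (A := A))).X where
  hom := und (B := CommMon.trivial C) (default : CommMon.trivial C ⟶ Φ.free Cxt.zero)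
  inv := und (D := CommMon.trivial C) (Φ.eval (N := Cxt.zero) fun n => Empty.elim n)
  hom_inv_id := congrArg und (Subsingleton.elim
    ((default : CommMon.trivial C ⟶ Φ.free Cxt.zero) ≫
      Φ.eval (N := Cxt.zero) fun n => Empty.elim n) (𝟙 _))
  inv_hom_id := congrArg und (Φ.free_hom_ext (f := Φ.eval (N := Cxt.zero)
    (fun n => Empty.elim n) ≫ (default : CommMon.trivial C ⟶ Φ.free Cxt.zero)) (g := 𝟙 _)
      fun n => Empty.elim n)

theorem zeroIso_hom : Φ.zeroIso.hom = MonObj.one (X := (Φ.free (Cxt.zero (A := A))).X) := by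
  exact (Category.id_comp _).symm.trans (IsMonHom.one_hom
    (und (B := CommMon.trivial C) (default : CommMon.trivial C ⟶ Φ.free Cxt.zero)))

theorem varIso_map {x : A} {N : Cxt A} (f : Cxt.one x ⟶ N) :
    (Φ.varIso x).hom ≫ Φ.map f = und (Φ.var N (f.toFun ()) (f.lab_eq ())) :=
  Φ.und_var_map f () rfl

/-- Identifies the inverse image along a fold with the comultiplication. With `a` as representative
the only nontrivial equation is between `a` and `b`, and `act_eqElt` turns it into the convolution.
-/
theorem var_pull_pair {W : Cxt A} (x : A) (a b : W.pt) (ha : W.lab a = x) (hb : W.lab b = x)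
    (h : ∀ c, c = a ∨ c = b) (g : W ⟶ Cxt.one x) :
    (Φ.varIso x).hom ≫ Φ.pull g =
      Φ.comul x ≫ copair (und (Φ.var W a ha)) (und (Φ.var W b hb)) := by
  let s : Cxt.one x ⟶ W := ⟨fun _ => a, fun _ => ha⟩
  have hE : Φ.eqm (𝟙 W) (g ≫ s) = Φ.eqv W a b (ha.trans hb.symm) := by
    refine Φ.eq_of_mul_eq ?_ (Φ.mul_eqm fun i => ?_)
    · exact (Φ.holds_eqm (𝟙 W) (g ≫ s) b).symm.2
    · rcases h i with rfl | rfl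
      · exact Holds.refl _ _
      · exact (Φ.holds_eqv _ _ _).symm
  rw [Φ.pull_eq_of_section g s rfl, comp_act, hE, ← eqElt_var Φ a b ha hb]
  refine Eq.trans ?_ (Φ.act_eqElt _ _)
  congr 1
  exact Φ.und_var_map s () rfl

/-- The quantifier was fixed only through its logical property, so it has to be matched with the
given counit. By functoriality and the Beck-Chevalley condition, this inverse image is a left counit
for the comultiplication, and a left counit agrees with the given right counit. -/
theorem var_pull_zero (x : A) (g : Cxt.zero ⟶ Cxt.one x) :
    (Φ.varIso x).hom ≫ Φ.pull g = Φ.counit x ≫ Φ.zeroIso.hom := by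
  have h₁ : Φ.comul x ≫ copair (((Φ.varIso x).hom ≫ Φ.pull g) ≫ Φ.map g) (Φ.varIso x).hom =
      (Φ.varIso x).hom := by
    have h : Cxt.IsPush g g (Cxt.inl (Cxt.one x) (Cxt.one x)) (Cxt.inr _ _) :=
      .of_section (fun i => Empty.elim i) Sum.swap (by rintro (_ | _) <;> rfl)
        (by rintro r hr - (_ | _) <;> exact hr.refl _)
    have h₄ : Φ.pull (Cxt.desc (𝟙 (Cxt.one x)) (𝟙 _)) ≫ Φ.pull (Cxt.inr (Cxt.one x) (Cxt.one x)) =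
        𝟙 _ := by
      rw [← pull_comp, ← pull_id]
      rfl
    have h₂ : (Φ.varIso x).hom ≫ Φ.pull (Cxt.desc (𝟙 (Cxt.one x)) (𝟙 _)) =
        Φ.comul x ≫ copair ((Φ.varIso x).hom ≫ Φ.map (Cxt.inl (Cxt.one x) (Cxt.one x)))
          ((Φ.varIso x).hom ≫ Φ.map (Cxt.inr (Cxt.one x) (Cxt.one x))) := by
      rw [varIso_map, varIso_map]
      exact Φ.var_pull_pair (W := (Cxt.one x).sum (Cxt.one x)) x (.inl ()) (.inr ()) rfl rfl
        (by rintro (_ | _) <;> simp) _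
    have h₃ := congrArg (· ≫ Φ.pull (Cxt.inr (Cxt.one x) (Cxt.one x))) h₂
    simp only [Category.assoc, h₄, Category.comp_id] at h₃
    rw [copair_pull_right, Category.assoc, ← pull_comp_map_of_isPush _ h, ← Category.assoc] at h₃
    exact h₃.symm
  set e := ((Φ.varIso x).hom ≫ Φ.pull g) ≫ Φ.zeroIso.inv with he
  have h₂ : (Φ.varIso x).hom ≫ Φ.pull g = e ≫ Φ.zeroIso.hom := by
    rw [he, Category.assoc, Iso.inv_hom_id, Category.comp_id]
  have h₃ : Φ.zeroIso.hom ≫ Φ.map g = MonObj.one := by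
    rw [zeroIso_hom, IsMonHom.one_hom]
  have h₄ : Φ.comul x ≫ e ▷ _ ≫ (λ_ _).hom = 𝟙 _ := by
    rw [← cancel_mono (Φ.varIso x).hom, Category.id_comp]
    refine Eq.trans ?_ h₁
    rw [h₂, Category.assoc, Category.assoc e, h₃, copair, ← Category.comp_id (Φ.varIso x).hom,
      ← tensorHom_comp_tensorHom, tensorHom_id, Category.assoc, Category.assoc,
      MonObj.one_mul, MonoidalCategory.tensorHom_def]
    simp
  have h₅ : e = Φ.counit x := by
    have := congrArg (· ≫ Φ.counit x) h₄
    simp only [Category.assoc, Category.id_comp] at this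
    rw [← this, ← leftUnitor_naturality, ← whisker_exchange_assoc, reassoc_of% Φ.comul_counit,
      unitors_equal]
    simp
  rw [h₂, h₅]

/-- The context of a word. -/
@[reducible]
def _root_.StringDiag.Cxt.word (l : List A) : Cxt A := ⟨Fin l.length, l.get, inferInstance⟩

/-- The positions of a nonempty word. -/
def _root_.StringDiag.Cxt.consTo (x : A) (l : List A) :
    (Cxt.one x).sum (Cxt.word l) ⟶ Cxt.word (x :: l) :=
  Cxt.desc ⟨fun _ => (0 : Fin (l.length + 1)), fun _ => rfl⟩
    ⟨fun i => (Fin.succ i : Fin (l.length + 1)), fun _ => rfl⟩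

/-- The positions of a nonempty word, split into the first one and the other ones. -/
def _root_.StringDiag.Cxt.consOf (x : A) (l : List A) :
    Cxt.word (x :: l) ⟶ (Cxt.one x).sum (Cxt.word l) :=
  ⟨fun i => Fin.cases (n := l.length) (motive := fun _ => Unit ⊕ Fin l.length) (.inl ()) .inr i,
    fun i => by
      refine Fin.cases (n := l.length) ?_ (fun i => ?_) i <;> rfl⟩

/-- The object of a nonempty word. -/
noncomputable def consIso (x : A) (l : List A) {Z : C} (i : Z ≅ (Φ.free (Cxt.word l)).X) :
    (Φ.obj x).X ⊗ Z ≅ (Φ.free (Cxt.word (x :: l))).X :=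
  (Φ.varIso x ⊗ᵢ i) ≪≫ (Φ.split _ _).symm ≪≫ Φ.freeIso (Cxt.consTo x l) (Cxt.consOf x l)
    (Cxt.hom_ext (by rintro (_ | _) <;> rfl))
    (Cxt.hom_ext fun i => by refine Fin.cases (n := l.length) ?_ (fun i => ?_) i <;> rfl)

theorem consIso_hom (x : A) (l : List A) {Z : C} (i : Z ≅ (Φ.free (Cxt.word l)).X) :
    (Φ.consIso x l i).hom = ((Φ.varIso x).hom ⊗ₘ i.hom) ≫ (Φ.split _ _).inv ≫
      Φ.map (Cxt.consTo x l) := rfl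

/-- The map from the context without variables to the context of the empty word. -/
def _root_.StringDiag.Cxt.nilTo : Cxt.zero (A := A) ⟶ Cxt.word [] :=
  ⟨fun n => Empty.elim n, fun n => Empty.elim n⟩

/-- The object of the empty word. -/
noncomputable def nilIso : 𝟙_ C ≅ (Φ.free (Cxt.word ([] : List A))).X :=
  Φ.zeroIso ≪≫ Φ.freeIso Cxt.nilTo
    ⟨fun n : Fin 0 => n.elim0, fun n : Fin 0 => n.elim0⟩ (Cxt.hom_ext fun n => Empty.elim n)
    (Cxt.hom_ext fun n : Fin 0 => n.elim0)

theorem nilIso_hom : Φ.nilIso.hom =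
    MonObj.one (X := (Φ.free (Cxt.word ([] : List A))).X) := by
  have h : Φ.nilIso.hom = Φ.zeroIso.hom ≫ Φ.map Cxt.nilTo := rfl
  rw [h, zeroIso_hom, IsMonHom.one_hom]

end FrobFamily

end Cospans

/-! ### Strict symmetric monoidal categories as symmetric monoidal categories in the sense of
Mathlib. -/

namespace StrictSMC

variable {C : Type u} [StrictSMC.{u, v} C]

/-- Converts the heterogeneous laws of the strict structure into naturality squares for coherence
isomorphisms of the form `eqToHom`. -/
theorem eqToHom_comp_of_heq {X X' Y Y' : C} (hX : X = X') (hY : Y = Y') {f : X ⟶ Y} {g : X' ⟶ Y'}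
    (h : HEq f g) : f ≫ eqToHom hY = eqToHom hX ≫ g := by
  subst hX hY
  simpa using h

theorem tensorHom_eqToHom_id {X X' : C} (h : X = X') (Y : C) :
    tensorHom (eqToHom h) (𝟙 Y) = eqToHom (by rw [h]) := by
  subst h
  exact tensorHom_id _ _

theorem tensorHom_id_eqToHom {X X' : C} (h : X = X') (Y : C) :
    tensorHom (𝟙 Y) (eqToHom h) = eqToHom (by rw [h]) := by
  subst h
  exact tensorHom_id _ _

variable (C)

/-- A strict symmetric monoidal category is a monoidal category. -/
@[reducible]
def monoidalCategory : MonoidalCategory C :=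
  letI : MonoidalCategoryStruct C :=
    { tensorObj := tensorObj
      whiskerLeft := fun X _ _ f => tensorHom (𝟙 X) f
      whiskerRight := fun f Y => tensorHom f (𝟙 Y)
      tensorHom := tensorHom
      tensorUnit := unit
      associator := fun X Y Z => eqToIso (tensorObj_assoc X Y Z)
      leftUnitor := fun X => eqToIso (unit_tensorObj X)
      rightUnitor := fun X => eqToIso (tensorObj_unit X) }
  MonoidalCategory.ofTensorHom
    (id_tensorHom_id := tensorHom_id)
    (id_tensorHom := fun _ _ _ _ => rfl)
    (tensorHom_id := fun _ _ => rfl)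
    (tensorHom_comp_tensorHom := fun _ _ _ _ => tensorHom_comp _ _ _ _)
    (associator_naturality := fun _ _ _ => eqToHom_comp_of_heq (tensorObj_assoc _ _ _) (tensorObj_assoc _ _ _)
      (tensorHom_assoc _ _ _))
    (leftUnitor_naturality := fun _ => eqToHom_comp_of_heq (unit_tensorObj _) (unit_tensorObj _)
      (unit_tensorHom _))
    (rightUnitor_naturality := fun _ => eqToHom_comp_of_heq (tensorObj_unit _) (tensorObj_unit _)
      (tensorHom_unit _))
    (pentagon := fun W X Y Z => by
      change tensorHom (eqToHom (tensorObj_assoc W X Y)) (𝟙 Z) ≫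
        eqToHom (tensorObj_assoc W (tensorObj X Y) Z) ≫
          tensorHom (𝟙 W) (eqToHom (tensorObj_assoc X Y Z)) =
        eqToHom (tensorObj_assoc (tensorObj W X) Y Z) ≫ eqToHom (tensorObj_assoc W X (tensorObj Y Z))
      rw [tensorHom_eqToHom_id, tensorHom_id_eqToHom]
      simp)
    (triangle := fun X Y => by
      change eqToHom (tensorObj_assoc X unit Y) ≫ tensorHom (𝟙 X) (eqToHom (unit_tensorObj Y)) =
        tensorHom (eqToHom (tensorObj_unit X)) (𝟙 Y)
      rw [tensorHom_eqToHom_id, tensorHom_id_eqToHom]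
      simp)

/-- A strict symmetric monoidal category is a symmetric category. -/
@[reducible]
def symmetricCategory : @SymmetricCategory C _ (monoidalCategory C) :=
  letI := monoidalCategory C
  let σ (X Y : C) : X ⊗ Y ⟶ Y ⊗ X := symm X Y
  have σσ (X Y : C) : σ X Y ≫ σ Y X = 𝟙 _ := symm_symm X Y
  have right (X : C) {Y Z : C} (f : Y ⟶ Z) : X ◁ f ≫ σ X Z = σ X Y ≫ f ▷ X := symm_natural X f
  have forward (X Y Z : C) : (α_ X Y Z).hom ≫ σ X (Y ⊗ Z) ≫ (α_ Y Z X).hom =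
      σ X Y ▷ Z ≫ (α_ Y X Z).hom ≫ Y ◁ σ X Z := by
    have h : σ X (Y ⊗ Z) ≫ (α_ Y Z X).hom = (α_ X Y Z).inv ≫
        σ X Y ▷ Z ≫ (α_ Y X Z).hom ≫ Y ◁ σ X Z :=
      eqToHom_comp_of_heq (tensorObj_assoc X Y Z).symm (tensorObj_assoc Y Z X) (symm_tensor X Y Z)
    rw [h, Iso.hom_inv_id_assoc]
  { braiding := fun X Y => ⟨σ X Y, σ Y X, σσ X Y, σσ Y X⟩
    braiding_naturality_right := fun X _ _ f => right X f
    braiding_naturality_left := fun {X Y} f Z => by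
      change f ▷ Z ≫ σ Y Z = σ X Z ≫ Z ◁ f
      -- Naturality in the left variable follows from naturality in the right one by conjugation
      -- with the symmetry.
      have h₁ := congrArg (fun k => σ X Z ≫ k ≫ σ Y Z) (right Z f)
      simp only [Category.assoc] at h₁
      rw [σσ, Category.comp_id, ← Category.assoc (σ X Z), σσ, Category.id_comp] at h₁
      exact h₁.symm
    hexagon_forward := forward
    hexagon_reverse := fun X Y Z => by
      change (α_ X Y Z).inv ≫ σ (X ⊗ Y) Z ≫ (α_ Z X Y).inv =
        X ◁ σ Y Z ≫ (α_ X Z Y).inv ≫ σ X Z ▷ Y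
      -- The reverse hexagon is the inverse of the forward one, read as an equation between
      -- isomorphisms.
      let τ (X Y : C) : X ⊗ Y ≅ Y ⊗ X := ⟨σ X Y, σ Y X, σσ X Y, σσ Y X⟩
      have h : α_ Z X Y ≪≫ τ Z (X ⊗ Y) ≪≫ α_ X Y Z =
        whiskerRightIso (τ Z X) Y ≪≫ α_ X Z Y ≪≫ whiskerLeftIso X (τ Z Y) := Iso.ext (forward Z X Y)
      have := congrArg Iso.inv h
      simpa using this
    symmetry := fun X Y => σσ X Y }

end StrictSMC

instance {S : Signature.{u, v}} (E : Theory S) : MonoidalCategory (FreeSMC E) :=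
  StrictSMC.monoidalCategory _

instance {S : Signature.{u, v}} (E : Theory S) : SymmetricCategory (FreeSMC E) :=
  StrictSMC.symmetricCategory _

namespace Diagram

variable {S : Signature.{u, v}} {E : Theory S}

theorem mk_idn (x : S.Obj) : mk E (Term.idn x) = mk E (Term.idWord [x]) :=
  (eq_of_heq (par_null (mk E (Term.idn x)))).symm

theorem sound {v w : List S.Obj} {s t : Term S v w} (h : TermRel E s t) : mk E s = mk E t :=
  Quotient.sound h

/-- The recursive definition pads the generating symmetry with identities and empty diagrams, which
have to be cancelled. -/
theorem mk_swapWord (x y : S.Obj) : mk E (Term.swapWord [x] [y]) = mk E (Term.swap x y) := by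
  have h₁ (c : Diagram E [x, y] [y, x]) : c.par (mk E Term.null) = c := eq_of_heq (par_null c)
  have h : mk E (Term.swapWord [x] [y]) =
      ((mk E (Term.idn x)).par (mk E (Term.idWord [y]))).seq
      (((((mk E (Term.swap x y)).par (mk E Term.null)).seq
        ((mk E (Term.idn y)).par (mk E (Term.idn x)))).par (mk E Term.null) :
          Diagram E [x, y] [y, x])) := rfl
  have h₂ : (mk E (Term.idWord [y])).par (mk E (Term.idWord [x])) = mk E (Term.idWord [y, x]) :=
    par_id _ _
  rw [h, h₁, h₁, mk_idn, mk_idn, par_id, h₂]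
  exact (id_seq _).trans (seq_id _)

end Diagram

/-! ### The Frobenius structures of the free category. -/

section FrobeniusFamily

variable (S : Signature.{u, v})

open Diagram

/-- The monoids of the free category. -/
instance frobMon (x : S.Obj) : MonObj (⟨[x]⟩ : FreeSMC (scFrob S)) where
  one := Diagram.mk (scFrob S) (Term.unit x)
  mul := Diagram.mk (scFrob S) (Term.mult x)
  one_mul := by
    change ((Diagram.mk (scFrob S) (Term.unit x)).par (Diagram.mk (scFrob S) (Term.idWord (S := S.addFrob) [x]))).seq
      (Diagram.mk (scFrob S) (Term.mult x)) = Diagram.mk (scFrob S) (Term.idWord (S := S.addFrob) [x])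
    rw [← mk_idn]
    exact sound (.ax (.unit_left x))
  mul_one := by
    change ((Diagram.mk (scFrob S) (Term.idWord (S := S.addFrob) [x])).par (Diagram.mk (scFrob S) (Term.unit x))).seq
      (Diagram.mk (scFrob S) (Term.mult x)) = Diagram.mk (scFrob S) (Term.idWord (S := S.addFrob) [x])
    rw [← mk_idn]
    exact sound (.ax (.unit_right x))
  mul_assoc := by
    change ((Diagram.mk (scFrob S) (Term.mult x)).par (Diagram.mk (scFrob S) (Term.idWord (S := S.addFrob) [x]))).seq
      (Diagram.mk (scFrob S) (Term.mult x)) = (Diagram.mk (scFrob S) (Term.idWord (S := S.addFrob) [x, x, x])).seq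
      (((Diagram.mk (scFrob S) (Term.idWord (S := S.addFrob) [x])).par (Diagram.mk (scFrob S) (Term.mult x))).seq
      (Diagram.mk (scFrob S) (Term.mult x)))
    -- The associator at one-letter words is definitionally the identity diagram on three wires.
    rw [id_seq, ← mk_idn]
    exact sound (.ax (.assoc x))

/-- The commutative monoids of the free category. -/
def frobObj (x : S.Obj) : CommMon (FreeSMC (scFrob S)) where
  X := ⟨[x]⟩
  comm :=
    { mul_comm := by
        change (Diagram.mk (scFrob S) (Term.swapWord (S := S.addFrob) [x] [x])).seq (Diagram.mk (scFrob S) (Term.mult x)) =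
          Diagram.mk (scFrob S) (Term.mult x)
        rw [mk_swapWord]
        exact sound (.ax (.comm x)) }

/-- The special commutative Frobenius structures of the free category. -/
def frobFamily : FrobFamily S.Obj (FreeSMC (scFrob S)) where
  obj := frobObj S
  comul x := Diagram.mk (scFrob S) (Term.comult x)
  counit x := Diagram.mk (scFrob S) (Term.counit x)
  comul_counit x := by
    change (Diagram.mk (scFrob S) (Term.comult x)).seq ((Diagram.mk (scFrob S) (Term.idWord (S := S.addFrob) [x])).par
      (Diagram.mk (scFrob S) (Term.counit x))) = Diagram.mk (scFrob S) (Term.idWord (S := S.addFrob) [x])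
    rw [← mk_idn]
    exact sound (.ax (.counit_right x))
  cocomm x := by
    change (Diagram.mk (scFrob S) (Term.comult x)).seq (Diagram.mk (scFrob S) (Term.swapWord (S := S.addFrob) [x] [x])) =
      Diagram.mk (scFrob S) (Term.comult x)
    rw [mk_swapWord]
    exact sound (.ax (.cocomm x))
  coassoc x := by
    change (Diagram.mk (scFrob S) (Term.comult x)).seq (((Diagram.mk (scFrob S) (Term.comult x)).par
      (Diagram.mk (scFrob S) (Term.idWord (S := S.addFrob) [x]))).seq (Diagram.mk (scFrob S) (Term.idWord (S := S.addFrob) [x, x, x]))) =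
      (Diagram.mk (scFrob S) (Term.comult x)).seq ((Diagram.mk (scFrob S) (Term.idWord (S := S.addFrob) [x])).par
      (Diagram.mk (scFrob S) (Term.comult x)))
    rw [← mk_idn]
    refine (congrArg _ (seq_id _)).trans ?_
    exact sound (.ax (.coassoc x))
  frobenius x := by
    change ((Diagram.mk (scFrob S) (Term.idWord (S := S.addFrob) [x])).par (Diagram.mk (scFrob S) (Term.comult x))).seq
      ((Diagram.mk (scFrob S) (Term.idWord (S := S.addFrob) [x, x, x])).seq ((Diagram.mk (scFrob S) (Term.mult x)).par
      (Diagram.mk (scFrob S) (Term.idWord (S := S.addFrob) [x])))) =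
      (Diagram.mk (scFrob S) (Term.mult x)).seq (Diagram.mk (scFrob S) (Term.comult x))
    rw [id_seq, ← mk_idn]
    exact (sound (.ax (.frobenius_right x))).symm
  special x := by
    change (Diagram.mk (scFrob S) (Term.comult x)).seq (Diagram.mk (scFrob S) (Term.mult x)) =
      Diagram.mk (scFrob S) (Term.idWord (S := S.addFrob) [x])
    rw [← mk_idn]
    exact sound (.ax (.special x))

end FrobeniusFamily

/-! ### Positions in a concatenation of words. -/

section AppendWords

/-- The positions of a concatenation of words. -/
def Cxt.appendTo {A : Type u} (l l' : List A) :
    (Cxt.word l).sum (Cxt.word l') ⟶ Cxt.word (l ++ l') :=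
  ⟨(OpenHypergraph.position l l').symm, fun i => by
    have := OpenHypergraph.get_position l l' ((OpenHypergraph.position l l').symm i)
    rw [Equiv.apply_symm_apply] at this
    exact this.symm⟩

/-- The positions of a concatenation of words, split into those of the two words. -/
def Cxt.appendOf {A : Type u} (l l' : List A) :
    Cxt.word (l ++ l') ⟶ (Cxt.word l).sum (Cxt.word l') :=
  ⟨OpenHypergraph.position l l', OpenHypergraph.get_position l l'⟩

theorem appendTo_appendOf {A : Type u} (l l' : List A) :
    Cxt.appendTo l l' ≫ Cxt.appendOf l l' = 𝟙 _ :=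
  Cxt.hom_ext fun i => (OpenHypergraph.position l l').apply_symm_apply i

theorem appendOf_appendTo {A : Type u} (l l' : List A) :
    Cxt.appendOf l l' ≫ Cxt.appendTo l l' = 𝟙 _ :=
  Cxt.hom_ext fun i => (OpenHypergraph.position l l').symm_apply_apply i

variable {C : Type u₁} [Category.{v₁} C] [MonoidalCategory C] [SymmetricCategory C]
  {A : Type u} (Φ : FrobFamily A C)

theorem copair_one_left {B Z : C} [MonObj B] (f : Z ⟶ B) :
    copair (MonObj.one : 𝟙_ _ ⟶ B) f = (λ_ Z).hom ≫ f := by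
  rw [copair, MonoidalCategory.tensorHom_def', Category.assoc, MonObj.one_mul,
    leftUnitor_naturality]

theorem copair_one_right {B Z : C} [MonObj B] (f : Z ⟶ B) :
    copair f (MonObj.one : 𝟙_ _ ⟶ B) = (ρ_ Z).hom ≫ f := by
  rw [copair, MonoidalCategory.tensorHom_def, Category.assoc, MonObj.mul_one,
    rightUnitor_naturality]

namespace FrobFamily

theorem consIso_hom_eq_copair (x : A) (l : List A) {Z : C} (i : Z ≅ (Φ.free (Cxt.word l)).X) :
    (Φ.consIso x l i).hom = copair ((Φ.varIso x).hom ≫ Φ.map (Cxt.inl _ _ ≫ Cxt.consTo x l))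
      (i.hom ≫ Φ.map (Cxt.inr _ _ ≫ Cxt.consTo x l)) := by
  rw [consIso_hom, split_inv_map, tensor_copair]

theorem copair_one_appendTo {l : List A} {Z : C} (i : Z ⟶ (Φ.free (Cxt.word l)).X)
    (j : 𝟙_ C ⟶ (Φ.free (Cxt.word [])).X) (hj : j = MonObj.one) :
    copair (j ≫ Φ.map (Cxt.inl _ _ ≫ Cxt.appendTo [] l))
      (i ≫ Φ.map (Cxt.inr _ _ ≫ Cxt.appendTo [] l)) = (λ_ Z).hom ≫ i := by
  have h : Cxt.inr (Cxt.word []) (Cxt.word l) ≫ Cxt.appendTo [] l = 𝟙 _ :=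
    Cxt.hom_ext fun i => Fin.ext (by simp [Cxt.appendTo, Cxt.inr, OpenHypergraph.position])
  rw [hj, IsMonHom.one_hom, copair_one_left, h]
  exact congrArg (_ ≫ i ≫ ·) (Φ.map_id _) |>.trans (by rw [Category.comp_id])

/-- The inductive step of `wordIso_append`, stated in a general category, where the associator is
not yet an identity. The three auxiliary equations trace the first letter, the rest of `l`, and `l'`
to their positions. -/
theorem copair_consIso_appendTo (x : A) {l l' : List A} {Z Z' : C}
    (i : Z ≅ (Φ.free (Cxt.word l)).X) (i' : Z' ⟶ (Φ.free (Cxt.word l')).X)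
    (k : Z ⊗ Z' ≅ (Φ.free (Cxt.word (l ++ l'))).X)
    (hk : k.hom = copair (i.hom ≫ Φ.map (Cxt.inl _ _ ≫ Cxt.appendTo l l'))
      (i' ≫ Φ.map (Cxt.inr _ _ ≫ Cxt.appendTo l l'))) :
    copair ((Φ.consIso x l i).hom ≫ Φ.map (Cxt.inl _ _ ≫ Cxt.appendTo (x :: l) l'))
      (i' ≫ Φ.map (Cxt.inr _ _ ≫ Cxt.appendTo (x :: l) l')) =
      (α_ _ _ _).hom ≫ (Φ.consIso x (l ++ l') k).hom := by
  have h₁ : (Cxt.inl _ _ ≫ Cxt.consTo x l) ≫ Cxt.inl _ _ ≫ Cxt.appendTo (x :: l) l' =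
      Cxt.inl _ _ ≫ Cxt.consTo x (l ++ l') :=
    Cxt.hom_ext fun i => Fin.ext (by simp [Cxt.appendTo, Cxt.inl, Cxt.consTo, Cxt.desc, OpenHypergraph.position])
  have h₂ : (Cxt.inr _ _ ≫ Cxt.consTo x l) ≫ Cxt.inl _ _ ≫ Cxt.appendTo (x :: l) l' =
      (Cxt.inl _ _ ≫ Cxt.appendTo l l') ≫ Cxt.inr _ _ ≫ Cxt.consTo x (l ++ l') :=
    Cxt.hom_ext fun i => Fin.ext (by simp [Cxt.appendTo, Cxt.inl, Cxt.inr, Cxt.consTo, Cxt.desc, OpenHypergraph.position])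
  have h₃ : Cxt.inr _ _ ≫ Cxt.appendTo (x :: l) l' =
      (Cxt.inr _ _ ≫ Cxt.appendTo l l') ≫ Cxt.inr _ _ ≫ Cxt.consTo x (l ++ l') :=
    Cxt.hom_ext fun i => Fin.ext (by simp [Cxt.appendTo, Cxt.inr, Cxt.consTo, Cxt.desc, OpenHypergraph.position]; omega)
  rw [consIso_hom_eq_copair, consIso_hom_eq_copair, hk, ← Iso.inv_comp_eq, copair_comp,
    copair_assoc, copair_comp]
  simp only [Category.assoc, ← map_comp]
  rw [← h₁, ← Category.assoc (Cxt.inl _ _) (Cxt.appendTo l l'), ← h₂,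
    ← Category.assoc (Cxt.inr _ _) (Cxt.appendTo l l'), ← h₃]
  simp only [Category.assoc]

end FrobFamily

end AppendWords

/-! ### Words as free objects on their positions. -/

section Words

variable (S : Signature.{u, v})

/-- A word, as an object of the free category, is a free object on its positions. -/
noncomputable def wordIso : (l : List S.Obj) →
    ((⟨l⟩ : FreeSMC (scFrob S)) ≅ ((frobFamily S).free (Cxt.word l)).X)
  | [] => (frobFamily S).nilIso
  | x :: l => (frobFamily S).consIso x l (wordIso l)

/-- `wordIso` is built letter by letter; this makes it monoidal and thereby handles parallel
composition and symmetries in `wordIso_denote`. -/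
theorem wordIso_append (l l' : List S.Obj) :
    (wordIso S (l ++ l')).hom =
      copair ((wordIso S l).hom ≫ (frobFamily S).map (Cxt.inl _ _ ≫ Cxt.appendTo l l'))
        ((wordIso S l').hom ≫ (frobFamily S).map (Cxt.inr _ _ ≫ Cxt.appendTo l l')) := by
  induction l with
  | nil =>
    have h := (frobFamily S).copair_one_appendTo (wordIso S l').hom _ (frobFamily S).nilIso_hom
    have h' : (λ_ (⟨l'⟩ : FreeSMC (scFrob S))).hom = 𝟙 _ := rfl
    rw [h', Category.id_comp] at h
    exact h.symm
  | cons x l ih =>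
    have h := (frobFamily S).copair_consIso_appendTo x (wordIso S l) (wordIso S l').hom
      (wordIso S (l ++ l')) ih
    refine Eq.trans ?_ h.symm
    -- The associator at words beginning with a letter is definitionally an identity.
    exact (Category.id_comp _).symm

end Words

/-! ### The morphism denoted by an open hypergraph. -/

section Denotation

variable {S : Signature.{u, v}}

/-- A list of variables, as a map from the positions of the word of its labels. -/
def Cxt.ofList {A : Type u} (N : Cxt A) (s : List N.pt) {l : List A}
    (h : s.map N.lab = l) : Cxt.word l ⟶ N :=
  ⟨fun i => s.get (i.cast (by rw [← h, List.length_map])), fun i => by subst h; simp⟩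

theorem Cxt.ofList_comp {A : Type u} {N P : Cxt A} (s : List N.pt) {l : List A}
    (h : s.map N.lab = l) (f : N ⟶ P) (h' : (s.map f.toFun).map P.lab = l) :
    Cxt.ofList N s h ≫ f = Cxt.ofList P (s.map f.toFun) h' :=
  Cxt.hom_ext fun i => by simp [Cxt.ofList]

/-- The nodes of a hypergraph as a context. -/
@[reducible]
def Hypergraph.cxt (G : Hypergraph S) : Cxt S.Obj := ⟨G.Node, G.nodeLabel, G.finite_node⟩

/-- The nodes of the left interface. -/
def OpenHypergraph.leftMap {v w : List S.Obj} (G : OpenHypergraph S v w) :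
    Cxt.word v ⟶ G.carrier.cxt := ⟨G.left.node, G.left.nodeLabel⟩

/-- The nodes of the right interface. -/
def OpenHypergraph.rightMap {v w : List S.Obj} (G : OpenHypergraph S v w) :
    Cxt.word w ⟶ G.carrier.cxt := ⟨G.right.node, G.right.nodeLabel⟩

variable {C : Type u₁} [Category.{v₁} C] [MonoidalCategory C] [SymmetricCategory C]
  (Φ : FrobFamily S.Obj C)
  (T : ∀ d : S.Op, 𝟙_ C ⟶ (Φ.free ((Cxt.word (S.arity d)).sum (Cxt.word (S.coarity d)))).X)

namespace FrobFamily

/-- An operation applied to lists of variables. -/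
noncomputable def edgeElt (N : Cxt S.Obj) (d : S.Op) (s t : List N.pt)
    (hs : s.map N.lab = S.arity d) (ht : t.map N.lab = S.coarity d) : 𝟙_ C ⟶ (Φ.free N).X :=
  T d ≫ Φ.map (Cxt.desc (Cxt.ofList N s hs) (Cxt.ofList N t ht))

theorem edgeElt_map {N P : Cxt S.Obj} (f : N ⟶ P) (d : S.Op) (s t : List N.pt)
    (hs : s.map N.lab = S.arity d) (ht : t.map N.lab = S.coarity d)
    (hs' : (s.map f.toFun).map P.lab = S.arity d)
    (ht' : (t.map f.toFun).map P.lab = S.coarity d) :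
    Φ.edgeElt T N d s t hs ht ≫ Φ.map f =
      Φ.edgeElt T P d (s.map f.toFun) (t.map f.toFun) hs' ht' := by
  rw [edgeElt, edgeElt, Category.assoc, ← map_comp, ← Cxt.ofList_comp s hs f,
    ← Cxt.ofList_comp t ht f]
  congr 2
  exact Cxt.hom_ext (by rintro (i | i) <;> rfl)

theorem edgeElt_congr {N : Cxt S.Obj} {d d' : S.Op} {s s' t t' : List N.pt} (h : d = d')
    (h₁ : s = s') (h₂ : t = t') (hs : s.map N.lab = S.arity d) (ht : t.map N.lab = S.coarity d)
    (hs' : s'.map N.lab = S.arity d') (ht' : t'.map N.lab = S.coarity d') :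
    Φ.edgeElt T N d s t hs ht = Φ.edgeElt T N d' s' t' hs' ht' := by
  subst h h₁ h₂
  rfl

/-- The conjunction of the hyperedges of a hypergraph. -/
noncomputable def edges (G : Hypergraph S) : 𝟙_ C ⟶ (Φ.free G.cxt).X :=
  ∏ᶠ e, Φ.edgeElt T G.cxt (G.edgeLabel e) (G.source e) (G.target e) (G.map_source e)
    (G.map_target e)

theorem edges_map {G : Hypergraph S} {P : Cxt S.Obj} (f : G.cxt ⟶ P) :
    Φ.edges T G ≫ Φ.map f = ∏ᶠ e, Φ.edgeElt T G.cxt (G.edgeLabel e) (G.source e) (G.target e)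
      (G.map_source e) (G.map_target e) ≫ Φ.map f := by
  have := G.finite_edge
  exact finprod_comp _ _

/-- The morphism defined by an open hypergraph. -/
noncomputable def den {v w : List S.Obj} (G : OpenHypergraph S v w) :
    (Φ.free (Cxt.word v)).X ⟶ (Φ.free (Cxt.word w)).X :=
  Φ.sem G.leftMap (Φ.edges T G.carrier) G.rightMap

/-- The product over hyperedges is reindexed along the bijection of edges, and the apex of the
cospan is replaced along the bijection of nodes by `sem_iso`. -/
theorem den_isIso {v w : List S.Obj} {G H : OpenHypergraph S v w}
    (h : OpenHypergraph.IsIso G H) : Φ.den T G = Φ.den T H := by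
  obtain ⟨n, e, hn, he, hs, ht, hl, hr⟩ := h.exists_equiv
  let f : G.carrier.cxt ⟶ H.carrier.cxt := ⟨n, hn⟩
  let g : H.carrier.cxt ⟶ G.carrier.cxt := ⟨n.symm, fun b =>
    (hn (n.symm b)).symm.trans (congrArg _ (n.apply_symm_apply b))⟩
  have h₁ : f ≫ g = 𝟙 _ := Cxt.hom_ext n.symm_apply_apply
  have h₂ : g ≫ f = 𝟙 _ := Cxt.hom_ext n.apply_symm_apply
  have h₃ : Φ.edges T G.carrier ≫ Φ.map f = Φ.edges T H.carrier := by
    rw [edges_map]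
    refine finprod_eq_of_bijective e e.bijective fun a => ?_
    refine (Φ.edgeElt_map T f _ _ _ _ _ ?_ ?_).trans
      (Φ.edgeElt_congr T (he a).symm (hs a).symm (ht a).symm _ _ _ _)
    · rw [← hs a, H.carrier.map_source, he]
    · rw [← ht a, H.carrier.map_target, he]
  rw [den, den, ← h₃, ← Φ.sem_iso _ _ _ f g h₁ h₂]
  congr 1
  · exact Cxt.hom_ext hl
  · exact Cxt.hom_ext hr

theorem finprod_sum {M α β : Type*} [CommMonoid M] [Finite α] [Finite β] (f : α ⊕ β → M) :
    ∏ᶠ a, f a = (∏ᶠ a, f (.inl a)) * ∏ᶠ b, f (.inr b) := by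
  have := Fintype.ofFinite α
  have := Fintype.ofFinite β
  rw [finprod_eq_prod_of_fintype, finprod_eq_prod_of_fintype, finprod_eq_prod_of_fintype,
    Fintype.prod_sum_type]

/-- The inclusion of the first carrier into a pushout. -/
def _root_.StringDiag.OpenHypergraph.pushoutInl {u v w : List S.Obj} (G : OpenHypergraph S u v)
    (H : OpenHypergraph S v w) : G.carrier.cxt ⟶ (OpenHypergraph.pushout G H).cxt :=
  ⟨fun n => Quot.mk _ (.inl n), fun _ => rfl⟩

/-- The inclusion of the second carrier into a pushout. -/
def _root_.StringDiag.OpenHypergraph.pushoutInr {u v w : List S.Obj} (G : OpenHypergraph S u v)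
    (H : OpenHypergraph S v w) : H.carrier.cxt ⟶ (OpenHypergraph.pushout G H).cxt :=
  ⟨fun n => Quot.mk _ (.inr n), fun _ => rfl⟩

/-- Equality in the quotient is the equivalence relation generated by the gluing, hence is contained
in every equivalence relation that identifies the glued nodes. The swap reconciles the order of
summands in `IsPush` with that in the quotient. -/
theorem _root_.StringDiag.OpenHypergraph.isPush {u v w : List S.Obj} (G : OpenHypergraph S u v)
    (H : OpenHypergraph S v w) :
    Cxt.IsPush G.rightMap H.leftMap (OpenHypergraph.pushoutInl G H)
      (OpenHypergraph.pushoutInr G H) where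
  w i := Quot.sound ⟨i⟩
  surj q := by
    induction q using Quot.ind with | _ q => ?_
    rcases q with n | n
    · exact ⟨.inr n, rfl⟩
    · exact ⟨.inl n, rfl⟩
  ker r hr h x y hxy := by
    have key (x y : G.carrier.Node ⊕ H.carrier.Node)
        (h' : Relation.EqvGen (OpenHypergraph.Glue G H) x y) : r x.swap y.swap := by
      induction h' with
      | rel x y h' =>
        obtain ⟨i⟩ := h'
        exact hr.symm (h i)
      | refl x => exact hr.refl _
      | symm x y _ ih => exact hr.symm ih
      | trans x y z _ _ ih ih' => exact hr.trans ih ih'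
    have hswap (x : H.carrier.Node ⊕ G.carrier.Node) :
        (Cxt.desc (OpenHypergraph.pushoutInr G H) (OpenHypergraph.pushoutInl G H)).toFun x =
          Quot.mk _ x.swap := by
      rcases x with x | x <;> rfl
    have h₁ := hswap x
    have h₂ := hswap y
    rw [hxy, h₂] at h₁
    have := key _ _ (Quot.eqvGen_exact h₁.symm)
    simpa using this

/-- The hyperedges of the pushout are those of both factors, so its formula is the conjunction that
`sem_comp` produces. -/
theorem den_comp {u v w : List S.Obj} (G : OpenHypergraph S u v) (H : OpenHypergraph S v w) :
    Φ.den T (OpenHypergraph.comp G H) = Φ.den T G ≫ Φ.den T H := by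
  have := G.carrier.finite_edge
  have := H.carrier.finite_edge
  have h : Φ.edges T (OpenHypergraph.pushout G H) =
      Φ.edges T G.carrier ≫ Φ.map (OpenHypergraph.pushoutInl G H) *
        Φ.edges T H.carrier ≫ Φ.map (OpenHypergraph.pushoutInr G H) := by
    rw [edges_map, edges_map]
    refine (finprod_sum _).trans ?_
    congr 2
    · funext e
      exact (Φ.edgeElt_map T (OpenHypergraph.pushoutInl G H) _ _ _ _ _ _ _).symm
    · funext e
      exact (Φ.edgeElt_map T (OpenHypergraph.pushoutInr G H) _ _ _ _ _ _ _).symm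
  rw [den, den, den, Φ.sem_comp (OpenHypergraph.isPush G H), ← h]
  rfl

theorem den_tensor {v w v' w' : List S.Obj} (G : OpenHypergraph S v w)
    (H : OpenHypergraph S v' w') :
    Φ.den T (OpenHypergraph.tensor G H) =
      Φ.map (Cxt.appendOf v v') ≫ (Φ.split _ _).hom ≫ (Φ.den T G ⊗ₘ Φ.den T H) ≫
        (Φ.split _ _).inv ≫ Φ.map (Cxt.appendTo w w') := by
  have := G.carrier.finite_edge
  have := H.carrier.finite_edge
  let K := OpenHypergraph.disjointUnion G.carrier H.carrier
  have h : Φ.edges T K =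
      Φ.edges T G.carrier ≫ Φ.map (Cxt.inl G.carrier.cxt H.carrier.cxt) *
        Φ.edges T H.carrier ≫ Φ.map (Cxt.inr G.carrier.cxt H.carrier.cxt) := by
    rw [edges_map, edges_map]
    refine (finprod_sum _).trans ?_
    congr 2
    · funext e
      exact (Φ.edgeElt_map T (Cxt.inl G.carrier.cxt H.carrier.cxt) _ _ _ _ _ _ _).symm
    · funext e
      exact (Φ.edgeElt_map T (Cxt.inr G.carrier.cxt H.carrier.cxt) _ _ _ _ _ _ _).symm
  have h₂ : Φ.den T (OpenHypergraph.tensor G H) =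
      Φ.sem (N := K.cxt) (Cxt.appendOf v v' ≫ Cxt.sumMap G.leftMap H.leftMap) (Φ.edges T K)
        (Cxt.appendOf w w' ≫ Cxt.sumMap G.rightMap H.rightMap) := by
    rw [den]
    congr 1
  rw [h₂, den, den, ← Category.assoc (_ ⊗ₘ _), sem_tensor, ← h]
  simp only [Category.assoc, Iso.hom_inv_id_assoc]
  rw [sem, sem, map_comp, ← comp_act, pull_comp,
    Φ.pull_eq_map _ _ (appendOf_appendTo w w') (appendTo_appendOf w w')]
  simp only [Category.assoc]

end FrobFamily

end Denotation

/-! ### Recovering a string diagram from its open hypergraph. -/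

section Faithful

namespace FrobFamily

variable {S : Signature.{u, v}} {C : Type u₁} [Category.{v₁} C] [MonoidalCategory C]
  [SymmetricCategory C] (Φ : FrobFamily S.Obj C)
  (T : ∀ d : S.Op, 𝟙_ C ⟶ (Φ.free ((Cxt.word (S.arity d)).sum (Cxt.word (S.coarity d)))).X)

/-- The discrete open hypergraph of a cospan of words. -/
@[reducible]
def _root_.StringDiag.OpenHypergraph.ofCospan {v w x : List S.Obj} (p : Cxt.word v ⟶ Cxt.word x)
    (q : Cxt.word w ⟶ Cxt.word x) : OpenHypergraph S v w where
  carrier := Hypergraph.discrete x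
  left := Hypergraph.ofDiscrete p.toFun p.lab_eq
  right := Hypergraph.ofDiscrete q.toFun q.lab_eq

theorem den_ofCospan {v w x : List S.Obj} (p : Cxt.word v ⟶ Cxt.word x)
    (q : Cxt.word w ⟶ Cxt.word x) :
    Φ.den T (OpenHypergraph.ofCospan p q) = Φ.map p ≫ Φ.pull q := by
  have h : Φ.edges T (Hypergraph.discrete x) = 1 := finprod_of_isEmpty (α := Empty) _
  change act (Φ.map p) (Φ.edges T (Hypergraph.discrete x)) ≫ Φ.pull q = _
  rw [h]
  exact congrArg (· ≫ _) (act_one _)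

theorem den_idn (w : List S.Obj) : Φ.den T (OpenHypergraph.idn w) = 𝟙 _ := by
  change Φ.den T (OpenHypergraph.ofCospan (𝟙 (Cxt.word w)) (𝟙 (Cxt.word w))) = _
  rw [den_ofCospan, map_id, pull_id, Category.id_comp]

/-- The right leg is a bijection of positions, so its inverse image is renaming along the inverse.
-/
theorem den_symm (v w : List S.Obj) : Φ.den T (OpenHypergraph.symm v w) =
    Φ.map (Cxt.appendOf v w) ≫ Φ.map (Cxt.desc (Cxt.inr _ _) (Cxt.inl _ _)) ≫
      Φ.map (Cxt.appendTo w v) := by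
  let f : Cxt.word (w ++ v) ⟶ Cxt.word (v ++ w) := ⟨_, OpenHypergraph.get_swapPosition v w⟩
  let g : Cxt.word (v ++ w) ⟶ Cxt.word (w ++ v) :=
    Cxt.appendOf v w ≫ Cxt.desc (Cxt.inr _ _) (Cxt.inl _ _) ≫ Cxt.appendTo w v
  have hf : f = Cxt.appendOf w v ≫ Cxt.desc (Cxt.inr _ _) (Cxt.inl _ _) ≫ Cxt.appendTo v w :=
    Cxt.hom_ext fun i => by
      change OpenHypergraph.swapPosition v w i = _
      simp only [OpenHypergraph.swapPosition, Equiv.trans_apply, Cxt.comp_toFun, Cxt.appendOf,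
        Cxt.appendTo]
      rcases OpenHypergraph.position w v i with j | j <;> rfl
  have hfg : f ≫ g = 𝟙 _ := by
    simp only [hf, g, Category.assoc]
    rw [reassoc_of% (appendTo_appendOf v w), ← Category.assoc (Cxt.desc _ _), swap_swap,
      Category.id_comp, appendOf_appendTo]
  have hgf : g ≫ f = 𝟙 _ := by
    simp only [hf, g, Category.assoc]
    rw [reassoc_of% (appendTo_appendOf w v), ← Category.assoc (Cxt.desc _ _), swap_swap,
      Category.id_comp, appendOf_appendTo]
  change Φ.den T (OpenHypergraph.ofCospan (𝟙 (Cxt.word (v ++ w))) f) = _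
  rw [den_ofCospan, map_id, Category.id_comp, Φ.pull_eq_map f g hfg hgf, map_comp, map_comp]

/-- There is one hyperedge, and its sources and targets enumerate all the nodes in order, so the
renaming of `T d` is an identity. -/
theorem den_ofOp (d : S.Op) : Φ.den T (OpenHypergraph.ofOp d) =
    Φ.sem (Cxt.inl _ _) (T d) (Cxt.inr _ _) := by
  have h : Φ.edges T (OpenHypergraph.opCarrier d) = T d := by
    refine (finprod_unique (α := Unit) _).trans ?_
    refine Eq.trans ?_ (Category.comp_id _)
    refine congrArg (T d ≫ ·) ?_
    rw [← map_id]
    refine congrArg Φ.map (Cxt.hom_ext ?_)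
    rintro (i | i) <;> simp [Cxt.desc, Cxt.ofList, OpenHypergraph.opCarrier] <;> rfl
  exact congrArg (Φ.sem (Cxt.inl (Cxt.word (S.arity d)) (Cxt.word (S.coarity d))) ·
    (Cxt.inr _ _)) h

/-- The naturality square of `wordIso` for a parallel composite, obtained from the squares of its
factors. -/
theorem append_square {V V' W W' : C} {v v' w w' : List S.Obj}
    {i : V ⟶ (Φ.free (Cxt.word v)).X} {i' : V' ⟶ (Φ.free (Cxt.word v')).X}
    {j : W ⟶ (Φ.free (Cxt.word w)).X} {j' : W' ⟶ (Φ.free (Cxt.word w')).X}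
    {k : V ⊗ V' ⟶ (Φ.free (Cxt.word (v ++ v'))).X} {l : W ⊗ W' ⟶ (Φ.free (Cxt.word (w ++ w'))).X}
    (hk : k = copair (i ≫ Φ.map (Cxt.inl _ _ ≫ Cxt.appendTo v v'))
      (i' ≫ Φ.map (Cxt.inr _ _ ≫ Cxt.appendTo v v')))
    (hl : l = copair (j ≫ Φ.map (Cxt.inl _ _ ≫ Cxt.appendTo w w'))
      (j' ≫ Φ.map (Cxt.inr _ _ ≫ Cxt.appendTo w w')))
    {c : V ⟶ W} {c' : V' ⟶ W'} {f : (Φ.free (Cxt.word v)).X ⟶ (Φ.free (Cxt.word w)).X}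
    {f' : (Φ.free (Cxt.word v')).X ⟶ (Φ.free (Cxt.word w')).X} (h : i ≫ f = c ≫ j)
    (h' : i' ≫ f' = c' ≫ j') :
    k ≫ Φ.map (Cxt.appendOf v v') ≫ (Φ.split _ _).hom ≫ (f ⊗ₘ f') ≫ (Φ.split _ _).inv ≫
      Φ.map (Cxt.appendTo w w') = (c ⊗ₘ c') ≫ l := by
  rw [hk, hl, ← tensor_copair, ← split_inv_map, ← tensor_copair, ← split_inv_map]
  simp only [Category.assoc]
  rw [← Category.assoc (Φ.map (Cxt.appendTo v v')), ← map_comp, appendTo_appendOf, map_id,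
    Category.id_comp, Iso.inv_hom_id_assoc, tensorHom_comp_tensorHom_assoc, h, h',
    tensorHom_comp_tensorHom_assoc]

theorem swap_square {V W : C} {v w : List S.Obj}
    {i : V ⟶ (Φ.free (Cxt.word v)).X} {j : W ⟶ (Φ.free (Cxt.word w)).X}
    {k : V ⊗ W ⟶ (Φ.free (Cxt.word (v ++ w))).X} {l : W ⊗ V ⟶ (Φ.free (Cxt.word (w ++ v))).X}
    (hk : k = copair (i ≫ Φ.map (Cxt.inl _ _ ≫ Cxt.appendTo v w))
      (j ≫ Φ.map (Cxt.inr _ _ ≫ Cxt.appendTo v w)))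
    (hl : l = copair (j ≫ Φ.map (Cxt.inl _ _ ≫ Cxt.appendTo w v))
      (i ≫ Φ.map (Cxt.inr _ _ ≫ Cxt.appendTo w v))) :
    k ≫ Φ.map (Cxt.appendOf v w) ≫ Φ.map (Cxt.desc (Cxt.inr _ _) (Cxt.inl _ _)) ≫
      Φ.map (Cxt.appendTo w v) = (β_ V W).hom ≫ l := by
  rw [hk, hl, ← tensor_copair, ← split_inv_map, ← tensor_copair, ← split_inv_map]
  simp only [Category.assoc]
  rw [← Category.assoc (Φ.map (Cxt.appendTo v w)), ← map_comp, appendTo_appendOf, map_id,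
    Category.id_comp, ← Category.assoc (Φ.split _ _).inv, split_inv_swap, Category.assoc,
    BraidedCategory.braiding_naturality_assoc]

/-- The variable of a one-letter word. -/
def _root_.StringDiag.Cxt.oneTo {A : Type u} (x : A) : Cxt.one x ⟶ Cxt.word [x] :=
  ⟨fun _ => (0 : Fin 1), fun _ => rfl⟩

/-- The position of a one-letter word. -/
def _root_.StringDiag.Cxt.oneOf {A : Type u} (x : A) : Cxt.word [x] ⟶ Cxt.one x :=
  ⟨fun _ => (), fun i => by obtain rfl : i = (0 : Fin 1) := Subsingleton.elim (α := Fin 1) _ _; rfl⟩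

theorem word_one_hom_ext {A : Type u} {x : A} {N : Cxt A} (f g : N ⟶ Cxt.word [x]) : f = g :=
  Cxt.hom_ext fun _ => Subsingleton.elim (α := Fin 1) _ _

theorem pull_oneOf (x : S.Obj) : Φ.pull (Cxt.oneOf x) = Φ.map (Cxt.oneTo x) :=
  Φ.pull_eq_map _ _ (word_one_hom_ext _ _) rfl

instance (x : S.Obj) : IsMonHom (Φ.varIso x).hom :=
  inferInstanceAs (IsMonHom (und (Φ.var (Cxt.one x) () rfl)))

theorem nilIso_map {x : S.Obj} (p : Cxt.word [] ⟶ Cxt.word [x]) :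
    Φ.nilIso.hom ≫ Φ.map p = MonObj.one ≫ (Φ.varIso x).hom ≫ Φ.map (Cxt.oneTo x) := by
  rw [nilIso_hom, IsMonHom.one_hom, ← Category.assoc, IsMonHom.one_hom, IsMonHom.one_hom]

theorem consIso_map {x : S.Obj} {i : (Φ.obj x).X ≅ (Φ.free (Cxt.word [x])).X}
    (hi : i.hom = (Φ.varIso x).hom ≫ Φ.map (Cxt.oneTo x)) (p : Cxt.word [x, x] ⟶ Cxt.word [x]) :
    (Φ.consIso x [x] i).hom ≫ Φ.map p =
      MonObj.mul ≫ (Φ.varIso x).hom ≫ Φ.map (Cxt.oneTo x) := by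
  rw [consIso_hom_eq_copair, copair_comp, hi]
  simp only [Category.assoc, ← map_comp]
  rw [word_one_hom_ext (_ ≫ _) (Cxt.oneTo x), word_one_hom_ext (_ ≫ _) (Cxt.oneTo x),
    IsMonHom.mul_hom_assoc, IsMonHom.mul_hom, tensorHom_comp_tensorHom_assoc]
  rfl

theorem varIso_pull_two {x : S.Obj} {i : (Φ.obj x).X ≅ (Φ.free (Cxt.word [x])).X}
    (hi : i.hom = (Φ.varIso x).hom ≫ Φ.map (Cxt.oneTo x)) (q : Cxt.word [x, x] ⟶ Cxt.word [x]) :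
    ((Φ.varIso x).hom ≫ Φ.map (Cxt.oneTo x)) ≫ Φ.pull q =
      Φ.comul x ≫ (Φ.consIso x [x] i).hom := by
  rw [consIso_hom_eq_copair, hi, Category.assoc, Category.assoc, ← map_comp, varIso_map,
    varIso_map, ← pull_oneOf, ← pull_comp]
  exact Φ.var_pull_pair (W := Cxt.word [x, x]) x (0 : Fin 2) (1 : Fin 2) rfl rfl
    (show ∀ c : Fin 2, c = 0 ∨ c = 1 by decide) _

theorem varIso_pull_nil {x : S.Obj} (q : Cxt.word [] ⟶ Cxt.word [x]) :
    ((Φ.varIso x).hom ≫ Φ.map (Cxt.oneTo x)) ≫ Φ.pull q = Φ.counit x ≫ Φ.nilIso.hom := by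
  let n : Cxt.word [] ⟶ Cxt.zero (A := S.Obj) :=
    ⟨fun n : Fin 0 => n.elim0, fun n : Fin 0 => n.elim0⟩
  have hn : Cxt.nilTo ≫ n = 𝟙 _ := Cxt.hom_ext fun n => Empty.elim n
  have hn' : n ≫ Cxt.nilTo = 𝟙 _ := Cxt.hom_ext fun n : Fin 0 => n.elim0
  have h : Φ.nilIso.hom = Φ.zeroIso.hom ≫ Φ.pull n :=
    congrArg (_ ≫ ·) (Φ.pull_eq_map _ _ hn' hn).symm
  rw [h, ← Category.assoc (Φ.counit x), ← Φ.var_pull_zero x (Cxt.nilTo ≫ q ≫ Cxt.oneOf x),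
    Category.assoc, Category.assoc, ← pull_comp, ← Category.assoc n, hn', Category.id_comp,
    pull_comp, pull_oneOf]

end FrobFamily

variable (S : Signature.{u, v})

open FrobFamily

theorem wordIso_one (x : S.Obj) : (wordIso S [x]).hom =
    (((frobFamily S).varIso x).hom ≫ (frobFamily S).map (Cxt.oneTo x) :
      ((frobFamily S).obj x).X ⟶ _) := by
  refine ((frobFamily S).consIso_hom_eq_copair x [] (wordIso S [])).trans ?_
  have h : (wordIso S []).hom = MonObj.one := (frobFamily S).nilIso_hom
  rw [h, IsMonHom.one_hom, copair_one_right]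
  exact Category.id_comp _

theorem exists_opElt (d : S.Op) : ∃ T : 𝟙_ (FreeSMC (scFrob S)) ⟶
    ((frobFamily S).free ((Cxt.word (S.arity d)).sum (Cxt.word (S.coarity d)))).X,
    (frobFamily S).sem (Cxt.inl _ _) T (Cxt.inr _ _) = (wordIso S (S.arity d)).inv ≫
      (Diagram.mk (scFrob S) (Term.op (S := S.addFrob) (.inl d)) :
        (⟨S.arity d⟩ : FreeSMC (scFrob S)) ⟶ ⟨S.coarity d⟩) ≫ (wordIso S (S.coarity d)).hom :=
  (frobFamily S).exists_sem_eq _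

/-- The predicate that defines an operation in the free category. -/
noncomputable def opElt (d : S.Op) : 𝟙_ (FreeSMC (scFrob S)) ⟶
    ((frobFamily S).free ((Cxt.word (S.arity d)).sum (Cxt.word (S.coarity d)))).X :=
  (exists_opElt S d).choose

/-- The morphism defined by an isomorphism class of open hypergraphs. -/
noncomputable def denote {v w : List S.Obj} (c : HypHom S v w) :
    ((frobFamily S).free (Cxt.word v)).X ⟶ ((frobFamily S).free (Cxt.word w)).X :=
  Quotient.lift ((frobFamily S).den (opElt S)) (fun _ _ h => den_isIso _ _ h) c

theorem denote_mk {v w : List S.Obj} (G : OpenHypergraph S v w) :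
    denote S (HypHom.mk G) = (frobFamily S).den (opElt S) G := rfl

theorem denote_comp {u v w : List S.Obj} (c : HypHom S u v) (d : HypHom S v w) :
    denote S (c.comp d) = denote S c ≫ denote S d := by
  induction c using Quotient.inductionOn
  induction d using Quotient.inductionOn
  exact den_comp _ _ _ _

theorem denote_tensor {v w v' w' : List S.Obj} (c : HypHom S v w) (d : HypHom S v' w') :
    denote S (c.tensor d) =
      (frobFamily S).map (Cxt.appendOf v v') ≫ ((frobFamily S).split _ _).hom ≫
        (denote S c ⊗ₘ denote S d) ≫ ((frobFamily S).split _ _).inv ≫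
        (frobFamily S).map (Cxt.appendTo w w') := by
  induction c using Quotient.inductionOn
  induction d using Quotient.inductionOn
  exact den_tensor _ _ _ _

/-- A generator is a one-node cospan with an identity leg. For `mult` and `unit` it is a renaming,
computed by `consIso_map` and `nilIso_map`; for `comult` and `counit` it is an inverse image,
computed by `varIso_pull_two` and `varIso_pull_nil`. -/
theorem wordIso_denote_frobOp (d : FrobOp S.Obj) :
    (wordIso S d.arity).hom ≫ denote S (HypHom.mk (.ofFrobOp d)) =
      (Diagram.mk (scFrob S) (Term.op (S := S.addFrob) (.inr d)) :
        (⟨d.arity⟩ : FreeSMC (scFrob S)) ⟶ ⟨d.coarity⟩) ≫ (wordIso S d.coarity).hom := by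
  have hright (x : S.Obj) {v : List S.Obj} (p : Cxt.word v ⟶ Cxt.word [x]) :
      (frobFamily S).den (opElt S) (OpenHypergraph.ofCospan p (𝟙 _)) = (frobFamily S).map p := by
    rw [den_ofCospan, pull_id, Category.comp_id]
  have hleft (x : S.Obj) {v : List S.Obj} (p : Cxt.word v ⟶ Cxt.word [x]) :
      (frobFamily S).den (opElt S) (OpenHypergraph.ofCospan (𝟙 _) p) = (frobFamily S).pull p := by
    rw [den_ofCospan, map_id, Category.id_comp]
  -- The constant leg of a spider at a one-letter interface is the identity, as there is only one
  -- position.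
  have hid (x : S.Obj) (h) :
      @Eq (Cxt.word [x] ⟶ Cxt.word [x]) ⟨fun _ => (0 : Fin 1), h⟩ (𝟙 _) :=
    word_one_hom_ext _ _
  cases d with
  | comult x =>
    let q : Cxt.word [x, x] ⟶ Cxt.word [x] := ⟨fun _ => (0 : Fin 1), by simp⟩
    have h : denote S (HypHom.mk (.ofFrobOp (.comult x))) = (frobFamily S).pull q := by
      rw [← hleft, ← hid x (by simp)]
      rfl
    refine (congrArg (_ ≫ ·) h).trans ?_
    refine (congrArg (· ≫ _) (wordIso_one S x)).trans ?_
    exact (frobFamily S).varIso_pull_two (i := wordIso S [x]) (wordIso_one S x) q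
  | counit x =>
    let q : Cxt.word [] ⟶ Cxt.word [x] := ⟨fun _ => (0 : Fin 1), by simp⟩
    have h : denote S (HypHom.mk (.ofFrobOp (.counit x))) = (frobFamily S).pull q := by
      rw [← hleft, ← hid x (by simp)]
      rfl
    refine (congrArg (_ ≫ ·) h).trans ?_
    refine (congrArg (· ≫ _) (wordIso_one S x)).trans ?_
    exact (frobFamily S).varIso_pull_nil q
  | mult x =>
    let p : Cxt.word [x, x] ⟶ Cxt.word [x] := ⟨fun _ => (0 : Fin 1), by simp⟩
    have h : denote S (HypHom.mk (.ofFrobOp (.mult x))) = (frobFamily S).map p := by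
      rw [← hright, ← hid x (by simp)]
      rfl
    refine (congrArg (_ ≫ ·) h).trans ?_
    refine Eq.trans ?_ (congrArg (_ ≫ ·) (wordIso_one S x)).symm
    exact (frobFamily S).consIso_map (i := wordIso S [x]) (wordIso_one S x) p
  | unit x =>
    let p : Cxt.word [] ⟶ Cxt.word [x] := ⟨fun _ => (0 : Fin 1), by simp⟩
    have h : denote S (HypHom.mk (.ofFrobOp (.unit x))) = (frobFamily S).map p := by
      rw [← hright, ← hid x (by simp)]
      rfl
    refine (congrArg (_ ≫ ·) h).trans ?_
    refine Eq.trans ?_ (congrArg (_ ≫ ·) (wordIso_one S x)).symm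
    exact (frobFamily S).nilIso_map p

theorem wordIso_denote_op (d : S.Op) :
    (wordIso S (S.arity d)).hom ≫ denote S (HypHom.mk (.ofOp d)) =
      (Diagram.mk (scFrob S) (Term.op (S := S.addFrob) (.inl d)) :
        (⟨S.arity d⟩ : FreeSMC (scFrob S)) ⟶ ⟨S.coarity d⟩) ≫ (wordIso S (S.coarity d)).hom := by
  rw [denote_mk, den_ofOp, opElt, (exists_opElt S d).choose_spec, Iso.hom_inv_id_assoc]

theorem denote_idn (w : List S.Obj) : denote S (HypHom.mk (.idn w)) = 𝟙 _ :=
  den_idn _ _ _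

/-- Structural induction; each constructor is a naturality square already available. For operations
of the signature the square holds because `opElt` was chosen to represent them. -/
theorem wordIso_denote : {v w : List S.Obj} → (t : Term S.addFrob v w) →
    (wordIso S v).hom ≫ denote S (interp S t) =
      (Diagram.mk (scFrob S) t : (⟨v⟩ : FreeSMC (scFrob S)) ⟶ ⟨w⟩) ≫ (wordIso S w).hom
  | _, _, .op (Sum.inl d) => wordIso_denote_op S d
  | _, _, .op (Sum.inr d) => wordIso_denote_frobOp S d
  | _, _, .idn x => by
    have h : (Diagram.mk (scFrob S) (Term.idn (S := S.addFrob) x) :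
        (⟨[x]⟩ : FreeSMC (scFrob S)) ⟶ ⟨[x]⟩) = 𝟙 (⟨[x]⟩ : FreeSMC (scFrob S)) :=
      Diagram.mk_idn (S := S.addFrob) x
    rw [h, Category.id_comp]
    exact (congrArg (_ ≫ ·) (denote_idn S [x])).trans (Category.comp_id _)
  | _, _, .swap x y => by
    have h : (Diagram.mk (scFrob S) (Term.swap (S := S.addFrob) x y) :
        (⟨[x, y]⟩ : FreeSMC (scFrob S)) ⟶ ⟨[y, x]⟩) =
          (β_ (⟨[x]⟩ : FreeSMC (scFrob S)) ⟨[y]⟩).hom := (Diagram.mk_swapWord _ _).symm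
    rw [h]
    exact (congrArg (_ ≫ ·) (den_symm _ (opElt S) [x] [y])).trans
      ((frobFamily S).swap_square (wordIso_append S [x] [y]) (wordIso_append S [y] [x]))
  | _, _, .null =>
    (congrArg (_ ≫ ·) (denote_idn S [])).trans
      ((Category.comp_id _).trans (Category.id_comp _).symm)
  | _, _, .seq c d => by
    have h₁ := wordIso_denote c
    have h₂ := wordIso_denote d
    refine (congrArg (_ ≫ ·) (denote_comp S (interp S c) (interp S d))).trans ?_
    rw [← Category.assoc, h₁, Category.assoc, h₂, ← Category.assoc]
    rfl
  | _, _, .par (v₁ := v₁) (v₂ := v₂) (w₁ := w₁) (w₂ := w₂) c d =>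
    (congrArg (_ ≫ ·) (denote_tensor S (interp S c) (interp S d))).trans
      ((frobFamily S).append_square (wordIso_append S v₁ v₂) (wordIso_append S w₁ w₂)
        (wordIso_denote c) (wordIso_denote d))

/-- Equal interpretations have equal denotations, and the isomorphisms `wordIso` can be cancelled.
-/
theorem mk_eq_of_interp_eq {v w : List S.Obj} {s t : Term S.addFrob v w}
    (h : interp S s = interp S t) : Diagram.mk (scFrob S) s = Diagram.mk (scFrob S) t := by
  have h₁ := wordIso_denote S s
  rw [h, wordIso_denote S t] at h₁
  exact ((cancel_mono (wordIso S w).hom).mp h₁).symm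

end Faithful

/-! ### The interpretation respects the laws of string diagrams. -/

section Soundness

variable (S : Signature.{u, v})

instance : MonoidalCategory (Hyp S) := StrictSMC.monoidalCategory _

instance : SymmetricCategory (Hyp S) := StrictSMC.symmetricCategory _

theorem interp_idWord : (w : List S.Obj) →
    interp S (Term.idWord (S := S.addFrob) w) = HypHom.mk (.idn w)
  | [] => rfl
  | x :: w => (congrArg (HypHom.tensor _) (interp_idWord w)).trans
      (OpenHypergraph.cls_eq (OpenHypergraph.tensor_idn_idn [x] w))

/-- Crossing the wires of `w` one by one is the hexagon law `symm_tensor` of open hypergraphs, whose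
intermediate object equality is here definitional. -/
theorem interp_swapWire (x : S.Obj) : (w : List S.Obj) →
    interp S (Term.swapWire (S := S.addFrob) x w) = HypHom.mk (.symm [x] w)
  | [] => OpenHypergraph.cls_eq (OpenHypergraph.isIso_of_equiv (Equiv.refl (Fin 1)) (Equiv.refl _)
      (fun _ => rfl) (fun a => a.elim) (fun a => a.elim) (fun a => a.elim) (fun _ => rfl)
      (fun _ => Subsingleton.elim (α := Fin 1) _ _))
  | y :: w => by
    have h := eq_of_heq (StrictSMC.symm_tensor (⟨[x]⟩ : Hyp S) ⟨[y]⟩ ⟨w⟩)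
    refine Eq.trans ?_ h.symm
    have h' : eqToHom (StrictSMC.tensorObj_assoc (⟨[y]⟩ : Hyp S) ⟨[x]⟩ ⟨w⟩) = 𝟙 _ := rfl
    rw [h', Category.id_comp]
    have e : interp S (Term.swapWire (S := S.addFrob) x (y :: w)) =
        HypHom.comp (HypHom.tensor (HypHom.mk (.symm [x] [y]))
          (interp S (Term.idWord (S := S.addFrob) w)))
        (HypHom.tensor (v₁ := [y]) (w₁ := [y]) (v₂ := [x] ++ w) (w₂ := w ++ [x])
          (HypHom.mk (.idn [y])) (interp S (Term.swapWire (S := S.addFrob) x w))) := rfl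
    rw [e, interp_idWord, interp_swapWire]
    rfl

theorem interp_cast {v v' w w' : List S.Obj} (hv : v = v') (hw : w = w')
    (t : Term S.addFrob v w) : HEq (interp S (t.cast hv hw)) (interp S t) := by
  subst hv hw
  rfl

theorem interp_cast_right {v w w' : List S.Obj} (hw : w = w') (t : Term S.addFrob v w) :
    (interp S (t.cast rfl hw) : (⟨v⟩ : Hyp S) ⟶ ⟨w'⟩) =
      (interp S t : (⟨v⟩ : Hyp S) ⟶ ⟨w⟩) ≫ eqToHom (congrArg Hyp.mk hw) := by
  subst hw
  exact (Category.comp_id (X := (⟨v⟩ : Hyp S)) (Y := ⟨w⟩) _).symm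

theorem mk_symm_nil (w : List S.Obj) : HEq (HypHom.mk (S := S) (.symm [] w))
    (HypHom.mk (S := S) (.idn w)) := by
  refine OpenHypergraph.cls_heq rfl (List.append_nil w) (Equiv.refl (Fin w.length)) (Equiv.refl _)
    (fun _ => rfl) (fun a => a.elim) (fun a => a.elim) (fun a => a.elim) (fun _ => rfl) fun i => ?_
  obtain ⟨i, rfl⟩ := (OpenHypergraph.position w []).symm.surjective i
  rcases i with i | i
  · refine Fin.ext ?_
    have h : OpenHypergraph.swapPosition [] w ((OpenHypergraph.position w []).symm (.inl i)) =
        (OpenHypergraph.position [] w).symm (.inr i) := by simp [OpenHypergraph.swapPosition]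
    refine (congrArg Fin.val h).trans ?_
    rw [OpenHypergraph.position_symm_inr]
    refine (Nat.zero_add _).trans ?_
    exact (OpenHypergraph.position_symm_inl w [] i).symm
  · exact i.elim0

theorem interp_swapWord : (v w : List S.Obj) →
    interp S (Term.swapWord (S := S.addFrob) v w) = HypHom.mk (.symm v w)
  | [], w => eq_of_heq ((interp_cast S _ _ _).trans
      ((heq_of_eq (interp_idWord S w)).trans (mk_symm_nil S w).symm))
  | x :: v, w => by
    have h := BraidedCategory.hexagon_reverse (⟨[x]⟩ : Hyp S) ⟨v⟩ ⟨w⟩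
    have h₁ : (α_ (⟨[x]⟩ : Hyp S) ⟨v⟩ ⟨w⟩).inv = 𝟙 _ := rfl
    have h₂ : (α_ (⟨[x]⟩ : Hyp S) ⟨w⟩ ⟨v⟩).inv = 𝟙 _ := rfl
    rw [h₁, h₂, Category.id_comp, Category.id_comp, Iso.comp_inv_eq] at h
    refine Eq.trans ?_ h.symm
    have e : interp S (Term.swapWord (S := S.addFrob) (x :: v) w) =
        HypHom.comp (HypHom.tensor (v₁ := [x]) (w₁ := [x]) (v₂ := v ++ w) (w₂ := w ++ v)
          (HypHom.mk (.idn [x])) (interp S (Term.swapWord (S := S.addFrob) v w)))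
        (interp S (Term.cast rfl (List.append_assoc w [x] v) (Term.par (S := S.addFrob)
          (v₁ := [x] ++ w) (Term.swapWire (S := S.addFrob) x w)
          (Term.idWord (S := S.addFrob) v)))) := rfl
    rw [e, interp_swapWord]
    refine Eq.trans (congrArg (HypHom.comp _) (interp_cast_right S _ _)) ?_
    have e' : interp S (Term.par (S := S.addFrob) (v₁ := [x] ++ w) (Term.swapWire (S := S.addFrob) x w)
        (Term.idWord (S := S.addFrob) v)) = HypHom.tensor (v₁ := [x] ++ w) (w₁ := w ++ [x])
        (interp S (Term.swapWire (S := S.addFrob) x w))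
        (interp S (Term.idWord (S := S.addFrob) v)) := rfl
    rw [e', interp_idWord, interp_swapWire]
    exact (HypHom.assoc _ _ _).symm

/-- An open hypergraph with a single node, labelled with `x`, and no hyperedges. -/
def OpenHypergraph.IsPoint {S : Signature.{u, v}} {v w : List S.Obj} (x : S.Obj)
    (G : OpenHypergraph S v w) : Prop :=
  IsEmpty G.carrier.Edge ∧ ∃ n, G.carrier.nodeLabel n = x ∧ ∀ m, m = n

variable {S}

namespace OpenHypergraph

/-- Maps into a one-element set are unique, so the interfaces carry no information. Each Frobenius
axiom reduces to the claim that both of its sides have a single node and no hyperedges. -/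
theorem IsPoint.cls_eq {v w : List S.Obj} {x : S.Obj} {G H : OpenHypergraph S v w}
    (hG : G.IsPoint x) (hH : H.IsPoint x) : cls G = cls H := by
  obtain ⟨_, n, hn, hn'⟩ := hG
  obtain ⟨_, m, hm, hm'⟩ := hH
  have : Unique G.carrier.Node := ⟨⟨n⟩, hn'⟩
  have : Unique H.carrier.Node := ⟨⟨m⟩, hm'⟩
  refine OpenHypergraph.cls_eq (isIso_of_equiv (Equiv.ofUnique _ _) (Equiv.equivOfIsEmpty _ _)
    (fun a => ?_) isEmptyElim isEmptyElim isEmptyElim (fun _ => Subsingleton.elim _ _)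
    (fun _ => Subsingleton.elim _ _))
  rw [hm' (Equiv.ofUnique _ _ a), hn' a, hm, hn]

theorem isPoint_spider (x : S.Obj) (v w : List S.Obj) (hv hw) : (spider x v w hv hw).IsPoint x :=
  ⟨inferInstanceAs (IsEmpty Empty), (0 : Fin 1), rfl, fun _ => Subsingleton.elim (α := Fin 1) _ _⟩

theorem isPoint_idn (x : S.Obj) : (idn (S := S) [x]).IsPoint x :=
  ⟨inferInstanceAs (IsEmpty Empty), (0 : Fin 1), rfl, fun _ => Subsingleton.elim (α := Fin 1) _ _⟩

/-- Every node of the second factor is glued to the single node of the first. -/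
theorem IsPoint.comp_left {u v w : List S.Obj} {x : S.Obj} {G : OpenHypergraph S u v}
    {H : OpenHypergraph S v w} (h : G.IsPoint x) (hH : IsEmpty H.carrier.Edge)
    (hs : Function.Surjective H.left.node) : (comp G H).IsPoint x := by
  obtain ⟨hG, n, hn, hn'⟩ := h
  refine ⟨inferInstanceAs (IsEmpty (_ ⊕ _)), Quot.mk _ (.inl n), hn, ?_⟩
  rintro ⟨m | m⟩
  · rw [hn' m]
  · obtain ⟨i, rfl⟩ := hs m
    rw [← hn' (G.right.node i)]
    exact (Quot.sound (Glue.glue i)).symm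

theorem IsPoint.comp_right {u v w : List S.Obj} {x : S.Obj} {G : OpenHypergraph S u v}
    {H : OpenHypergraph S v w} (h : H.IsPoint x) (hG : IsEmpty G.carrier.Edge)
    (hs : Function.Surjective G.right.node) : (comp G H).IsPoint x := by
  obtain ⟨hH, n, hn, hn'⟩ := h
  refine ⟨inferInstanceAs (IsEmpty (_ ⊕ _)), Quot.mk _ (.inr n), hn, ?_⟩
  rintro ⟨m | m⟩
  · obtain ⟨i, rfl⟩ := hs m
    rw [← hn' (H.left.node i)]
    exact Quot.sound (Glue.glue i)
  · rw [hn' m]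

theorem left_surjective_tensor {v w v' w' : List S.Obj} {G : OpenHypergraph S v w}
    {H : OpenHypergraph S v' w'} (hG : Function.Surjective G.left.node)
    (hH : Function.Surjective H.left.node) : Function.Surjective (tensor G H).left.node :=
  (hG.sumMap hH).comp (position v v').surjective

theorem right_surjective_tensor {v w v' w' : List S.Obj} {G : OpenHypergraph S v w}
    {H : OpenHypergraph S v' w'} (hG : Function.Surjective G.right.node)
    (hH : Function.Surjective H.right.node) : Function.Surjective (tensor G H).right.node :=
  (hG.sumMap hH).comp (position w w').surjective

theorem spider_left_surjective (x a : S.Obj) (v w : List S.Obj) (hv hw) :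
    Function.Surjective (spider x (a :: v) w hv hw).left.node :=
  fun _ => ⟨(0 : Fin (v.length + 1)), Subsingleton.elim (α := Fin 1) _ _⟩

theorem spider_right_surjective (x a : S.Obj) (v w : List S.Obj) (hv hw) :
    Function.Surjective (spider x v (a :: w) hv hw).right.node :=
  fun _ => ⟨(0 : Fin (w.length + 1)), Subsingleton.elim (α := Fin 1) _ _⟩

/-- Neither factor is a single point, so the previous criteria do not apply. The four nodes are
connected by the gluings at the three middle wires, numbered 0, 1 and 2. -/
theorem isPoint_frobenius_left (x : S.Obj) (hv hw hv' hw') :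
    (comp (tensor (spider x [x] [x, x] hv hw) (idn [x]))
      (tensor (v₁ := [x]) (v₂ := [x, x]) (idn [x]) (spider x [x, x] [x] hv' hw'))).IsPoint x := by
  refine ⟨inferInstanceAs (IsEmpty ((Empty ⊕ Empty) ⊕ (Empty ⊕ Empty))),
    Quot.mk _ (.inl (.inl (0 : Fin 1))), rfl, ?_⟩
  have g (i : Fin 3) := Quot.sound (Glue.glue
    (G := tensor (spider x [x] [x, x] hv hw) (idn [x]))
    (H := tensor (v₁ := [x]) (v₂ := [x, x]) (idn [x]) (spider x [x, x] [x] hv' hw')) i)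
  have z (m : Fin 1) : m = 0 := Subsingleton.elim _ _
  rintro ⟨(m | m) | (m | m)⟩ <;> obtain rfl := z m
  · rfl
  · exact (g 2).trans ((g 1).symm)
  · exact (g 0).symm
  · exact (g 1).symm

theorem isPoint_frobenius_right (x : S.Obj) (hv hw hv' hw') :
    (comp (tensor (w₁ := [x]) (w₂ := [x, x]) (idn [x]) (spider x [x] [x, x] hv hw))
      (tensor (v₁ := [x, x]) (v₂ := [x]) (spider x [x, x] [x] hv' hw') (idn [x]))).IsPoint x := by
  refine ⟨inferInstanceAs (IsEmpty ((Empty ⊕ Empty) ⊕ (Empty ⊕ Empty))),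
    Quot.mk _ (.inl (.inl (0 : Fin 1))), rfl, ?_⟩
  have g (i : Fin 3) := Quot.sound (Glue.glue
    (G := tensor (w₁ := [x]) (w₂ := [x, x]) (idn [x]) (spider x [x] [x, x] hv hw))
    (H := tensor (v₁ := [x, x]) (v₂ := [x]) (spider x [x, x] [x] hv' hw') (idn [x])) i)
  have z (m : Fin 1) : m = 0 := Subsingleton.elim _ _
  rintro ⟨(m | m) | (m | m)⟩ <;> obtain rfl := z m
  · rfl
  · exact (g 1).trans ((g 0).symm)
  · exact (g 0).symm
  · exact (g 2).symm.trans ((g 1).trans (g 0).symm)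

end OpenHypergraph

open OpenHypergraph in
theorem interp_scFrob {v w : List S.Obj} {s t : Term S.addFrob v w} (h : scFrob S v w s t) :
    interp S s = interp S t := by
  have hi (w : List S.Obj) : Function.Surjective (idn (S := S) w).left.node :=
    Function.surjective_id
  have hi' (w : List S.Obj) : Function.Surjective (idn (S := S) w).right.node :=
    Function.surjective_id
  have he : IsEmpty (Empty ⊕ Empty) := inferInstance
  have pδ (x : S.Obj) : IsPoint (v := [x]) (w := [x, x]) x (ofFrobOp (S := S) (.comult x)) :=
    isPoint_spider x [x] [x, x] (by simp) (by simp)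
  have pμ (x : S.Obj) : IsPoint (v := [x, x]) (w := [x]) x (ofFrobOp (S := S) (.mult x)) :=
    isPoint_spider x [x, x] [x] (by simp) (by simp)
  have sδ (x : S.Obj) : Function.Surjective
      (left (v := [x]) (w := [x, x]) (ofFrobOp (S := S) (.comult x))).node :=
    spider_left_surjective x x [] [x, x] (by simp) (by simp)
  have sε (x : S.Obj) : Function.Surjective
      (left (v := [x]) (w := []) (ofFrobOp (S := S) (.counit x))).node :=
    spider_left_surjective x x [] [] (by simp) (by simp)
  have sμ (x : S.Obj) : Function.Surjective
      (right (v := [x, x]) (w := [x]) (ofFrobOp (S := S) (.mult x))).node :=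
    spider_right_surjective x x [x, x] [] (by simp) (by simp)
  have sη (x : S.Obj) : Function.Surjective
      (right (v := []) (w := [x]) (ofFrobOp (S := S) (.unit x))).node :=
    spider_right_surjective x x [] [] (by simp) (by simp)
  cases h with
  | coassoc x =>
    exact IsPoint.cls_eq
      ((pδ x).comp_left he
        (left_surjective_tensor (sδ x) (hi [x])))
      ((pδ x).comp_left he
        (left_surjective_tensor (hi [x]) (sδ x)))
  | counit_left x =>
    exact IsPoint.cls_eq
      ((pδ x).comp_left he
        (left_surjective_tensor (sε x) (hi [x])))
      (isPoint_idn x)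
  | counit_right x =>
    exact IsPoint.cls_eq
      ((pδ x).comp_left he
        (left_surjective_tensor (hi [x]) (sε x)))
      (isPoint_idn x)
  | cocomm x =>
    exact IsPoint.cls_eq
      ((pδ x).comp_left (inferInstanceAs (IsEmpty Empty))
        (Function.surjective_id)) (pδ x)
  | assoc x =>
    exact IsPoint.cls_eq
      ((pμ x).comp_right he
        (right_surjective_tensor (sμ x) (hi' [x])))
      ((pμ x).comp_right he
        (right_surjective_tensor (hi' [x]) (sμ x)))
  | unit_left x =>
    exact IsPoint.cls_eq
      ((pμ x).comp_right he
        (right_surjective_tensor (sη x) (hi' [x])))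
      (isPoint_idn x)
  | unit_right x =>
    exact IsPoint.cls_eq
      ((pμ x).comp_right he
        (right_surjective_tensor (hi' [x]) (sη x)))
      (isPoint_idn x)
  | comm x =>
    exact IsPoint.cls_eq
      ((pμ x).comp_right (inferInstanceAs (IsEmpty Empty))
        (swapPosition [x] [x]).surjective) (pμ x)
  | frobenius_left x =>
    exact IsPoint.cls_eq (isPoint_frobenius_left x (by simp) (by simp) (by simp) (by simp))
      ((pμ x).comp_left (inferInstanceAs (IsEmpty Empty))
        (sδ x))
  | frobenius_right x =>
    exact IsPoint.cls_eq
      ((pμ x).comp_left (inferInstanceAs (IsEmpty Empty))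
        (sδ x)) (isPoint_frobenius_right x (by simp) (by simp) (by simp) (by simp))
  | special x =>
    exact IsPoint.cls_eq
      ((pδ x).comp_left (inferInstanceAs (IsEmpty Empty))
        (spider_left_surjective x x [x] [x] (by simp) (by simp))) (isPoint_idn x)

theorem interp_sound {v w : List S.addFrob.Obj} {s t : Term S.addFrob v w}
    (h : TermRel (scFrob S) s t) : interp S s = interp S t := by
  induction h with
  | ax h => exact interp_scFrob h
  | refl t => rfl
  | symm _ ih => exact ih.symm
  | trans _ _ ih ih' => exact ih.trans ih'
  | seq_congr _ _ ih ih' => exact congrArg₂ HypHom.comp ih ih'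
  | par_congr _ _ ih ih' => exact congrArg₂ HypHom.tensor ih ih'
  | seq_assoc a b c => exact HypHom.assoc _ _ _
  | id_seq c => exact (congrArg (HypHom.comp · _) (interp_idWord S _)).trans (HypHom.id_comp _)
  | seq_id c => exact (congrArg (HypHom.comp _) (interp_idWord S _)).trans (HypHom.comp_id _)
  | interchange c₁ d₁ c₂ d₂ =>
    exact StrictSMC.tensorHom_comp (C := Hyp S) (X₁ := ⟨_⟩) (X₂ := ⟨_⟩) (Y₁ := ⟨_⟩) (Y₂ := ⟨_⟩)
      (Z₁ := ⟨_⟩) (Z₂ := ⟨_⟩) (interp S c₁) (interp S d₁) (interp S c₂) (interp S d₂)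
  | par_assoc c₁ c₂ c₃ =>
    exact eq_of_heq ((interp_cast S _ _ _).trans
      (StrictSMC.tensorHom_assoc (C := Hyp S) (X₁ := ⟨_⟩) (X₂ := ⟨_⟩) (X₃ := ⟨_⟩) (Y₁ := ⟨_⟩)
        (Y₂ := ⟨_⟩) (Y₃ := ⟨_⟩) (interp S c₁) (interp S c₂) (interp S c₃)))
  | null_par c =>
    exact eq_of_heq (StrictSMC.unit_tensorHom (C := Hyp S) (X := ⟨_⟩) (Y := ⟨_⟩) (interp S c))
  | par_null c =>
    exact eq_of_heq ((interp_cast S _ _ _).trans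
      (StrictSMC.tensorHom_unit (C := Hyp S) (X := ⟨_⟩) (Y := ⟨_⟩) (interp S c)))
  | swap_natural u c =>
    refine (congrArg₂ HypHom.comp (congrArg (HypHom.tensor · _) (interp_idWord S u))
      (interp_swapWord S u _)).trans (Eq.trans ?_ (congrArg₂ HypHom.comp (interp_swapWord S u _)
      (congrArg (HypHom.tensor _) (interp_idWord S u))).symm)
    exact StrictSMC.symm_natural (C := Hyp S) ⟨u⟩ (Y := ⟨_⟩) (Z := ⟨_⟩) (interp S c)
  | swap_swap v w =>
    refine (congrArg₂ HypHom.comp (interp_swapWord S v w) (interp_swapWord S w v)).trans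
      (Eq.trans ?_ (interp_idWord S (v ++ w)).symm)
    exact OpenHypergraph.symm_symm (S := S) v w

end Soundness

/-! ### Maps of words as interpretations of terms. -/

section Fullness

variable {S : Signature.{u, v}}

namespace OpenHypergraph

/-- A criterion for an open hypergraph to be a composite. -/
theorem comp_isIso {u v w : List S.Obj} {G : OpenHypergraph S u v} {H : OpenHypergraph S v w}
    {K : OpenHypergraph S u w} (f : G.carrier.Node ⊕ H.carrier.Node → K.carrier.Node)
    (c : K.carrier.Node → G.carrier.Node ⊕ H.carrier.Node)
    (e : G.carrier.Edge ⊕ H.carrier.Edge ≃ K.carrier.Edge)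
    (hf : ∀ i, f (.inl (G.right.node i)) = f (.inr (H.left.node i)))
    (hc : ∀ k, f (c k) = k)
    (hx : ∀ x, Quot.mk (Glue G H) (c (f x)) = Quot.mk (Glue G H) x)
    (hn : ∀ x, K.carrier.nodeLabel (f x) = Sum.elim G.carrier.nodeLabel H.carrier.nodeLabel x)
    (he : ∀ a, K.carrier.edgeLabel (e a) = (pushout G H).edgeLabel a)
    (hs : ∀ a, K.carrier.source (e (.inl a)) = (G.carrier.source a).map (fun n => f (.inl n)))
    (hs' : ∀ a, K.carrier.source (e (.inr a)) = (H.carrier.source a).map (fun n => f (.inr n)))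
    (ht : ∀ a, K.carrier.target (e (.inl a)) = (G.carrier.target a).map (fun n => f (.inl n)))
    (ht' : ∀ a, K.carrier.target (e (.inr a)) = (H.carrier.target a).map (fun n => f (.inr n)))
    (hl : ∀ i, f (.inl (G.left.node i)) = K.left.node i)
    (hr : ∀ i, f (.inr (H.right.node i)) = K.right.node i) : IsIso (comp G H) K := by
  let n : Quot (Glue G H) ≃ K.carrier.Node :=
    { toFun := Quot.lift f (by rintro _ _ ⟨i⟩; exact hf i)
      invFun := fun k => Quot.mk _ (c k)
      left_inv := by rintro ⟨x⟩; exact hx x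
      right_inv := hc }
  refine isIso_of_equiv n e ?_ he ?_ ?_ hl hr
  · rintro ⟨x⟩
    rw [show n (Quot.mk _ x) = f x from rfl, hn]
  · rintro (a | a)
    · refine (hs a).trans (Eq.trans ?_ (List.map_map (l := G.carrier.source a)).symm)
      rfl
    · refine (hs' a).trans (Eq.trans ?_ (List.map_map (l := H.carrier.source a)).symm)
      rfl
  · rintro (a | a)
    · refine (ht a).trans (Eq.trans ?_ (List.map_map (l := G.carrier.target a)).symm)
      rfl
    · refine (ht' a).trans (Eq.trans ?_ (List.map_map (l := H.carrier.target a)).symm)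
      rfl

/-- Every node on the middle interface of the cospan is glued to a node of `G`, so no new node
appears; in contrast to `wiring_comp`, `p` need not be bijective. -/
theorem cowiring_comp {u v w : List S.Obj} (p : Cxt.word u ⟶ Cxt.word v)
    (G : OpenHypergraph S v w) :
    IsIso (comp (ofCospan p (𝟙 _)) G) (reindexLeft G p.toFun p.lab_eq) := by
  refine comp_isIso (Sum.elim G.left.node id) Sum.inr (Equiv.emptySum Empty _) (fun _ => rfl)
    (fun _ => rfl) ?_ ?_ ?_ ?_ ?_ ?_ ?_ (fun _ => rfl) (fun _ => rfl)
  · rintro (i | a)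
    · exact (Quot.sound (Glue.glue (G := ofCospan p (𝟙 _)) (H := G) i)).symm
    · rfl
  · rintro (i | a)
    · exact G.left.nodeLabel i
    · rfl
  · rintro (a | a)
    · exact a.elim
    · rfl
  · exact fun a => a.elim
  · exact fun a => (List.map_id _).symm
  · exact fun a => a.elim
  · exact fun a => (List.map_id _).symm

/-- Juxtaposition of maps between words. -/
def _root_.StringDiag.Cxt.append {A : Type u} {v w v' w' : List A} (p : Cxt.word v ⟶ Cxt.word w)
    (p' : Cxt.word v' ⟶ Cxt.word w') : Cxt.word (v ++ v') ⟶ Cxt.word (w ++ w') :=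
  Cxt.appendOf v v' ≫ Cxt.sumMap p p' ≫ Cxt.appendTo w w'

theorem tensor_ofCospan {v w x v' w' x' : List S.Obj} (p : Cxt.word v ⟶ Cxt.word x)
    (q : Cxt.word w ⟶ Cxt.word x) (p' : Cxt.word v' ⟶ Cxt.word x')
    (q' : Cxt.word w' ⟶ Cxt.word x') :
    IsIso (tensor (ofCospan p q) (ofCospan p' q')) (ofCospan (Cxt.append p p') (Cxt.append q q')) := by
  refine isIso_of_equiv (position x x').symm (Equiv.sumEmpty Empty Empty) ?_ ?_ ?_ ?_ ?_ ?_
  · exact (Cxt.appendTo x x').lab_eq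
  · rintro (a | a) <;> exact a.elim
  · rintro (a | a) <;> exact a.elim
  · rintro (a | a) <;> exact a.elim
  · exact fun _ => rfl
  · exact fun _ => rfl

end OpenHypergraph

open OpenHypergraph

theorem append_id {A : Type u} (v w : List A) :
    Cxt.append (𝟙 (Cxt.word v)) (𝟙 (Cxt.word w)) = 𝟙 _ := by
  have h : Cxt.sumMap (𝟙 (Cxt.word v)) (𝟙 (Cxt.word w)) = 𝟙 _ :=
    Cxt.hom_ext (by rintro (_ | _) <;> rfl)
  rw [Cxt.append, h, Category.id_comp, appendOf_appendTo]

/-- The class of open hypergraphs that are interpretations of terms. -/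
def Definable {v w : List S.Obj} (c : HypHom S v w) : Prop :=
  ∃ t : Term S.addFrob v w, interp S t = c

theorem Definable.comp {u v w : List S.Obj} {c : HypHom S u v} {d : HypHom S v w}
    (hc : Definable c) (hd : Definable d) : Definable (c.comp d) := by
  obtain ⟨s, rfl⟩ := hc
  obtain ⟨t, rfl⟩ := hd
  exact ⟨s.seq t, rfl⟩

theorem Definable.tensor {v w v' w' : List S.Obj} {c : HypHom S v w} {d : HypHom S v' w'}
    (hc : Definable c) (hd : Definable d) : Definable (c.tensor d) := by
  obtain ⟨s, rfl⟩ := hc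
  obtain ⟨t, rfl⟩ := hd
  exact ⟨s.par t, rfl⟩

theorem definable_idn (w : List S.Obj) : Definable (HypHom.mk (S := S) (.idn w)) :=
  ⟨_, interp_idWord S w⟩

/-- The maps between words both of whose discrete open hypergraphs are interpretations of terms. -/
def DefinableMap (S : Signature.{u, v}) {v w : List S.Obj} (f : Cxt.word v ⟶ Cxt.word w) : Prop :=
  Definable (HypHom.mk (S := S) (ofCospan f (𝟙 _))) ∧
    Definable (HypHom.mk (S := S) (ofCospan (𝟙 _) f))

namespace DefinableMap

theorem id (v : List S.Obj) : DefinableMap S (𝟙 (Cxt.word v)) :=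
  ⟨definable_idn v, definable_idn v⟩

theorem comp {u v w : List S.Obj} {f : Cxt.word u ⟶ Cxt.word v} {g : Cxt.word v ⟶ Cxt.word w}
    (hf : DefinableMap S f) (hg : DefinableMap S g) : DefinableMap S (f ≫ g) := by
  constructor
  · have h := hf.1.comp hg.1
    rwa [show HypHom.comp (HypHom.mk (S := S) (ofCospan f (𝟙 _))) (HypHom.mk (ofCospan g (𝟙 _))) =
      HypHom.mk (ofCospan (f ≫ g) (𝟙 _)) from cls_eq (cowiring_comp _ _)] at h
  · have h := hg.2.comp hf.2
    rwa [show HypHom.comp (HypHom.mk (S := S) (ofCospan (𝟙 _) g)) (HypHom.mk (ofCospan (𝟙 _) f)) =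
      HypHom.mk (ofCospan (𝟙 _) (f ≫ g)) from
        cls_eq (comp_wiring (ofCospan (𝟙 _) g) f.toFun f.lab_eq)] at h

theorem append {v w v' w' : List S.Obj} {f : Cxt.word v ⟶ Cxt.word w}
    {g : Cxt.word v' ⟶ Cxt.word w'} (hf : DefinableMap S f) (hg : DefinableMap S g) :
    DefinableMap S (Cxt.append f g) := by
  constructor
  · have h := hf.1.tensor hg.1
    rw [show HypHom.tensor (HypHom.mk (S := S) (ofCospan f (𝟙 _)))
      (HypHom.mk (ofCospan g (𝟙 _))) = _ from cls_eq (tensor_ofCospan _ _ _ _), append_id] at h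
    exact h
  · have h := hf.2.tensor hg.2
    rw [show HypHom.tensor (HypHom.mk (S := S) (ofCospan (𝟙 _) f))
      (HypHom.mk (ofCospan (𝟙 _) g)) = _ from cls_eq (tensor_ofCospan _ _ _ _), append_id] at h
    exact h

theorem swap (x y : S.Obj) : DefinableMap S (v := [y, x]) (w := [x, y])
    ⟨swapPosition [x] [y], get_swapPosition [x] [y]⟩ := by
  constructor
  · refine ⟨Term.swap (S := S.addFrob) y x, ?_⟩
    -- The permutation sits on the left leg here and on the right leg in the symmetry; the
    -- permutation itself, applied to the nodes, relates the two.
    refine OpenHypergraph.cls_eq (isIso_of_equiv (swapPosition [x] [y]) (Equiv.refl _)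
      (get_swapPosition [x] [y]) (fun a => a.elim) (fun a => a.elim) (fun a => a.elim)
      (fun _ => rfl) ?_)
    exact (swapPosition [y] [x]).symm_apply_apply
  · exact ⟨Term.swap (S := S.addFrob) x y, rfl⟩

theorem isPoint_ofCospan {v w : List S.Obj} {x : S.Obj} (p : Cxt.word v ⟶ Cxt.word [x])
    (q : Cxt.word w ⟶ Cxt.word [x]) : (ofCospan p q).IsPoint x :=
  ⟨inferInstanceAs (IsEmpty Empty), (0 : Fin 1), rfl, fun _ => Subsingleton.elim (α := Fin 1) _ _⟩

theorem fold {x : S.Obj} (f : Cxt.word [x, x] ⟶ Cxt.word [x]) : DefinableMap S f :=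
  ⟨⟨Term.mult x, (isPoint_spider x [x, x] [x] (by simp) (by simp)).cls_eq (isPoint_ofCospan _ _)⟩,
    ⟨Term.comult x,
      (isPoint_spider x [x] [x, x] (by simp) (by simp)).cls_eq (isPoint_ofCospan _ _)⟩⟩

theorem init {x : S.Obj} (f : Cxt.word [] ⟶ Cxt.word [x]) : DefinableMap S f :=
  ⟨⟨Term.unit x, (isPoint_spider x [] [x] (by simp) (by simp)).cls_eq (isPoint_ofCospan _ _)⟩,
    ⟨Term.counit x,
      (isPoint_spider x [x] [] (by simp) (by simp)).cls_eq (isPoint_ofCospan _ _)⟩⟩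

end DefinableMap

/-- The map out of a nonempty word with a given value at the first position. -/
def Cxt.cons {A : Type u} {x : A} {l : List A} {N : Cxt A} (n : N.pt)
    (hn : N.lab n = x) (f : Cxt.word l ⟶ N) : Cxt.word (x :: l) ⟶ N :=
  ⟨fun i => Fin.cases (n := l.length) (motive := fun _ => N.pt) n f.toFun i, fun i =>
    Fin.cases (n := l.length) (motive := fun i => N.lab (Fin.cases (n := l.length)
      (motive := fun _ => N.pt) n f.toFun i) = (x :: l).get i) hn f.lab_eq i⟩

theorem cons_hom_ext {A : Type u} {x : A} {l : List A} {N : Cxt A} {f g : Cxt.word (x :: l) ⟶ N}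
    (h : f.toFun (0 : Fin (l.length + 1)) = g.toFun (0 : Fin (l.length + 1)))
    (h' : ∀ i : Fin l.length, f.toFun (Fin.succ i) = g.toFun (Fin.succ i)) : f = g :=
  Cxt.hom_ext fun i => Fin.cases (n := l.length) (motive := fun i => f.toFun i = g.toFun i) h h' i

/-- Maps between words are compared through the numerical values of positions, which avoids casts
between `Fin` types. -/
theorem append_val_left {A : Type u} {v w v' w' : List A} (f : Cxt.word v ⟶ Cxt.word w)
    (g : Cxt.word v' ⟶ Cxt.word w') (i : Fin (v ++ v').length) (h : i.val < v.length) :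
    ((Cxt.append f g).toFun i).val = (f.toFun ⟨i, h⟩).val := by
  change ((position w w').symm (Sum.map f.toFun g.toFun (position v v' i))).val = _
  have hi : position v v' i = .inl ⟨i, h⟩ := by
    rw [← Equiv.eq_symm_apply]
    exact Fin.ext (position_symm_inl v v' ⟨i, h⟩).symm
  rw [hi, Sum.map_inl, position_symm_inl]

theorem append_val_right {A : Type u} {v w v' w' : List A} (f : Cxt.word v ⟶ Cxt.word w)
    (g : Cxt.word v' ⟶ Cxt.word w') (i : Fin (v ++ v').length) (j : Fin v'.length)
    (h : i.val = v.length + j.val) :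
    ((Cxt.append f g).toFun i).val = w.length + (g.toFun j).val := by
  change ((position w w').symm (Sum.map f.toFun g.toFun (position v v' i))).val = _
  obtain rfl : i = (position v v').symm (.inr j) :=
    Fin.ext (h.trans (position_symm_inr v v' j).symm)
  rw [Equiv.apply_symm_apply, Sum.map_inr, position_symm_inr]

theorem cons_id_val {A : Type u} {x : A} {l : List A} (k : Fin l.length) (hk : l.get k = x)
    (i : Fin (l.length + 1)) : ((Cxt.cons (N := Cxt.word l) k hk (𝟙 _)).toFun i).val =
      if i.val = 0 then k.val else i.val - 1 :=
  Fin.cases (n := l.length) (motive := fun i => ((Cxt.cons (N := Cxt.word l) k hk (𝟙 _)).toFun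
    i).val = if i.val = 0 then k.val else i.val - 1) rfl (fun _ => rfl) i

/-- Merges one extra letter at the front with position `k`. If `k` is zero this is a fold beside
identities; otherwise the extra letter is first moved past the head of the word, and the
construction is repeated on the tail. -/
theorem definableMap_cons_id : {w : List S.Obj} → {x : S.Obj} → (k : Fin w.length) →
    (hk : w.get k = x) → DefinableMap S (Cxt.cons (N := Cxt.word w) k hk (𝟙 _))
  | y :: w, x, ⟨0, h⟩, hk => by
    obtain rfl : y = x := hk
    let f : Cxt.word [y, y] ⟶ Cxt.word [y] := ⟨fun _ => (0 : Fin 1), by simp⟩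
    refine cast (congrArg (DefinableMap S) (Cxt.hom_ext fun i => Fin.ext ?_))
      (DefinableMap.append (DefinableMap.fold f) (DefinableMap.id w))
    refine Eq.trans ?_ (cons_id_val (l := y :: w) ⟨0, h⟩ rfl i).symm
    by_cases h₁ : i.val < 2
    · refine (append_val_left f (𝟙 (Cxt.word w)) i h₁).trans ?_
      change 0 = if i.val = 0 then 0 else i.val - 1
      split_ifs <;> omega
    · have hi : i.val < w.length + 2 := i.2
      refine (append_val_right f (𝟙 (Cxt.word w)) i ⟨i.val - 2, by omega⟩
        (by change _ = 2 + (i.val - 2); omega)).trans ?_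
      change 1 + (i.val - 2) = if i.val = 0 then 0 else i.val - 1
      split_ifs <;> omega
  | y :: w, x, ⟨k + 1, h⟩, hk => by
    have hk' : w.get ⟨k, by simpa using h⟩ = x := hk
    let f : Cxt.word [x, y] ⟶ Cxt.word [y, x] :=
      ⟨swapPosition [y] [x], get_swapPosition [y] [x]⟩
    let g : Cxt.word (x :: w) ⟶ Cxt.word w := Cxt.cons (N := Cxt.word w) _ hk' (𝟙 _)
    have hf (i : Fin 2) : (f.toFun i).val = 1 - i.val := by
      fin_cases i <;> rfl
    have h₁ (i : Fin (w.length + 2)) : ((Cxt.append f (𝟙 (Cxt.word w))).toFun i).val =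
        if i.val < 2 then 1 - i.val else i.val := by
      split_ifs with hi
      · exact (append_val_left f (𝟙 (Cxt.word w)) i hi).trans (hf ⟨i, hi⟩)
      · refine (append_val_right f (𝟙 (Cxt.word w)) i ⟨i.val - 2, by omega⟩
          (by change _ = 2 + (i.val - 2); omega)).trans ?_
        change 2 + (i.val - 2) = i.val
        omega
    have h₂ (i : Fin (w.length + 2)) : ((Cxt.append (𝟙 (Cxt.word [y])) g).toFun i).val =
        if i.val < 1 then i.val else 1 + if i.val - 1 = 0 then k else i.val - 1 - 1 := by
      split_ifs with hi hi'
      · exact append_val_left (𝟙 (Cxt.word [y])) g i hi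
      · exact (append_val_right (𝟙 (Cxt.word [y])) g i (⟨i.val - 1, by omega⟩ : Fin (w.length + 1))
          (by change _ = 1 + (i.val - 1); omega)).trans
          (congrArg (1 + ·) ((cons_id_val _ hk' _).trans (if_pos hi')))
      · exact (append_val_right (𝟙 (Cxt.word [y])) g i (⟨i.val - 1, by omega⟩ : Fin (w.length + 1))
          (by change _ = 1 + (i.val - 1); omega)).trans
          (congrArg (1 + ·) ((cons_id_val _ hk' _).trans (if_neg hi')))
    refine cast (congrArg (DefinableMap S) (Cxt.hom_ext fun i => Fin.ext ?_))
      (DefinableMap.comp (DefinableMap.append (DefinableMap.swap y x) (DefinableMap.id w))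
      (DefinableMap.append (DefinableMap.id [y]) (definableMap_cons_id _ hk')))
    refine (h₂ ((Cxt.append f (𝟙 (Cxt.word w))).toFun i)).trans
      (Eq.trans ?_ (cons_id_val (l := y :: w) ⟨k + 1, h⟩ hk i).symm)
    rw [h₁]
    change _ = if i.val = 0 then k + 1 else i.val - 1
    split_ifs <;> omega

theorem definableMap_nil : (w : List S.Obj) → (f : Cxt.word [] ⟶ Cxt.word w) → DefinableMap S f
  | [], f => by
    rw [show f = 𝟙 _ from Cxt.hom_ext fun i : Fin 0 => i.elim0]
    exact .id _
  | x :: w, f => by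
    let g : Cxt.word [] ⟶ Cxt.word w := ⟨fun i : Fin 0 => i.elim0, fun i : Fin 0 => i.elim0⟩
    let h : Cxt.word [] ⟶ Cxt.word [x] := ⟨fun i : Fin 0 => i.elim0, fun i : Fin 0 => i.elim0⟩
    have := DefinableMap.append (DefinableMap.init h) (definableMap_nil w g)
    rwa [show f = Cxt.append h g from Cxt.hom_ext fun i : Fin 0 => i.elim0]

/-- Induction on the source: apply the restriction of `f` to the tail beside an identity wire, then
merge that wire with the value of `f` at the first letter. -/
theorem definableMap : {v w : List S.Obj} → (f : Cxt.word v ⟶ Cxt.word w) → DefinableMap S f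
  | [], w, f => definableMap_nil w f
  | x :: v, w, f => by
    let g : Cxt.word v ⟶ Cxt.word w :=
      ⟨fun i => f.toFun (Fin.succ i : Fin (v.length + 1)),
        fun i => f.lab_eq (Fin.succ i : Fin (v.length + 1))⟩
    refine cast (congrArg (DefinableMap S) (cons_hom_ext ?_ fun i => ?_)) (DefinableMap.comp
      (DefinableMap.append (DefinableMap.id [x]) (definableMap g)) (definableMap_cons_id
        (f.toFun (0 : Fin (v.length + 1))) (f.lab_eq (0 : Fin (v.length + 1)))))
    · have h : (Cxt.append (𝟙 (Cxt.word [x])) g).toFun (0 : Fin (v.length + 1)) =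
          (0 : Fin (w.length + 1)) :=
        Fin.ext (append_val_left (𝟙 (Cxt.word [x])) g (0 : Fin (v.length + 1)) Nat.zero_lt_one)
      exact congrArg (Cxt.Hom.toFun (Cxt.cons (N := Cxt.word w) (f.toFun (0 : Fin (v.length + 1)))
        (f.lab_eq (0 : Fin (v.length + 1))) (𝟙 _))) h
    · have h : (Cxt.append (𝟙 (Cxt.word [x])) g).toFun (Fin.succ i : Fin (v.length + 1)) =
          (Fin.succ (g.toFun i : Fin w.length) : Fin (w.length + 1)) := by
        refine Fin.ext ((append_val_right (𝟙 (Cxt.word [x])) g _ i ?_).trans ?_)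
        · exact Nat.add_comm _ _
        · exact Nat.add_comm _ _
      exact congrArg (Cxt.Hom.toFun (Cxt.cons (N := Cxt.word w) (f.toFun (0 : Fin (v.length + 1)))
        (f.lab_eq (0 : Fin (v.length + 1))) (𝟙 _))) h

end Fullness

/-! ### Attaching hyperedges, and the definability of all open hypergraphs. -/

section Edges

variable {S : Signature.{u, v}}

open OpenHypergraph

theorem map_ofList_finRange {A : Type u} (N : Cxt A) (s : List N.pt) {l : List A}
    (h : s.map N.lab = l) : (List.finRange l.length).map (Cxt.ofList N s h).toFun = s := by
  subst h
  refine List.ext_getElem (by simp) fun i h₁ h₂ => ?_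
  simp [Cxt.ofList]

namespace OpenHypergraph

/-- The open hypergraph on the positions of a word with given hyperedges, both of whose interfaces
are identities. -/
@[reducible]
def onWord (L : List S.Obj) (E : Type) (fin : Finite E) (d : E → S.Op)
    (s t : E → List (Fin L.length)) (hs : ∀ e, (s e).map L.get = S.arity (d e))
    (ht : ∀ e, (t e).map L.get = S.coarity (d e)) : OpenHypergraph S L L where
  carrier :=
    { Node := Fin L.length
      Edge := E
      finite_node := inferInstance
      finite_edge := fin
      nodeLabel := L.get
      edgeLabel := d
      source := s
      target := t
      map_source := hs
      map_target := ht }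
  left := Hypergraph.ofDiscrete id fun _ => rfl
  right := Hypergraph.ofDiscrete id fun _ => rfl

/-- A hyperedge whose targets are positions of a word and whose sources are free. -/
@[reducible]
def freeSources (L : List S.Obj) (d : S.Op) (t : List (Fin L.length))
    (ht : t.map L.get = S.coarity d) : OpenHypergraph S (L ++ S.arity d) L where
  carrier :=
    { Node := Fin L.length ⊕ Fin (S.arity d).length
      Edge := Unit
      finite_node := inferInstance
      finite_edge := inferInstance
      nodeLabel := Sum.elim L.get (S.arity d).get
      edgeLabel _ := d
      source _ := (List.finRange _).map .inr
      target _ := t.map .inl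
      map_source _ := by simp [Function.comp_def]
      map_target _ := by rw [List.map_map]; exact ht }
  left := Hypergraph.ofDiscrete (position L (S.arity d)) (get_position L (S.arity d))
  right := Hypergraph.ofDiscrete .inl fun _ => rfl

/-- The operation is placed beside the wires of `L`, and its targets are merged into `L` by the map
that is the identity on `L` and `t` on the targets. -/
theorem comp_freeSources (L : List S.Obj) (d : S.Op) (t : List (Fin L.length))
    (ht : t.map L.get = S.coarity d) :
    IsIso (comp (tensor (idn L) (ofOp d)) (ofCospan
      (Cxt.appendOf L (S.coarity d) ≫ Cxt.desc (𝟙 _) (Cxt.ofList (Cxt.word L) t ht)) (𝟙 _)))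
      (freeSources L d t ht) := by
  let p := Cxt.ofList (Cxt.word L) t ht
  have g (j : Fin L.length ⊕ Fin (S.coarity d).length) :
      Quot.mk (Glue (tensor (idn L) (ofOp d)) (ofCospan (Cxt.appendOf L (S.coarity d) ≫
        Cxt.desc (𝟙 _) p) (𝟙 _))) (.inl (Sum.map id .inr j)) =
      Quot.mk _ (.inr ((Cxt.desc (𝟙 (Cxt.word L)) p).toFun j)) := by
    obtain ⟨i, rfl⟩ := (position L (S.coarity d)).surjective j
    exact Quot.sound (Glue.glue i)
  have h₃ {α β γ δ : Type} (f : α → β) (g : β → γ) (h : γ → δ) (l : List α) :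
      ((l.map f).map g).map h = l.map fun a => h (g (f a)) := by
    rw [List.map_map, List.map_map]
    rfl
  let F : (Fin L.length ⊕ (Fin (S.arity d).length ⊕ Fin (S.coarity d).length)) ⊕ Fin L.length →
      Fin L.length ⊕ Fin (S.arity d).length :=
    Sum.elim (Sum.elim .inl (Sum.elim .inr fun b => .inl (p.toFun b))) .inl
  refine comp_isIso F
    (Sum.elim .inr fun a => .inl (.inr (.inl a)))
    ((Equiv.sumEmpty (Empty ⊕ Unit) Empty).trans (Equiv.emptySum Empty Unit)) ?_ ?_ ?_ ?_ ?_ ?_ ?_ ?_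
      ?_ ?_ ?_
  · intro i
    change F (Sum.inl (Sum.map id Sum.inr (position L (S.coarity d) i))) =
      Sum.inl ((Cxt.desc (𝟙 (Cxt.word L)) p).toFun (position L (S.coarity d) i))
    rcases position L (S.coarity d) i with j | j <;> rfl
  · rintro (l | a) <;> rfl
  · rintro ((l | (a | b)) | l)
    · exact (g (.inl l)).symm
    · rfl
    · exact (g (.inr b)).symm
    · rfl
  · rintro ((l | (a | b)) | l)
    · rfl
    · rfl
    · exact p.lab_eq b
    · rfl
  · rintro ((a | a) | a)
    · exact a.elim
    · rfl
    · exact a.elim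
  · rintro (a | a)
    · exact a.elim
    · exact (h₃ Sum.inl Sum.inr (fun n => F (.inl n)) (List.finRange _)).symm
  · exact fun a => a.elim
  · rintro (a | a)
    · exact a.elim
    · exact (congrArg (List.map _) (map_ofList_finRange (Cxt.word L) t ht).symm).trans
        (List.map_map.trans (h₃ Sum.inr Sum.inr (fun n => F (.inl n)) (List.finRange _)).symm)
  · exact fun a => a.elim
  · intro i
    change F (Sum.inl (Sum.map id Sum.inl (position L (S.arity d) i))) =
      position L (S.arity d) i
    rcases position L (S.arity d) i with j | j <;> rfl
  · exact fun _ => rfl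

/-- The reversed cospan duplicates the wires of `L` that serve as sources and feeds the copies to
the free source ports. -/
theorem comp_onWord_unit (L : List S.Obj) (d : S.Op) (s t : List (Fin L.length))
    (hs : s.map L.get = S.arity d) (ht : t.map L.get = S.coarity d) :
    IsIso (comp (ofCospan (𝟙 _) (Cxt.appendOf L (S.arity d) ≫
      Cxt.desc (𝟙 _) (Cxt.ofList (Cxt.word L) s hs))) (freeSources L d t ht))
      (onWord L Unit inferInstance (fun _ => d) (fun _ => s) (fun _ => t) (fun _ => hs)
        fun _ => ht) := by
  let p := Cxt.ofList (Cxt.word L) s hs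
  have g (j : Fin L.length ⊕ Fin (S.arity d).length) :
      Quot.mk (Glue (ofCospan (𝟙 _) (Cxt.appendOf L (S.arity d) ≫ Cxt.desc (𝟙 _) p))
        (freeSources L d t ht)) (.inl ((Cxt.desc (𝟙 (Cxt.word L)) p).toFun j)) =
      Quot.mk _ (.inr j) := by
    obtain ⟨i, rfl⟩ := (position L (S.arity d)).surjective j
    exact Quot.sound (Glue.glue (G := ofCospan (𝟙 _) (Cxt.appendOf L (S.arity d) ≫
      Cxt.desc (𝟙 _) p)) (H := freeSources L d t ht) i)
  refine comp_isIso (Sum.elim id (Cxt.desc (𝟙 (Cxt.word L)) p).toFun) Sum.inl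
    (Equiv.emptySum Empty Unit) (fun _ => rfl) (fun _ => rfl) ?_ ?_ ?_ ?_ ?_ ?_ ?_ (fun _ => rfl)
      (fun _ => rfl)
  · rintro (l | j)
    · rfl
    · exact g j
  · rintro (l | j)
    · rfl
    · exact (Cxt.desc (𝟙 (Cxt.word L)) p).lab_eq j
  · rintro (a | a)
    · exact a.elim
    · rfl
  · exact fun a => a.elim
  · rintro -
    change s = List.map _ (List.map _ _)
    rw [List.map_map]
    exact (map_ofList_finRange (Cxt.word L) s hs).symm
  · exact fun a => a.elim
  · rintro -
    change t = List.map _ (List.map _ _)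
    rw [List.map_map]
    exact (List.map_id t).symm

/-- When both interfaces are identities on `L`, gluing identifies the two node sets and takes the
disjoint union of the hyperedges. -/
theorem comp_onWord (L : List S.Obj) {E E' E'' : Type} (i : E ⊕ E' ≃ E'') (fin : Finite E)
    (fin' : Finite E') (fin'' : Finite E'') (d : E'' → S.Op) (s t : E'' → List (Fin L.length))
    (hs : ∀ e, (s e).map L.get = S.arity (d e)) (ht : ∀ e, (t e).map L.get = S.coarity (d e)) :
    IsIso (comp (onWord L E fin (fun e => d (i (.inl e))) (fun e => s (i (.inl e)))
      (fun e => t (i (.inl e))) (fun _ => hs _) (fun _ => ht _))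
      (onWord L E' fin' (fun e => d (i (.inr e))) (fun e => s (i (.inr e)))
      (fun e => t (i (.inr e))) (fun _ => hs _) (fun _ => ht _)))
      (onWord L E'' fin'' d s t hs ht) := by
  refine comp_isIso (Sum.elim id id) Sum.inl i (fun _ => rfl) (fun _ => rfl) ?_ ?_ ?_ ?_ ?_ ?_ ?_
    (fun _ => rfl) (fun _ => rfl)
  · rintro (l | l)
    · rfl
    · exact Quot.sound (Glue.glue (G := onWord L E fin (fun e => d (i (.inl e)))
        (fun e => s (i (.inl e))) (fun e => t (i (.inl e))) (fun _ => hs _) (fun _ => ht _))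
        (H := onWord L E' fin' (fun e => d (i (.inr e))) (fun e => s (i (.inr e)))
        (fun e => t (i (.inr e))) (fun _ => hs _) (fun _ => ht _)) l)
  · rintro (l | l) <;> rfl
  · rintro (a | a) <;> rfl
  · exact fun a => (List.map_id _).symm
  · exact fun a => (List.map_id _).symm
  · exact fun a => (List.map_id _).symm
  · exact fun a => (List.map_id _).symm

end OpenHypergraph

theorem definable_onWord_unit (L : List S.Obj) (d : S.Op) (s t : List (Fin L.length))
    (hs : s.map L.get = S.arity d) (ht : t.map L.get = S.coarity d) :
    Definable (HypHom.mk (onWord L Unit inferInstance (fun _ => d) (fun _ => s) (fun _ => t)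
      (fun _ => hs) fun _ => ht)) := by
  have hd : Definable (HypHom.mk (ofOp d)) := ⟨Term.op (S := S.addFrob) (.inl d), rfl⟩
  have h₁ := ((definable_idn L).tensor hd).comp (definableMap (S := S)
    (Cxt.appendOf L (S.coarity d) ≫ Cxt.desc (𝟙 _) (Cxt.ofList (Cxt.word L) t ht))).1
  have h₂ : Definable (HypHom.mk (freeSources L d t ht)) :=
    Eq.mp (congrArg Definable (cls_eq (comp_freeSources L d t ht))) h₁
  have h₃ := (definableMap (S := S) (Cxt.appendOf L (S.arity d) ≫
    Cxt.desc (𝟙 _) (Cxt.ofList (Cxt.word L) s hs))).2.comp h₂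
  exact Eq.mp (congrArg Definable (cls_eq (comp_onWord_unit L d s t hs ht))) h₃

/-- Induction on the number of hyperedges, composing with one further hyperedge at a time over the
same nodes. -/
theorem definable_onWord (L : List S.Obj) (E : Type) (fin : Finite E) :
    ∀ (d : E → S.Op) (s t : E → List (Fin L.length)) (hs : ∀ e, (s e).map L.get = S.arity (d e))
      (ht : ∀ e, (t e).map L.get = S.coarity (d e)),
      Definable (HypHom.mk (onWord L E fin d s t hs ht)) := by
  refine Finite.induction_empty_option (P := fun E : Type => ∀ (fin : Finite E) (d : E → S.Op)
      (s t : E → List (Fin L.length)) (hs : ∀ e, (s e).map L.get = S.arity (d e))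
      (ht : ∀ e, (t e).map L.get = S.coarity (d e)),
      Definable (HypHom.mk (onWord L E fin d s t hs ht))) ?_ ?_ ?_ E fin
  · intro E E' i h fin' d s t hs ht
    have := h (Finite.of_equiv _ i.symm) (fun e => d (i e)) (fun e => s (i e)) (fun e => t (i e))
      (fun e => hs _) (fun e => ht _)
    have e : HypHom.mk (onWord L E (Finite.of_equiv _ i.symm) (fun e => d (i e)) (fun e => s (i e))
        (fun e => t (i e)) (fun e => hs _) (fun e => ht _)) =
        HypHom.mk (onWord L E' fin' d s t hs ht) :=
      cls_eq (isIso_of_equiv (Equiv.refl _) i (fun _ => rfl) (fun _ => rfl)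
        (fun a => (List.map_id _).symm) (fun a => (List.map_id _).symm) (fun _ => rfl)
        (fun _ => rfl))
    exact e ▸ this
  · intro fin d s t hs ht
    have e : HypHom.mk (idn L) = HypHom.mk (onWord L PEmpty fin d s t hs ht) :=
      cls_eq (isIso_of_equiv (Equiv.refl _) (Equiv.equivOfIsEmpty Empty PEmpty) (fun _ => rfl)
        (fun a => a.elim) (fun a => a.elim) (fun a => a.elim) (fun _ => rfl) (fun _ => rfl))
    exact e ▸ definable_idn L
  · intro E _ h fin d s t hs ht
    let i : E ⊕ Unit ≃ Option E := (Equiv.optionEquivSumPUnit E).symm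
    have h₁ := (h inferInstance (fun e => d (i (.inl e))) (fun e => s (i (.inl e)))
      (fun e => t (i (.inl e))) (fun _ => hs _) (fun _ => ht _)).comp
      (definable_onWord_unit L (d (i (.inr ()))) (s (i (.inr ()))) (t (i (.inr ()))) (hs _) (ht _))
    have e : HypHom.comp (HypHom.mk _) (HypHom.mk _) =
        HypHom.mk (onWord L (Option E) fin d s t hs ht) :=
      cls_eq (comp_onWord L i inferInstance inferInstance fin d s t hs ht)
    exact e ▸ h₁

theorem definable {v w : List S.Obj} (c : HypHom S v w) : Definable c := by
  induction c using Quotient.inductionOn with | _ G => ?_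
  have := G.carrier.finite_node
  let e := Finite.equivFin G.carrier.Node
  -- An enumeration of the nodes turns the node set into the positions of a word. The two legs of
  -- the cospan then become maps of words, the right one being used in reverse.
  let L : List S.Obj := List.ofFn fun i => G.carrier.nodeLabel (e.symm i)
  have hL : Nat.card G.carrier.Node = L.length := (List.length_ofFn ..).symm
  let n : G.carrier.Node ≃ Fin L.length := e.trans (finCongr hL)
  have hn (a : G.carrier.Node) : L.get (n a) = G.carrier.nodeLabel a := by
    simp [L, n]
  let H := onWord L G.carrier.Edge G.carrier.finite_edge G.carrier.edgeLabel
    (fun e => (G.carrier.source e).map n) (fun e => (G.carrier.target e).map n)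
    (fun e => by
      rw [List.map_map, ← G.carrier.map_source]
      exact List.map_congr_left fun a _ => hn a)
    (fun e => by
      rw [List.map_map, ← G.carrier.map_target]
      exact List.map_congr_left fun a _ => hn a)
  let p : Cxt.word v ⟶ Cxt.word L :=
    ⟨fun i => n (G.left.node i), fun i => (hn _).trans (G.left.nodeLabel i)⟩
  let q : Cxt.word w ⟶ Cxt.word L :=
    ⟨fun i => n (G.right.node i), fun i => (hn _).trans (G.right.nodeLabel i)⟩
  have h := ((definableMap (S := S) p).1.comp (definable_onWord L G.carrier.Edge
    G.carrier.finite_edge _ _ _ _ _ : Definable (HypHom.mk H))).comp (definableMap (S := S) q).2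
  have h₁ : HypHom.comp (HypHom.mk (ofCospan p (𝟙 _))) (HypHom.mk H) =
      HypHom.mk (reindexLeft H p.toFun p.lab_eq) := cls_eq (cowiring_comp p H)
  have h₂ : HypHom.comp (HypHom.mk (reindexLeft H p.toFun p.lab_eq))
      (HypHom.mk (ofCospan (𝟙 _) q)) =
      HypHom.mk (reindexRight (reindexLeft H p.toFun p.lab_eq) q.toFun q.lab_eq) :=
    cls_eq (comp_wiring _ q.toFun q.lab_eq)
  have h₃ : HypHom.mk G = HypHom.mk (reindexRight (reindexLeft H p.toFun p.lab_eq) q.toFun q.lab_eq) :=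
    cls_eq (isIso_of_equiv n (Equiv.refl _) hn (fun _ => rfl) (fun _ => rfl) (fun _ => rfl)
      (fun _ => rfl) (fun _ => rfl))
  rw [h₁, h₂, ← h₃] at h
  exact h

end Edges

/-! ### The isomorphism of categories. -/

section Isomorphism

variable (S : Signature.{u, v})

/-- The interpretation of string diagrams as open hypergraphs. -/
def interpDiagram {v w : List S.Obj} (c : Diagram (scFrob S) v w) : HypHom S v w :=
  Quotient.lift (interp S) (fun _ _ h => interp_sound h) c

/-- Injectivity comes from the denotation in the free category, surjectivity from the decomposition
of hypergraphs. As the functor is the identity on words, bijectivity on each hom-set is all that an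
isomorphism of categories requires. -/
theorem interpDiagram_bijective (v w : List S.Obj) :
    Function.Bijective (interpDiagram S (v := v) (w := w)) := by
  constructor
  · intro c d h
    induction c using Quotient.inductionOn
    induction d using Quotient.inductionOn
    exact mk_eq_of_interp_eq S h
  · intro c
    obtain ⟨t, rfl⟩ := definable c
    exact ⟨Diagram.mk _ t, rfl⟩

theorem interpDiagram_par {v w v' w' : List S.Obj} (c : Diagram (scFrob S) v w)
    (d : Diagram (scFrob S) v' w') :
    interpDiagram S (c.par d) = (interpDiagram S c).tensor (interpDiagram S d) := by
  induction c using Quotient.inductionOn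
  induction d using Quotient.inductionOn
  rfl

/-- The interpretation functor. -/
def interpFunctor : FreeSMC (scFrob S) ⥤ Hyp S where
  obj X := ⟨X.word⟩
  map f := interpDiagram S f
  map_id X := interp_idWord S X.word
  map_comp f g := by
    induction f using Quotient.inductionOn
    induction g using Quotient.inductionOn
    rfl

/-- The inverse of the interpretation of string diagrams. -/
noncomputable def interpEquiv (v w : List S.Obj) : Diagram (scFrob S) v w ≃ HypHom S v w :=
  Equiv.ofBijective _ (interpDiagram_bijective S v w)

/-- The inverse of the interpretation functor. -/
noncomputable def interpInverse : Hyp S ⥤ FreeSMC (scFrob S) where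
  obj X := ⟨X.word⟩
  map {X Y} f := (interpEquiv S X.word Y.word).symm f
  map_id X := (interpEquiv S _ _).symm_apply_eq.mpr ((interpFunctor S).map_id ⟨X.word⟩).symm
  map_comp {X Y Z} f g := (interpEquiv S _ _).symm_apply_eq.mpr <| by
    have h := (interpFunctor S).map_comp (X := ⟨X.word⟩) (Y := ⟨Y.word⟩) (Z := ⟨Z.word⟩)
      ((interpEquiv S _ _).symm f) ((interpEquiv S _ _).symm g)
    refine Eq.trans ?_ h.symm
    exact congrArg₂ HypHom.comp ((interpEquiv S _ _).apply_symm_apply f).symm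
      ((interpEquiv S _ _).apply_symm_apply g).symm

end Isomorphism

end StringDiag

/-- The interpretation of terms as open hypergraphs induces an isomorphism of strict symmetric monoidal
categories from the free symmetric monoidal category on `S + scFrob`, modulo the axioms of special
commutative Frobenius structures, to the category of `S`-labelled open hypergraphs. -/
theorem mainTheorem3 (S : Signature.{u, v}) :
    ∃ (F : FreeSMC (scFrob S) ⥤ Hyp S) (G : Hyp S ⥤ FreeSMC (scFrob S)),
      F ⋙ G = 𝟭 (FreeSMC (scFrob S)) ∧ G ⋙ F = 𝟭 (Hyp S) ∧
      IsStrictSymmetricMonoidal F ∧ IsStrictSymmetricMonoidal G ∧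
      (∀ X : FreeSMC (scFrob S), F.obj X = ⟨X.word⟩) ∧
      (∀ (X Y : FreeSMC (scFrob S)) (t : Term S.addFrob X.word Y.word),
        HEq (F.map (Diagram.mk (scFrob S) t : X ⟶ Y)) (interp S t)) := by
  refine ⟨interpFunctor S, interpInverse S, ?_, ?_, ?_, ?_, fun _ => rfl, fun _ _ _ => HEq.rfl⟩
  · exact CategoryTheory.Functor.hext (fun _ => rfl) fun X Y f => heq_of_eq <| by
      exact (interpEquiv S _ _).symm_apply_apply f
  · exact CategoryTheory.Functor.hext (fun _ => rfl) fun X Y f => heq_of_eq <| by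
      exact (interpEquiv S _ _).apply_symm_apply f
  · exact ⟨fun _ _ => rfl, rfl, fun f g => heq_of_eq (interpDiagram_par S f g),
      fun X Y => heq_of_eq (interp_swapWord S X.word Y.word)⟩
  -- Strictness of the inverse follows from that of the interpretation: each required equation is
  -- checked after applying the bijection.
  · refine ⟨fun _ _ => rfl, rfl, fun {X₁ Y₁ X₂ Y₂} f g => heq_of_eq ?_, fun X Y => heq_of_eq ?_⟩
    · refine (interpEquiv S _ _).symm_apply_eq.mpr (Eq.trans ?_ (interpDiagram_par S _ _).symm)
      exact congrArg₂ HypHom.tensor ((interpEquiv S _ _).apply_symm_apply f).symm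
        ((interpEquiv S _ _).apply_symm_apply g).symm
    · exact (interpEquiv S _ _).symm_apply_eq.mpr (interp_swapWord S X.word Y.word).symm
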